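/- Let $Q=[0,1)^2$, let $Q_0\subset\mathbb R^2$ be a non-empty open set with $\overline{Q_0}\subset Q$ whose boundary has Lebesgue measure zero (for instance, a smooth boundary), and put $Q_1=Q\setminus\overline{Q_0}$. Let $F_0,F_1$ be the $Q$-periodic extensions of $Q_0,Q_1$ to $\mathbb R^2$ and $\chi_0,\chi_1$ their characteristic functions. Let $\epsilon_0>\epsilon_1>0$ be constants and $\gamma=\epsilon_0/\epsilon_1-1$. For $\varepsilon>0$ with $\varepsilon^2<\epsilon_1$ put $s_\varepsilon=\sqrt{1-\varepsilon^2/\epsilon_1}$ and $$A_1^\varepsilon=\begin{pmatrix}1&0&0&s_\varepsilon\\0&1&-s_\varepsilon&0\\0&-s_\varepsilon&1&0\\s_\varepsilon&0&0&1\end{pmatrix},\quad A_0^\varepsilon=\begin{pmatrix}\epsilon_0/\epsilon_1&0&0&s_\varepsilon\\0&1&-s_\varepsilon&0\\0&-s_\varepsilon&\epsilon_0/\epsilon_1&0\\s_\varepsilon&0&0&1\end{pmatrix},\quad \rho=\chi_1\begin{pmatrix}1&0\\0&1\end{pmatrix}+\chi_0\begin{pmatrix}\epsilon_0/\epsilon_1&0\\0&1\end{pmatrix},$$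 where the $4\times4$ matrices act on gradients $\nabla u$ of $\mathbb C^2$-valued functions written as $(\partial_1u_1,\partial_1u_2,\partial_2u_1,\partial_2u_2)^T$. For $f^\varepsilon\in[L^2(\mathbb R^2)]^2$ the high-contrast resolvent problem at scale $\varepsilon$ is: $u^\varepsilon\in[H^1(\mathbb R^2)]^2$ and, for all $\phi\in[C_0^\infty(\mathbb R^2)]^2$, $$\int_{\mathbb R^2}\Big(\chi_1(\tfrac x\varepsilon)A_1^\varepsilon+\tfrac{\varepsilon^2}{\epsilon_0-\epsilon_1+\varepsilon^2}\chi_0(\tfrac x\varepsilon)A_0^\varepsilon\Big)\nabla u^\varepsilon\cdot\overline{\nabla\phi}\,dx+\int_{\mathbb R^2}\rho(\tfrac x\varepsilon)u^\varepsilon\cdot\overline\phi\,dx=\int_{\mathbb R^2}\rho(\tfrac x\varepsilon)f^\varepsilon\cdot\overline\phi\,dx .$$ For $N=(N_1,N_2)$ with integers $N_1,N_2\ge1$ let $NQ=[0,N_1)\times[0,N_2)$. A bounded sequence $w_n$ in $L^2(\mathbb R^2)$ two-scale converges, with respect to $NQ$ and along scales $\varepsilon_n\to0^+$, to $w\in L^2(\mathbb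 R^2\times NQ)$ if for all $\varphi\in C_0^\infty(\mathbb R^2)$ and all smooth $NQ$-periodic $\psi$ $$\int_{\mathbb R^2}w_n(x)\varphi(x)\psi(x/\varepsilon_n)\,dx\to\frac1{N_1N_2}\int_{\mathbb R^2}\int_{NQ}w(x,y)\varphi(x)\psi(y)\,dy\,dx ;$$ for vector-valued sequences this is meant componentwise. Let $H^1_\#(NQ)$ be the closure of the smooth $NQ$-periodic functions in the $H^1(NQ)$ norm, $v^\perp=(-v_2,v_1)$, and $$V_N=\{v\in[H^1_\#(NQ)]^2:\ \operatorname{div}v=0\ \text{and}\ \operatorname{div}v^\perp=0\ \text{in }F_1\cap NQ\}$$ with the $H^1$ norm; $V=V_{(1,1)}$. **Theorem.** Let $N$ be as above, let $\varepsilon_n>0$ with $\varepsilon_n\to0$, let $f^{\varepsilon_n}\in[L^2(\mathbb R^2)]^2$ two-scale converge with respect to $NQ$ to $f\in[L^2(\mathbb R^2\times NQ)]^2$, and let $u^{\varepsilon_n}\in[H^1(\mathbb R^2)]^2$ solve, for all sufficiently large $n$, the high-contrast resolvent problem at scale $\varepsilon_n$ with data $f^{\varepsilon_n}$. Then there is $u\in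 L^2(\mathbb R^2;V_N)$ such that a subsequence of $u^{\varepsilon_n}$ two-scale converges to $u$ with respect to $NQ$, and $u$ is the unique element of $L^2(\mathbb R^2;V_N)$ satisfying, for all $\phi\in C_0^\infty(\mathbb R^2;V_N)$, $$\int_{\mathbb R^2}\!\int_{NQ}\nabla_yu_1\cdot\overline{\nabla_y\phi_1}+\gamma^{-1}\big(\operatorname{div}_yu\,\overline{\operatorname{div}_y\phi}+\operatorname{div}_yu^\perp\,\overline{\operatorname{div}_y\phi^\perp}\big)\,dy\,dx+\int_{\mathbb R^2}\!\int_{NQ}\epsilon_1\big(u\cdot\overline\phi+\gamma\chi_0u_1\overline{\phi_1}\big)\,dy\,dx=\int_{\mathbb R^2}\!\int_{NQ}\epsilon_1\big(f\cdot\overline\phi+\gamma\chi_0f_1\overline{\phi_1}\big)\,dy\,dx .$$ The case $N=(1,1)$ is the statement for the cell $Q$ and the space $V$. -/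

import Mathlib

open MeasureTheory Filter Topology
open scoped ContDiff ComplexConjugate NNReal

noncomputable section

namespace PhotonicFibre

/-- The plane `ℝ²` with Lebesgue measure (only its topology, its smooth structure and its measure
are used, never a norm). -/
abbrev Plane : Type := Fin 2 → ℝ

/-- Values in `ℂ²` with the Hermitian norm. -/
abbrev C2 : Type := EuclideanSpace ℂ (Fin 2)

/-- First-order jets of `ℂ²`-valued functions: the coordinate `(i, none)` stands for `v_i` and the
coordinate `(i, some j)` stands for `∂_j v_i`. -/
abbrev Jet : Type := EuclideanSpace ℂ (Fin 2 × Option (Fin 2))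

/-- The value `(v_1, v_2)` contained in a jet. -/
def Jet.val (p : Jet) : Fin 2 → ℂ := fun i => p (i, none)

/-- The derivative `∂_j v_i` contained in a jet. -/
def Jet.der (p : Jet) (i j : Fin 2) : ℂ := p (i, some j)

/-- `div v = ∂_1 v_1 + ∂_2 v_2`. -/
def Jet.div (p : Jet) : ℂ := p.der 0 0 + p.der 1 1

/-- `div v^⊥ = -∂_1 v_2 + ∂_2 v_1`, where `v^⊥ = (-v_2, v_1)`. -/
def Jet.divPerp (p : Jet) : ℂ := -p.der 1 0 + p.der 0 1

/-- The gradient in the order `(∂_1 v_1, ∂_1 v_2, ∂_2 v_1, ∂_2 v_2)`. -/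
def Jet.grad (p : Jet) : Fin 4 → ℂ := ![p.der 0 0, p.der 1 0, p.der 0 1, p.der 1 1]

/-- The partial derivative `∂_j ψ (y)`. -/
def pderiv {E : Type*} [NormedAddCommGroup E] [NormedSpace ℝ E] (j : Fin 2) (ψ : Plane → E)
    (y : Plane) : E := fderiv ℝ ψ y (Pi.single j 1)

/-- The jet `(v, ∇ v)(y)` of a differentiable function `v`. -/
def jet (v : Plane → C2) (y : Plane) : Jet :=
  WithLp.toLp 2 fun p => match p with
    | (i, none) => v y i
    | (i, some j) => pderiv j v y i

theorem jet_add {v w : Plane → C2} (hv : Differentiable ℝ v) (hw : Differentiable ℝ w)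
    (y : Plane) : jet (v + w) y = jet v y + jet w y := by
  ext ⟨i, o⟩
  cases o with
  | none => simp [jet]
  | some j => simp [jet, pderiv, fderiv_add (hv y) (hw y)]

theorem jet_smul (c : ℂ) {v : Plane → C2} (hv : Differentiable ℝ v) (y : Plane) :
    jet (c • v) y = c • jet v y := by
  ext ⟨i, o⟩
  cases o with
  | none => simp [jet]
  | some j => simp [jet, pderiv, fderiv_const_smul (hv y) c]

/-- The jets of smooth functions in a given linear class `S`, inside `L²(μ)`; the norm of
`L²(μ; Jet)` is the `H¹` norm `(∫ |v|² + |∇v|² dμ)^{1/2}`. -/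
def smoothJets (μ : Measure Plane) (S : Submodule ℂ (Plane → C2)) :
    Submodule ℂ (Lp Jet 2 μ) where
  carrier := {w | ∃ v ∈ S, ContDiff ℝ ∞ v ∧ w =ᵐ[μ] jet v}
  zero_mem' := by
    refine ⟨0, S.zero_mem, contDiff_const, ?_⟩
    filter_upwards [Lp.coeFn_zero Jet 2 μ] with y hy
    rw [hy]
    ext ⟨i, o⟩
    cases o <;> simp [jet, pderiv]
  add_mem' := by
    rintro a b ⟨v, hv, hvs, hav⟩ ⟨w, hw, hws, hbw⟩
    refine ⟨v + w, S.add_mem hv hw, hvs.add hws, ?_⟩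
    filter_upwards [hav, hbw, Lp.coeFn_add a b] with y h1 h2 h3
    rw [h3, Pi.add_apply, h1, h2,
      jet_add (hvs.differentiable (by simp)) (hws.differentiable (by simp))]
  smul_mem' := by
    rintro c a ⟨v, hv, hvs, hav⟩
    refine ⟨c • v, S.smul_mem c hv, hvs.const_smul c, ?_⟩
    filter_upwards [hav, Lp.coeFn_smul c a] with y h1 h3
    rw [h3, Pi.smul_apply, h1, jet_smul c (hvs.differentiable (by simp))]

/-- Functions of compact support. -/
def compactSupportFns : Submodule ℂ (Plane → C2) where
  carrier := {v | HasCompactSupport v}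
  zero_mem' := HasCompactSupport.zero
  add_mem' := fun h1 h2 => h1.add h2
  smul_mem' := fun c _ h => h.smul_left (f := fun _ => c)

/-- `ψ` is periodic with the periods `N_1` in `y_1` and `N_2` in `y_2`. -/
def IsCellPeriodic {E : Type*} (N : Fin 2 → ℕ) (ψ : Plane → E) : Prop :=
  ∀ (i : Fin 2) (y : Plane), ψ (y + Pi.single i (N i : ℝ)) = ψ y

/-- Cell-periodic functions. -/
def cellPeriodicFns (N : Fin 2 → ℕ) : Submodule ℂ (Plane → C2) where
  carrier := {v | IsCellPeriodic N v}
  zero_mem' := fun _ _ => rfl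
  add_mem' := fun h1 h2 i y => by simp [h1 i y, h2 i y]
  smul_mem' := fun c v h i y => by simp [h i y]

/-- The cell `NQ = [0, N_1) × [0, N_2)`; the unit cell `Q` is the case `N = (1, 1)`. -/
def cell (N : Fin 2 → ℕ) : Set Plane := {y | ∀ i, y i ∈ Set.Ico (0 : ℝ) (N i)}

/-- Lebesgue measure on `NQ`. -/
def cellMeasure (N : Fin 2 → ℕ) : Measure Plane := volume.restrict (cell N)

/-- `[H¹(ℝ²)]²`: the closure of `[C₀^∞(ℝ²)]²` in the `H¹` norm, an element being given by the pair
`(v, ∇v)`. -/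
def H1Plane : Submodule ℂ (Lp Jet 2 (volume : Measure Plane)) :=
  (smoothJets volume compactSupportFns).topologicalClosure

/-- `[H¹_#(NQ)]²`: the closure of the smooth `NQ`-periodic functions in the `H¹(NQ)` norm, an
element being given by the pair `(v, ∇v)`. -/
def H1Per (N : Fin 2 → ℕ) : Submodule ℂ (Lp Jet 2 (cellMeasure N)) :=
  (smoothJets (cellMeasure N) (cellPeriodicFns N)).topologicalClosure

/-- The `Q`-periodic extension to the plane of a subset `S` of `Q = [0,1)²`. -/
def perExt (S : Set Plane) : Set Plane := {y | (fun i => Int.fract (y i)) ∈ S}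

/-- `F_0`, the periodic extension of the inclusion `Q_0`. -/
def F0 (Q₀ : Set Plane) : Set Plane := perExt Q₀

/-- `F_1`, the periodic extension of the matrix part `Q_1 = Q ∖ closure Q_0`. -/
def F1 (Q₀ : Set Plane) : Set Plane := perExt (cell 1 \ closure Q₀)

/-- The characteristic function `χ_0` of `F_0`. -/
def chi0 (Q₀ : Set Plane) (y : Plane) : ℂ := (F0 Q₀).indicator 1 y

/-- The characteristic function `χ_1` of `F_1`. -/
def chi1 (Q₀ : Set Plane) (y : Plane) : ℂ := (F1 Q₀).indicator 1 y

/-- `V_N = {v ∈ [H¹_#(NQ)]² : div v = 0 and div v^⊥ = 0 in F_1 ∩ NQ}` with the `H¹` norm;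
`V` is `V_N` for `N = (1, 1)`. -/
def V (N : Fin 2 → ℕ) (Q₀ : Set Plane) : Submodule ℂ (Lp Jet 2 (cellMeasure N)) where
  carrier := {v | v ∈ H1Per N ∧
    ∀ᵐ y ∂(cellMeasure N), y ∈ F1 Q₀ → (v y).div = 0 ∧ (v y).divPerp = 0}
  zero_mem' := by
    refine ⟨(H1Per N).zero_mem, ?_⟩
    filter_upwards [Lp.coeFn_zero Jet 2 (cellMeasure N)] with y hy _
    rw [hy]
    simp [Jet.div, Jet.divPerp, Jet.der]
  add_mem' := by
    rintro a b ⟨ha, ha'⟩ ⟨hb, hb'⟩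
    refine ⟨(H1Per N).add_mem ha hb, ?_⟩
    filter_upwards [ha', hb', Lp.coeFn_add a b] with y h1 h2 h3 hy
    have e1 := (h1 hy).1
    have e2 := (h1 hy).2
    have e3 := (h2 hy).1
    have e4 := (h2 hy).2
    simp only [Jet.div, Jet.divPerp, Jet.der] at *
    constructor
    · simp only [h3, Pi.add_apply, PiLp.add_apply]
      linear_combination e1 + e3
    · simp only [h3, Pi.add_apply, PiLp.add_apply]
      linear_combination e2 + e4
  smul_mem' := by
    rintro c a ⟨ha, ha'⟩
    refine ⟨(H1Per N).smul_mem c ha, ?_⟩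
    filter_upwards [ha', Lp.coeFn_smul c a] with y h1 h3 hy
    have e1 := (h1 hy).1
    have e2 := (h1 hy).2
    simp only [Jet.div, Jet.divPerp, Jet.der] at *
    constructor
    · simp only [h3, Pi.smul_apply, PiLp.smul_apply, smul_eq_mul]
      linear_combination c * e1
    · simp only [h3, Pi.smul_apply, PiLp.smul_apply, smul_eq_mul]
      linear_combination c * e2

/-- Two-scale convergence with respect to the cell `NQ` along the scales `δ n` of a bounded
sequence `w n` in `L²(ℝ²)` to `g = g(x, y)`; it is used for those `g` that are square integrable
over `ℝ² × NQ`. -/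
def TwoScaleConverges (N : Fin 2 → ℕ) (δ : ℕ → ℝ) (w : ℕ → Plane → ℂ)
    (g : Plane → Plane → ℂ) : Prop :=
  (∃ C : ℝ≥0, ∀ n, MemLp (w n) 2 volume ∧ eLpNorm (w n) 2 volume ≤ C) ∧
  ∀ φ : Plane → ℂ, ContDiff ℝ ∞ φ → HasCompactSupport φ →
  ∀ ψ : Plane → ℂ, ContDiff ℝ ∞ ψ → IsCellPeriodic N ψ →
    Tendsto (fun n => ∫ x, w n x * φ x * ψ ((δ n)⁻¹ • x)) atTop
      (𝓝 (((N 0 : ℂ) * (N 1 : ℂ))⁻¹ * ∫ x, ∫ y, g x y * φ x * ψ y ∂(cellMeasure N)))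

/-- The number `√(1 - δ²/ε₁)`. -/
def offDiag (ε₁ δ : ℝ) : ℝ := Real.sqrt (1 - δ ^ 2 / ε₁)

/-- The tensor `A_1^δ` of the matrix phase, acting on gradients ordered as in `Jet.grad`. -/
def A1 (ε₁ δ : ℝ) : Matrix (Fin 4) (Fin 4) ℝ :=
  !![1, 0, 0, offDiag ε₁ δ;
     0, 1, -offDiag ε₁ δ, 0;
     0, -offDiag ε₁ δ, 1, 0;
     offDiag ε₁ δ, 0, 0, 1]

/-- The tensor `A_0^δ` of the inclusions. -/
def A0 (ε₀ ε₁ δ : ℝ) : Matrix (Fin 4) (Fin 4) ℝ :=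
  !![ε₀ / ε₁, 0, 0, offDiag ε₁ δ;
     0, 1, -offDiag ε₁ δ, 0;
     0, -offDiag ε₁ δ, ε₀ / ε₁, 0;
     offDiag ε₁ δ, 0, 0, 1]

/-- The high-contrast tensor `χ_1(y) A_1^δ + δ²/(ε₀ - ε₁ + δ²) χ_0(y) A_0^δ`. -/
def tensorA (Q₀ : Set Plane) (ε₀ ε₁ δ : ℝ) (y : Plane) : Matrix (Fin 4) (Fin 4) ℂ :=
  chi1 Q₀ y • (A1 ε₁ δ).map Complex.ofReal +
    (((δ ^ 2 / (ε₀ - ε₁ + δ ^ 2) : ℝ) : ℂ) * chi0 Q₀ y) • (A0 ε₀ ε₁ δ).map Complex.ofReal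

/-- The weight `ρ(y) = χ_1(y) I + χ_0(y) diag(ε₀/ε₁, 1)`. -/
def rho (Q₀ : Set Plane) (ε₀ ε₁ : ℝ) (y : Plane) : Matrix (Fin 2) (Fin 2) ℂ :=
  chi1 Q₀ y • !![1, 0; 0, 1] + chi0 Q₀ y • !![((ε₀ / ε₁ : ℝ) : ℂ), 0; 0, 1]

/-- `a · b̄ = ∑ a_i conj(b_i)`. -/
def cdot {ι : Type*} [Fintype ι] (a b : ι → ℂ) : ℂ := ∑ i, a i * conj (b i)

/-- `u ∈ [H¹(ℝ²)]²` solves the high-contrast resolvent problem at scale `δ` with data `f`. -/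
def IsResolventSolution (Q₀ : Set Plane) (ε₀ ε₁ δ : ℝ) (f : Lp C2 2 (volume : Measure Plane))
    (u : H1Plane) : Prop :=
  ∀ φ : Plane → C2, ContDiff ℝ ∞ φ → HasCompactSupport φ →
    (∫ x, cdot ((tensorA Q₀ ε₀ ε₁ δ (δ⁻¹ • x)).mulVec (u.1 x).grad) (jet φ x).grad) +
      (∫ x, cdot ((rho Q₀ ε₀ ε₁ (δ⁻¹ • x)).mulVec (u.1 x).val) (φ x)) =
    ∫ x, cdot ((rho Q₀ ε₀ ε₁ (δ⁻¹ • x)).mulVec (f x)) (φ x)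

/-- `γ = ε₀/ε₁ - 1`. -/
def gam (ε₀ ε₁ : ℝ) : ℝ := ε₀ / ε₁ - 1

/-- `∇v_1 · conj(∇w_1) + γ⁻¹ (div v conj(div w) + div v^⊥ conj(div w^⊥))`. -/
def limitForm (ε₀ ε₁ : ℝ) (p q : Jet) : ℂ :=
  cdot (p.der 0) (q.der 0) +
    (((gam ε₀ ε₁)⁻¹ : ℝ) : ℂ) * (p.div * conj q.div + p.divPerp * conj q.divPerp)

/-- `ε₁ (a · b̄ + γ χ_0(y) a_1 conj(b_1))`. -/
def limitWeight (Q₀ : Set Plane) (ε₀ ε₁ : ℝ) (y : Plane) (a b : Fin 2 → ℂ) : ℂ :=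
  (ε₁ : ℂ) * (cdot a b + (gam ε₀ ε₁ : ℂ) * chi0 Q₀ y * (a 0 * conj (b 0)))

/-- `u ∈ L²(ℝ²; V_N)` solves the two-scale limit problem with data `f ∈ [L²(ℝ² × NQ)]²`; the test
functions are `φ ∈ C₀^∞(ℝ²; V_N)`. -/
def IsLimitSolution (N : Fin 2 → ℕ) (Q₀ : Set Plane) (ε₀ ε₁ : ℝ)
    (f : Lp C2 2 ((volume : Measure Plane).prod (cellMeasure N)))
    (u : Lp (V N Q₀) 2 (volume : Measure Plane)) : Prop :=
  ∀ φ : Plane → V N Q₀, ContDiff ℝ ∞ φ → HasCompactSupport φ →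
    (∫ x, ∫ y, limitForm ε₀ ε₁ ((u x).1 y) ((φ x).1 y) ∂(cellMeasure N)) +
      (∫ x, ∫ y, limitWeight Q₀ ε₀ ε₁ y ((u x).1 y).val ((φ x).1 y).val ∂(cellMeasure N)) =
    ∫ x, ∫ y, limitWeight Q₀ ε₀ ε₁ y (f (x, y)) ((φ x).1 y).val ∂(cellMeasure N)

end PhotonicFibre

end

open PhotonicFibre

noncomputable section
namespace PhotonicFibre

/-! The proof combines periodic unfolding with a rigidity property of the Cauchy–Riemann system on a
torus. On gradients, the form of the matrix-phase tensor is `s (|div v|² + |div v^⊥|²) + (1 - s)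
|∇v|²` with `s = offDiag ε₁ ε` (`inner_flux`), and `1 - s` is of order `ε²`. The matrix is therefore
stiff only with respect to `(div, div^⊥)`, while the full gradient costs order `ε²` in both phases.
Testing the problem with its own solution bounds `u`, `ε∇u` and `χ₁ (div u, div u^⊥)` in `L²`
(`exists_energy_bound`).

Unfolding multiplies `L²` norms by a constant, so bounded sequences have weak limits in `L²(ℝ²;
L²(NQ))`, and weak convergence of unfoldings is two-scale convergence (`exists_subseq_TS`). Let `W`,
`P`, `F` be the limits of `(u, ε∇u)`, of the matrix-phase divergences and of the data. A periodic
vector orthogonal to `H1Per N` is orthogonal to `W x`, by periodizing test functions; hence `W x` is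
the jet of a periodic `H¹` function (`ae_mem_H1Per`). The divergences of `W x` in `F_1` are limits
of `ε` times a bounded sequence, so `W x ∈ V N Q₀`.

The problem is then tested with `η(x) b(x/ε)` (`IsResolventSolution.osc_eq`). For general periodic
`b` the term of order `ε⁻¹` dominates and makes `P x` orthogonal to every `(div b, div b^⊥)`. By
Fourier series such a field is constant; it vanishes on the inclusions, which have positive measure,
so it is zero (`eq_zero_of_orthogonal_divOp`). This is the crucial step: for `b ∈ V N Q₀` the
singular term vanishes identically, and `P = 0` removes the remaining terms in which `∇η` meets the
divergences. What survives is an equation in the cell for almost every `x` (`ae_limit_eq`).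

In `F_1` the surviving coefficient is `1/(2ε₁)` on the whole gradient; for fields in `V N Q₀` the
gradient of `v₂` is there a rotation of that of `v₁`, so half of the full product is `∇v₁ · conj
∇w₁`. In `F_0` the coefficient is `1/(ε₀ - ε₁)`, and `ε₁/(ε₀ - ε₁) = γ⁻¹`. Completeness of the
exponentials identifies `F` with `f` (`TS.ae_eq`), and positive definiteness of the limit form gives
uniqueness. -/

/-! ### Decomposition of the plane into translated cells -/

/-- The index of the translate of the cell that contains `y`. -/
def cidx (N : Fin 2 → ℕ) (y : Plane) : Fin 2 → ℤ := fun i => ⌊y i / N i⌋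

/-- The lattice point with index `k`. -/
def shift (N : Fin 2 → ℕ) (k : Fin 2 → ℤ) : Plane := fun i => N i * k i

/-- The representative of `y` in the cell. -/
def wrap (N : Fin 2 → ℕ) (y : Plane) : Plane := fun i => y i - N i * ⌊y i / N i⌋

/-- The area of the cell. -/
def area (N : Fin 2 → ℕ) : ℝ := N 0 * N 1

/-- The unfolding map: `y` is placed in the scaled cell containing `x`. -/
def unfoldPt (N : Fin 2 → ℕ) (ε : ℝ) (x y : Plane) : Plane :=
  ε • (shift N (cidx N (ε⁻¹ • x)) + y)

variable {N : Fin 2 → ℕ}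

theorem area_pos (hN : ∀ i, 0 < N i) : 0 < area N := by
  have h0 := hN 0
  have h1 := hN 1
  unfold area
  positivity

theorem shift_add_wrap (y : Plane) : shift N (cidx N y) + wrap N y = y := by
  ext i
  simp [shift, cidx, wrap]

theorem wrap_mem_cell (hN : ∀ i, 0 < N i) (y : Plane) : wrap N y ∈ cell N := by
  intro i
  have h : (0 : ℝ) < N i := by exact_mod_cast hN i
  have h1 := Int.floor_le (y i / N i)
  have h2 := Int.lt_floor_add_one (y i / N i)
  rw [le_div_iff₀ h] at h1
  rw [div_lt_iff₀ h] at h2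
  constructor <;> simp only [wrap] <;> linarith

theorem cidx_shift_add (hN : ∀ i, 0 < N i) (k : Fin 2 → ℤ) {y : Plane} (hy : y ∈ cell N) :
    cidx N (shift N k + y) = k := by
  ext i
  have h : (0 : ℝ) < N i := by exact_mod_cast hN i
  have h1 := hy i
  simp only [cidx, shift, Pi.add_apply]
  rw [Int.floor_eq_iff, le_div_iff₀ h, div_lt_iff₀ h]
  constructor <;> linarith [h1.1, h1.2]

theorem wrap_shift_add (hN : ∀ i, 0 < N i) (k : Fin 2 → ℤ) {y : Plane} (hy : y ∈ cell N) :
    wrap N (shift N k + y) = y := by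
  have h := shift_add_wrap (N := N) (shift N k + y)
  rw [cidx_shift_add hN k hy] at h
  exact add_left_cancel h

theorem cidx_preimage (hN : ∀ i, 0 < N i) (k : Fin 2 → ℤ) (y : Plane) :
    shift N k + y ∈ cidx N ⁻¹' {k} ↔ y ∈ cell N := by
  constructor
  · intro h
    have h2 := shift_add_wrap (N := N) (shift N k + y)
    rw [Set.mem_preimage, Set.mem_singleton_iff] at h
    rw [h] at h2
    rw [← add_left_cancel h2]
    exact wrap_mem_cell hN _
  · exact cidx_shift_add hN k

theorem measurable_cidx : Measurable (cidx N) := by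
  refine measurable_pi_lambda _ fun i => ?_
  exact Int.measurable_floor.comp ((measurable_pi_apply i).div_const _)

theorem measurable_shift : Measurable (shift N) := measurable_of_countable _

theorem measurable_wrap : Measurable (wrap N) := by
  refine measurable_pi_lambda _ fun i => ?_
  refine (measurable_pi_apply i).sub (Measurable.const_mul ?_ _)
  exact measurable_from_top.comp (Int.measurable_floor.comp ((measurable_pi_apply i).div_const _))

theorem measurable_unfoldPt (ε : ℝ) :
    Measurable (fun p : Plane × Plane => unfoldPt N ε p.1 p.2) := by
  unfold unfoldPt
  have : Measurable fun p : Plane × Plane => shift N (cidx N (ε⁻¹ • p.1)) :=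
    measurable_shift.comp (measurable_cidx.comp ((measurable_const_smul ε⁻¹).comp measurable_fst))
  exact (this.add measurable_snd).const_smul ε

theorem cell_eq_pi : cell N = Set.univ.pi fun i => Set.Ico (0 : ℝ) (N i) := by
  ext y
  simp [cell]

theorem measurableSet_cell : MeasurableSet (cell N) := by
  rw [cell_eq_pi]
  exact MeasurableSet.univ_pi fun _ => measurableSet_Ico

theorem volume_cell : volume (cell N) = ENNReal.ofReal (area N) := by
  rw [cell_eq_pi, Real.volume_pi_Ico]
  simp [area, Fin.prod_univ_two, ENNReal.ofReal_mul]

instance : IsFiniteMeasure (cellMeasure N) :=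
  ⟨by rw [cellMeasure, Measure.restrict_apply_univ, volume_cell]; exact ENNReal.ofReal_lt_top⟩

/-- The fibres of `cidx N` are the lattice translates of the cell; they are countably many,
measurable and disjoint, so `H` itself need not be measurable. -/
theorem lintegral_eq_tsum_cell (hN : ∀ i, 0 < N i) (H : Plane → ENNReal) :
    ∫⁻ x, H x = ∑' k, ∫⁻ y, H (shift N k + y) ∂(cellMeasure N) := by
  have hm : ∀ k, MeasurableSet (cidx N ⁻¹' {k}) := fun k =>
    measurable_cidx (measurableSet_singleton k)
  have hu : (⋃ k, cidx N ⁻¹' {k}) = Set.univ := by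
    ext x
    simp
  rw [← setLIntegral_univ, ← hu, lintegral_iUnion hm]
  · congr 1
    ext k
    rw [← lintegral_indicator (hm k), ← lintegral_add_left_eq_self _ (shift N k), cellMeasure,
      ← lintegral_indicator measurableSet_cell]
    congr 1
    ext y
    by_cases hy : y ∈ cell N
    · rw [Set.indicator_of_mem hy, Set.indicator_of_mem ((cidx_preimage hN k y).2 hy)]
    · rw [Set.indicator_of_notMem hy,
        Set.indicator_of_notMem (fun h => hy ((cidx_preimage hN k y).1 h))]
  · intro k l hkl
    exact Disjoint.preimage _ (Set.disjoint_singleton.2 hkl)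

/-- As a function of `x` the inner integral is constant on each translated cell, where it is the
integral of `H` over that same cell. Integrating it over the cell only produces the factor `area N`.
-/
theorem lintegral_unfold_one (hN : ∀ i, 0 < N i) (H : Plane → ENNReal) :
    ∫⁻ x, ∫⁻ y, H (shift N (cidx N x) + y) ∂(cellMeasure N) =
      ENNReal.ofReal (area N) * ∫⁻ x, H x := by
  rw [lintegral_eq_tsum_cell hN, lintegral_eq_tsum_cell hN H, ← ENNReal.tsum_mul_left]
  congr 1
  ext k
  rw [← volume_cell, mul_comm, ← setLIntegral_const]
  refine setLIntegral_congr_fun measurableSet_cell fun y hy => ?_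
  rw [cidx_shift_add hN k hy]

theorem lintegral_comp_smul_plane (H : Plane → ENNReal) {ε : ℝ} (hε : 0 < ε) :
    ∫⁻ x, H (ε • x) = ENNReal.ofReal ((ε ^ 2)⁻¹) * ∫⁻ x, H x := by
  have h := Measure.map_addHaar_smul (volume : Measure Plane) hε.ne'
  have h2 : ∫⁻ x, H x ∂(Measure.map (ε • ·) (volume : Measure Plane)) = ∫⁻ x, H (ε • x) :=
    (MeasurableEquiv.smul₀ ε hε.ne').measurableEmbedding.lintegral_map _
  rw [← h2, h, lintegral_smul_measure]
  simp [abs_of_pos hε]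

theorem lintegral_unfold (hN : ∀ i, 0 < N i) {ε : ℝ} (hε : 0 < ε) (H : Plane → ENNReal) :
    ∫⁻ x, ∫⁻ y, H (unfoldPt N ε x y) ∂(cellMeasure N) =
      ENNReal.ofReal (area N) * ∫⁻ x, H x := by
  have h1 := lintegral_comp_smul_plane
    (fun x => ∫⁻ y, H (ε • (shift N (cidx N x) + y)) ∂(cellMeasure N)) (inv_pos.2 hε)
  have h2 := lintegral_comp_smul_plane H hε
  have h3 := lintegral_unfold_one hN (fun x => H (ε • x))
  simp only [unfoldPt]
  rw [h1, h3, h2, mul_left_comm]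
  congr 1
  rw [← mul_assoc, ← ENNReal.ofReal_mul (by positivity)]
  have : ((ε⁻¹) ^ 2)⁻¹ * (ε ^ 2)⁻¹ = 1 := by field_simp
  rw [this]
  simp

/-- This form of the unfolding identity transfers integrability and Bochner integrals from the plane
to `ℝ² × NQ`. -/
theorem measurePreserving_unfoldPt (hN : ∀ i, 0 < N i) {ε : ℝ} (hε : 0 < ε) :
    MeasurePreserving (fun p : Plane × Plane => unfoldPt N ε p.1 p.2)
      ((volume : Measure Plane).prod (cellMeasure N))
      (ENNReal.ofReal (area N) • (volume : Measure Plane)) := by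
  refine ⟨measurable_unfoldPt ε, Measure.ext_of_lintegral _ fun H hH => ?_⟩
  rw [lintegral_map hH (measurable_unfoldPt ε),
    lintegral_prod (fun p : Plane × Plane => H (unfoldPt N ε p.1 p.2))
      (hH.comp (measurable_unfoldPt ε)).aemeasurable, lintegral_unfold hN hε, lintegral_smul_measure, smul_eq_mul]

theorem integrable_unfoldPt {E : Type*} [NormedAddCommGroup E]
    (hN : ∀ i, 0 < N i) {ε : ℝ} (hε : 0 < ε) {H : Plane → E} (hH : Integrable H) :
    Integrable (fun p : Plane × Plane => H (unfoldPt N ε p.1 p.2))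
      ((volume : Measure Plane).prod (cellMeasure N)) := by
  have := (hH.smul_measure (c := ENNReal.ofReal (area N)) ENNReal.ofReal_ne_top)
  exact (measurePreserving_unfoldPt hN hε).integrable_comp_of_integrable this

theorem integral_unfold {E : Type*} [NormedAddCommGroup E] [NormedSpace ℝ E]
    (hN : ∀ i, 0 < N i) {ε : ℝ} (hε : 0 < ε) {H : Plane → E} (hH : Integrable H) :
    ∫ x, ∫ y, H (unfoldPt N ε x y) ∂(cellMeasure N) = area N • ∫ x, H x := by
  rw [← integral_prod (fun p : Plane × Plane => H (unfoldPt N ε p.1 p.2))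
    (integrable_unfoldPt hN hε hH)]
  have h := (measurePreserving_unfoldPt hN hε)
  have h2 : AEStronglyMeasurable H (Measure.map (fun p : Plane × Plane => unfoldPt N ε p.1 p.2)
      ((volume : Measure Plane).prod (cellMeasure N))) := by
    rw [h.map_eq]
    exact hH.1.smul_measure _
  rw [← integral_map h.measurable.aemeasurable h2, h.map_eq, integral_smul_measure,
    ENNReal.toReal_ofReal (area_pos hN).le]

theorem wrap_unfoldPt (hN : ∀ i, 0 < N i) {ε : ℝ} (hε : 0 < ε) (x : Plane) {y : Plane}
    (hy : y ∈ cell N) : wrap N (ε⁻¹ • unfoldPt N ε x y) = y := by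
  rw [unfoldPt, inv_smul_smul₀ hε.ne', wrap_shift_add hN _ hy]

theorem ae_mem_cell : ∀ᵐ y ∂(cellMeasure N), y ∈ cell N :=
  ae_restrict_mem measurableSet_cell

/-- After unfolding, the indicator of the preimage of `s` becomes the indicator of `s` in the
variable `y`, which is null for each `x`. This is what allows elements of `L²(NQ)`, which are only
classes, to be evaluated at `wrap N (ε⁻¹ • z)`, and identities valid a.e. in the cell to be
transported to the plane. -/
theorem quasiMeasurePreserving_wrap (hN : ∀ i, 0 < N i) {ε : ℝ} (hε : 0 < ε) :
    Measure.QuasiMeasurePreserving (fun z : Plane => wrap N (ε⁻¹ • z)) volume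
      (cellMeasure N) := by
  have hm : Measurable (fun z : Plane => wrap N (ε⁻¹ • z)) :=
    measurable_wrap.comp (measurable_const_smul _)
  refine ⟨hm, Measure.AbsolutelyContinuous.mk fun s hs h0 => ?_⟩
  rw [Measure.map_apply hm hs]
  have h := lintegral_unfold hN hε
    (((fun z : Plane => wrap N (ε⁻¹ • z)) ⁻¹' s).indicator (fun _ => 1))
  rw [lintegral_indicator_const (hm hs), one_mul] at h
  have h2 : ∀ x, ∫⁻ y, ((fun z : Plane => wrap N (ε⁻¹ • z)) ⁻¹' s).indicator (fun _ => 1)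
      (unfoldPt N ε x y) ∂(cellMeasure N) = (0 : ENNReal) := by
    intro x
    rw [← h0, ← lintegral_indicator_one hs]
    refine lintegral_congr_ae ?_
    filter_upwards [ae_mem_cell] with y hy
    have : unfoldPt N ε x y ∈ (fun z : Plane => wrap N (ε⁻¹ • z)) ⁻¹' s ↔ y ∈ s := by
      rw [Set.mem_preimage, wrap_unfoldPt hN hε x hy]
    by_cases hys : y ∈ s
    · rw [Set.indicator_of_mem (this.2 hys), Set.indicator_of_mem hys, Pi.one_apply]
    · rw [Set.indicator_of_notMem (this.not.2 hys), Set.indicator_of_notMem hys]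
  simp only [h2, lintegral_zero] at h
  have h3 := area_pos hN
  rcases mul_eq_zero.1 h.symm with h4 | h4
  · rw [ENNReal.ofReal_eq_zero] at h4
    linarith
  · exact h4

/-! ### Multiplication operators on `L²` -/

section Operators

variable {X : Type*} [MeasurableSpace X] {μ : Measure X}
  {E : Type*} [NormedAddCommGroup E] [NormedSpace ℂ E]
  {F : Type*} [NormedAddCommGroup F] [NormedSpace ℂ F]

theorem sq_eLpNorm_two {E : Type*} [NormedAddCommGroup E] (f : X → E) :
    eLpNorm f 2 μ ^ 2 = ∫⁻ x, ‖f x‖ₑ ^ 2 ∂μ := by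
  have h := eLpNorm_nnreal_pow_eq_lintegral (p := 2) (f := f) (μ := μ) two_ne_zero
  simpa using h

/-- A bounded measurable family of operators. -/
structure IsBddFamily (μ : Measure X) (m : X → E →L[ℂ] F) : Prop where
  meas : AEStronglyMeasurable m μ
  bdd : ∃ C : ℝ, 0 ≤ C ∧ ∀ x, ‖m x‖ ≤ C

theorem IsBddFamily.memLp {m : X → E →L[ℂ] F} (hm : IsBddFamily μ m) (f : Lp E 2 μ) :
    MemLp (fun x => m x (f x)) 2 μ := by
  obtain ⟨C, -, hC⟩ := hm.bdd
  refine (Lp.memLp f).of_le_mul (c := C) ?_ (Eventually.of_forall fun x => ?_)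
  · exact (ContinuousLinearMap.apply ℂ F).aestronglyMeasurable_comp₂
      (Lp.memLp f).1 hm.meas
  · exact (m x).le_of_opNorm_le (hC x) _

/-- Multiplication of `L²` functions by a bounded measurable family of operators. -/
def mulOp (m : X → E →L[ℂ] F) (hm : IsBddFamily μ m) : Lp E 2 μ →L[ℂ] Lp F 2 μ :=
  LinearMap.mkContinuousOfExistsBound
    { toFun := fun f => (hm.memLp f).toLp _
      map_add' := fun f g => by
        rw [← MemLp.toLp_add]
        refine MemLp.toLp_congr _ _ ?_
        filter_upwards [Lp.coeFn_add f g] with x hx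
        change m x ((f + g : Lp E 2 μ) x) = m x (f x) + m x (g x)
        rw [hx, Pi.add_apply, map_add]
      map_smul' := fun c f => by
        rw [RingHom.id_apply, ← MemLp.toLp_const_smul]
        refine MemLp.toLp_congr _ _ ?_
        filter_upwards [Lp.coeFn_smul c f] with x hx
        change m x ((c • f : Lp E 2 μ) x) = c • m x (f x)
        rw [hx, Pi.smul_apply, map_smul] }
    (by
      obtain ⟨C, h0, hC⟩ := hm.bdd
      refine ⟨C, fun f => Lp.norm_le_mul_norm_of_ae_le_mul ?_⟩
      filter_upwards [(hm.memLp f).coeFn_toLp] with x hx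
      change ‖(hm.memLp f).toLp _ x‖ ≤ _
      rw [hx]
      exact (m x).le_of_opNorm_le (hC x) _)

theorem coeFn_mulOp {m : X → E →L[ℂ] F} (hm : IsBddFamily μ m) (f : Lp E 2 μ) :
    mulOp m hm f =ᵐ[μ] fun x => m x (f x) := (hm.memLp f).coeFn_toLp

end Operators

/-! ### The unfolding operator on `L²` -/

section Unfold

variable {N : Fin 2 → ℕ} {ε : ℝ} {E : Type*} [NormedAddCommGroup E]

/-- The affine map onto a scaled cell has constant Jacobian, so composition with it preserves `L²`
classes. -/
theorem quasi_cell (hε : 0 < ε) (k : Fin 2 → ℤ) :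
    ∃ c : ENNReal, c ≠ ⊤ ∧
      Measure.map (fun y : Plane => ε • (shift N k + y)) (cellMeasure N) ≤ c • volume := by
  refine ⟨ENNReal.ofReal |(ε ^ 2)⁻¹|, ENNReal.ofReal_ne_top, ?_⟩
  have hm : Measurable (fun y : Plane => ε • (shift N k + y)) :=
    (measurable_const_smul ε).comp (measurable_const_add _)
  have h := Measure.map_addHaar_smul (volume : Measure Plane) hε.ne'
  have h1 : Measure.map (fun y : Plane => ε • (shift N k + y)) volume =
      ENNReal.ofReal |(ε ^ 2)⁻¹| • (volume : Measure Plane) := by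
    have h2 : (fun y : Plane => ε • (shift N k + y)) = (ε • ·) ∘ (shift N k + ·) := rfl
    rw [h2, ← Measure.map_map (measurable_const_smul _) (measurable_const_add _),
      map_add_left_eq_self, h]
    simp
  rw [← h1]
  exact Measure.map_mono Measure.restrict_le_self hm

theorem memLp_cell (hε : 0 < ε) (k : Fin 2 → ℤ) (w : Lp E 2 (volume : Measure Plane)) :
    MemLp (fun y => w (ε • (shift N k + y))) 2 (cellMeasure N) := by
  obtain ⟨c, hc0, hc⟩ := quasi_cell (N := N) hε k
  have hm : Measurable (fun y : Plane => ε • (shift N k + y)) :=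
    (measurable_const_smul ε).comp (measurable_const_add _)
  have h2 := ((Lp.memLp w).smul_measure hc0).mono_measure hc
  exact h2.comp_of_map hm.aemeasurable

/-- The values of `w` on the scaled cell with index `k`. -/
def unfoldAt (N : Fin 2 → ℕ) (hε : 0 < ε) (k : Fin 2 → ℤ)
    (w : Lp E 2 (volume : Measure Plane)) : Lp E 2 (cellMeasure N) :=
  (memLp_cell hε k w).toLp _

theorem coeFn_unfoldAt (hε : 0 < ε) (x : Plane) (w : Lp E 2 (volume : Measure Plane)) :
    unfoldAt N hε (cidx N (ε⁻¹ • x)) w =ᵐ[cellMeasure N] fun y => w (unfoldPt N ε x y) :=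
  (memLp_cell hε _ w).coeFn_toLp

theorem sq_enorm_Lp {X : Type*} [MeasurableSpace X] {μ : Measure X} (g : Lp E 2 μ) :
    ‖g‖ₑ ^ 2 = ∫⁻ x, ‖g x‖ₑ ^ 2 ∂μ := by
  rw [Lp.enorm_def, sq_eLpNorm_two]

theorem sq_eLpNorm_unfold (hN : ∀ i, 0 < N i) (hε : 0 < ε)
    (w : Lp E 2 (volume : Measure Plane)) :
    eLpNorm (fun x => unfoldAt N hε (cidx N (ε⁻¹ • x)) w) 2 volume ^ 2 =
      ENNReal.ofReal (area N) * ‖w‖ₑ ^ 2 := by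
  rw [sq_eLpNorm_two, sq_enorm_Lp, ← lintegral_unfold hN hε]
  congr 1
  ext x
  rw [sq_enorm_Lp]
  refine lintegral_congr_ae ?_
  filter_upwards [coeFn_unfoldAt hε x w] with y hy
  rw [hy]

theorem memLp_unfold (hN : ∀ i, 0 < N i) (hε : 0 < ε) (w : Lp E 2 (volume : Measure Plane)) :
    MemLp (fun x => unfoldAt N hε (cidx N (ε⁻¹ • x)) w) 2 volume := by
  refine ⟨?_, ?_⟩
  -- The unfolding depends on `x` only through the discrete index `k`, so strong measurability into
  -- `L²(NQ)` is automatic.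
  · have h1 : StronglyMeasurable (fun k => unfoldAt N hε k w) := StronglyMeasurable.of_discrete
    exact (h1.comp_measurable
      (measurable_cidx.comp (measurable_const_smul ε⁻¹))).aestronglyMeasurable
  · have h := sq_eLpNorm_unfold hN hε w
    by_contra hlt
    rw [not_lt, top_le_iff] at hlt
    rw [hlt] at h
    have : ENNReal.ofReal (area N) * ‖w‖ₑ ^ 2 < ⊤ :=
      ENNReal.mul_lt_top ENNReal.ofReal_lt_top (by simp)
    rw [← h] at this
    simp at this

/-- The unfolding of an `L²` function. -/
def unfold (hN : ∀ i, 0 < N i) (hε : 0 < ε) (w : Lp E 2 (volume : Measure Plane)) :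
    Lp (Lp E 2 (cellMeasure N)) 2 (volume : Measure Plane) :=
  (memLp_unfold hN hε w).toLp _

theorem coeFn_unfold (hN : ∀ i, 0 < N i) (hε : 0 < ε) (w : Lp E 2 (volume : Measure Plane)) :
    unfold hN hε w =ᵐ[volume] fun x => unfoldAt N hε (cidx N (ε⁻¹ • x)) w :=
  (memLp_unfold hN hε w).coeFn_toLp

theorem sq_norm_unfold (hN : ∀ i, 0 < N i) (hε : 0 < ε) (w : Lp E 2 (volume : Measure Plane)) :
    ‖unfold hN hε w‖ ^ 2 = area N * ‖w‖ ^ 2 := by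
  have h := sq_eLpNorm_unfold hN hε w
  rw [← Lp.enorm_toLp (hf := memLp_unfold hN hε w)] at h
  have h2 := congrArg ENNReal.toReal h
  rw [unfold, ENNReal.toReal_pow, toReal_enorm] at *
  simpa [ENNReal.toReal_ofReal (area_pos hN).le] using h2

end Unfold

/-! ### Weak sequential compactness in a separable Hilbert space -/

section WeakCompactness

/-- Sequential Banach–Alaoglu in the dual, carried over by the Riesz isomorphism. That isomorphism
puts `x n` in the first slot of the inner product, hence the conjugations. -/
theorem exists_subseq_tendsto_inner {H : Type*} [NormedAddCommGroup H] [InnerProductSpace ℂ H]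
    [CompleteSpace H] [TopologicalSpace.SeparableSpace H] (x : ℕ → H) (C : ℝ)
    (hC : ∀ n, ‖x n‖ ≤ C) :
    ∃ w : H, ∃ k : ℕ → ℕ, StrictMono k ∧
      ∀ g : H, Tendsto (fun n => inner ℂ g (x (k n))) atTop (𝓝 (inner ℂ g w)) := by
  let L : ℕ → WeakDual ℂ H := fun n =>
    StrongDual.toWeakDual (InnerProductSpace.toDual ℂ H (x n))
  have hL : ∀ n, L n ∈ WeakDual.toStrongDual ⁻¹' Metric.closedBall (0 : StrongDual ℂ H) C := by
    intro n
    simpa [L] using hC n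
  obtain ⟨l, -, k, hk, hl⟩ := WeakDual.isSeqCompact_closedBall ℂ H 0 C hL
  refine ⟨(InnerProductSpace.toDual ℂ H).symm (WeakDual.toStrongDual l), k, hk, fun g => ?_⟩
  have h1 := ((WeakDual.eval_continuous g).tendsto l).comp hl
  have h2 := (Complex.continuous_conj.tendsto _).comp h1
  have h3 : inner ℂ g ((InnerProductSpace.toDual ℂ H).symm (WeakDual.toStrongDual l)) =
      conj (l g) := by
    rw [← inner_conj_symm, InnerProductSpace.toDual_symm_apply]
    rfl
  rw [h3]
  refine h2.congr fun n => ?_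
  simp only [Function.comp_apply, L]
  rw [← inner_conj_symm]
  rfl

end WeakCompactness

/-! ### Scaled periodic extensions of `L²` functions on the cell -/

section WrapOp

variable {N : Fin 2 → ℕ} {ε : ℝ} {E : Type*} [NormedAddCommGroup E]

/-- A bound for the diameter of the cell. -/
def cellDiam (N : Fin 2 → ℕ) : ℝ := N 0 + N 1

/-- Both points lie in the same scaled cell. -/
theorem dist_unfoldPt_le (hN : ∀ i, 0 < N i) (hε : 0 < ε) (x : Plane) {y : Plane}
    (hy : y ∈ cell N) : dist (unfoldPt N ε x y) x ≤ ε * cellDiam N := by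
  have hx : x = ε • (shift N (cidx N (ε⁻¹ • x)) + wrap N (ε⁻¹ • x)) := by
    rw [shift_add_wrap, smul_inv_smul₀ hε.ne']
  have hw := wrap_mem_cell hN (ε⁻¹ • x)
  conv_lhs => arg 2; rw [hx]
  rw [unfoldPt, dist_smul₀, dist_add_left, Real.norm_of_nonneg hε.le]
  refine mul_le_mul_of_nonneg_left ?_ hε.le
  have h0 : (0 : ℝ) ≤ N 0 := by positivity
  have h1 : (0 : ℝ) ≤ N 1 := by positivity
  rw [dist_pi_le_iff (by unfold cellDiam; positivity)]
  intro i
  rw [Real.dist_eq, abs_le]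
  have h2 := hy i
  have h3 := hw i
  unfold cellDiam
  constructor <;> fin_cases i <;> simp at * <;> linarith [h2.1, h2.2, h3.1, h3.2]

theorem aestronglyMeasurable_wrap (hN : ∀ i, 0 < N i) (hε : 0 < ε)
    (g : Lp E 2 (cellMeasure N)) :
    AEStronglyMeasurable (fun z : Plane => g (wrap N (ε⁻¹ • z))) volume :=
  (Lp.memLp g).1.comp_quasiMeasurePreserving (quasiMeasurePreserving_wrap hN hε)

/-- After unfolding, only those `x` whose scaled cell meets `K` contribute. They lie within the
diameter of a cell from `K`, and each contributes at most the squared norm of `g`. -/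
theorem lintegral_wrap_le (hN : ∀ i, 0 < N i) (hε : 0 < ε) {K : Set Plane}
    (g : Lp E 2 (cellMeasure N)) :
    ENNReal.ofReal (area N) * ∫⁻ z, ‖K.indicator (fun z => g (wrap N (ε⁻¹ • z))) z‖ₑ ^ 2 ≤
      volume (Metric.cthickening (ε * cellDiam N) K) * ‖g‖ₑ ^ 2 := by
  have hm : MeasurableSet (Metric.cthickening (ε * cellDiam N) K) :=
    Metric.isClosed_cthickening.measurableSet
  rw [← lintegral_unfold hN hε, mul_comm, ← lintegral_indicator_const hm]
  refine lintegral_mono fun x => ?_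
  by_cases hx : x ∈ Metric.cthickening (ε * cellDiam N) K
  · rw [Set.indicator_of_mem hx, sq_enorm_Lp]
    refine lintegral_mono_ae ?_
    filter_upwards [ae_mem_cell] with y hy
    by_cases hz : unfoldPt N ε x y ∈ K
    · rw [Set.indicator_of_mem hz, wrap_unfoldPt hN hε x hy]
    · rw [Set.indicator_of_notMem hz]
      simp
  · rw [Set.indicator_of_notMem hx]
    refine le_of_eq (lintegral_eq_zero_of_ae_eq_zero ?_)
    filter_upwards [ae_mem_cell] with y hy
    have hz : unfoldPt N ε x y ∉ K := fun hz => hx (Metric.mem_cthickening_of_dist_le _ _ _ _ hz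
      (by rw [dist_comm]; exact dist_unfoldPt_le hN hε x hy))
    rw [Set.indicator_of_notMem hz]
    simp

theorem exists_wrap_bound (hN : ∀ i, 0 < N i) (hε : 0 < ε) {K : Set Plane} (hK : IsCompact K) :
    ∃ C : ℝ≥0, ∀ g : Lp E 2 (cellMeasure N),
      eLpNorm (K.indicator (fun z => g (wrap N (ε⁻¹ • z)))) 2 volume ≤ C * ‖g‖ₑ := by
  have hfin : volume (Metric.cthickening (ε * cellDiam N) K) ≠ ⊤ :=
    hK.cthickening.measure_lt_top.ne
  obtain ⟨v, hv⟩ := WithTop.ne_top_iff_exists.1 hfin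
  refine ⟨NNReal.sqrt (v / (area N).toNNReal), fun g => ?_⟩
  have h := lintegral_wrap_le hN hε (K := K) g
  have ha : (area N).toNNReal ≠ 0 := by
    simpa using area_pos hN
  rw [← sq_eLpNorm_two, ← hv] at h
  rw [← ENNReal.pow_le_pow_left_iff two_ne_zero, mul_pow, ← ENNReal.coe_pow, NNReal.sq_sqrt,
    ENNReal.coe_div ha, ENNReal.mul_comm_div, ← mul_div_assoc]
  rw [ENNReal.le_div_iff_mul_le (by left; exact_mod_cast ha) (by left; simp), mul_comm]
  exact h

theorem memLp_wrap (hN : ∀ i, 0 < N i) (hε : 0 < ε) {K : Set Plane} (hK : IsCompact K)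
    (g : Lp E 2 (cellMeasure N)) :
    MemLp (K.indicator (fun z => g (wrap N (ε⁻¹ • z)))) 2 volume := by
  obtain ⟨C, hC⟩ := exists_wrap_bound (E := E) hN hε hK
  refine ⟨(aestronglyMeasurable_wrap hN hε g).indicator hK.measurableSet, (hC g).trans_lt ?_⟩
  exact ENNReal.mul_lt_top (by simp) (by simp)

variable [NormedSpace ℂ E]

/-- The scaled periodic extension, cut off to a compact set. -/
def wrapOp (hN : ∀ i, 0 < N i) (hε : 0 < ε) {K : Set Plane} (hK : IsCompact K) :
    Lp E 2 (cellMeasure N) →L[ℂ] Lp E 2 (volume : Measure Plane) :=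
  LinearMap.mkContinuousOfExistsBound
    { toFun := fun g => (memLp_wrap hN hε hK g).toLp _
      map_add' := fun f g => by
        rw [← MemLp.toLp_add]
        refine MemLp.toLp_congr _ _ ?_
        filter_upwards [(quasiMeasurePreserving_wrap hN hε).ae (Lp.coeFn_add f g)] with x hx
        simp only [Set.indicator, Pi.add_apply, hx]
        split_ifs <;> simp
      map_smul' := fun c f => by
        rw [RingHom.id_apply, ← MemLp.toLp_const_smul]
        refine MemLp.toLp_congr _ _ ?_
        filter_upwards [(quasiMeasurePreserving_wrap hN hε).ae (Lp.coeFn_smul c f)] with x hx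
        simp only [Set.indicator, Pi.smul_apply, hx]
        split_ifs <;> simp }
    (by
      obtain ⟨C, hC⟩ := exists_wrap_bound (E := E) hN hε hK
      refine ⟨C, fun g => ?_⟩
      have h := hC g
      rw [← Lp.enorm_toLp (hf := memLp_wrap hN hε hK g)] at h
      have h2 := ENNReal.toReal_mono (ENNReal.mul_ne_top (by simp) (by simp)) h
      simpa using h2)

theorem coeFn_wrapOp (hN : ∀ i, 0 < N i) (hε : 0 < ε) {K : Set Plane} (hK : IsCompact K)
    (g : Lp E 2 (cellMeasure N)) :
    wrapOp hN hε hK g =ᵐ[volume] K.indicator (fun z => g (wrap N (ε⁻¹ • z))) :=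
  (memLp_wrap hN hε hK g).coeFn_toLp

end WrapOp

/-! ### Two-scale convergence against non-smooth oscillating test functions -/

section TwoScale

variable {N : Fin 2 → ℕ} {ε : ℝ} {E : Type*} [NormedAddCommGroup E]

theorem integrable_sq_norm {X : Type*} [MeasurableSpace X] {μ : Measure X} (g : Lp E 2 μ) :
    Integrable (fun x => ‖g x‖ ^ 2) μ :=
  (Lp.memLp g).integrable_norm_pow two_ne_zero

theorem integral_sq_norm {X : Type*} [MeasurableSpace X] {μ : Measure X} (g : Lp E 2 μ) :
    ∫ x, ‖g x‖ ^ 2 ∂μ = ‖g‖ ^ 2 := by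
  rw [integral_eq_lintegral_of_nonneg_ae (Eventually.of_forall fun x => by positivity)
    (integrable_sq_norm g).1]
  have h := congrArg ENNReal.toReal (sq_enorm_Lp g)
  rw [ENNReal.toReal_pow, toReal_enorm] at h
  rw [h]
  congr 2
  ext x
  rw [ENNReal.ofReal_pow (norm_nonneg _), ofReal_norm]

variable [InnerProductSpace ℂ E]

theorem integrable_mul_inner {X : Type*} [TopologicalSpace X] [MeasurableSpace X]
    [OpensMeasurableSpace X] {μ : Measure X}
    [IsFiniteMeasureOnCompacts μ] {η : X → ℂ} (hη : Continuous η) (hc : HasCompactSupport η)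
    (g : E) (W : Lp E 2 μ) : Integrable (fun x => η x * inner ℂ g (W x)) μ :=
  (hη.memLp_of_hasCompactSupport (p := 2) hc).integrable_mul ((Lp.memLp W).const_inner g)

theorem integrable_wrap_inner (hN : ∀ i, 0 < N i) (hε : 0 < ε) {η : Plane → ℂ}
    (hη : Continuous η) (hc : HasCompactSupport η) (g : Lp E 2 (cellMeasure N))
    (U : Lp E 2 (volume : Measure Plane)) :
    Integrable (fun z => η z * inner ℂ (g (wrap N (ε⁻¹ • z))) (U z)) := by
  obtain ⟨C, hC⟩ := hc.exists_bound_of_continuous hη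
  have h1 := (L2.integrable_inner (𝕜 := ℂ) (wrapOp hN hε hc g) U).bdd_mul
    hη.aestronglyMeasurable (Eventually.of_forall hC)
  refine h1.congr ?_
  filter_upwards [coeFn_wrapOp hN hε hc g] with z hz
  rw [hz]
  by_cases hzs : z ∈ tsupport η
  · rw [Set.indicator_of_mem hzs]
  · rw [image_eq_zero_of_notMem_tsupport hzs]
    simp

/-- Unfolding turns the oscillating integral into a double integral of `η(unfoldPt) ⟨g(y), U⟩`.
Replacing the slow factor `η(unfoldPt)` by `η(x)` is the only error made; it is at most `κ`, lives
over `K`, and is paired with `‖g‖ ‖u‖ ≤ ‖g‖² + ‖u‖²`. Two-scale convergence is thereby reduced to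
weak convergence of the unfoldings. -/
theorem norm_integral_wrap_sub_le (hN : ∀ i, 0 < N i) (hε : 0 < ε) {η : Plane → ℂ}
    (hη : Continuous η) (hc : HasCompactSupport η) (g : Lp E 2 (cellMeasure N))
    (U : Lp E 2 (volume : Measure Plane)) {κ : ℝ} (hκ : 0 ≤ κ) {K : Set Plane}
    (hK : IsCompact K)
    (h : ∀ x, ∀ y ∈ cell N, ‖η (unfoldPt N ε x y) - η x‖ ≤ K.indicator (fun _ => κ) x) :
    ‖(∫ z, η z * inner ℂ (g (wrap N (ε⁻¹ • z))) (U z)) -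
      (area N : ℂ)⁻¹ * ∫ x, η x * inner ℂ g (unfold hN hε U x)‖ ≤
      κ * ((area N)⁻¹ * (volume.real K * ‖g‖ ^ 2 + area N * ‖U‖ ^ 2)) := by
  set H : Plane → ℂ := fun z => η z * inner ℂ (g (wrap N (ε⁻¹ • z))) (U z) with hH
  have ha := area_pos hN
  have hac : (area N : ℂ) ≠ 0 := by exact_mod_cast ha.ne'
  have hHi : Integrable H := integrable_wrap_inner hN hε hη hc g U
  have h1 := integral_unfold hN hε hHi
  have h2 : Integrable (fun x => ∫ y, H (unfoldPt N ε x y) ∂(cellMeasure N)) :=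
    (integrable_unfoldPt hN hε hHi).integral_prod_left
  have h3 : Integrable (fun x => η x * inner ℂ g (unfold hN hε U x)) :=
    integrable_mul_inner hη hc g (unfold hN hε U)
  have h4 : (∫ z, H z) - (area N : ℂ)⁻¹ * ∫ x, η x * inner ℂ g (unfold hN hε U x) =
      (area N : ℂ)⁻¹ * ∫ x, ((∫ y, H (unfoldPt N ε x y) ∂(cellMeasure N)) -
        η x * inner ℂ g (unfold hN hε U x)) := by
    rw [integral_sub h2 h3, h1, Complex.real_smul]
    field_simp
  have hbound : ∀ᵐ x, ‖(∫ y, H (unfoldPt N ε x y) ∂(cellMeasure N)) -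
      η x * inner ℂ g (unfold hN hε U x)‖ ≤
      K.indicator (fun _ => κ * ‖g‖ ^ 2) x + κ * ‖unfold hN hε U x‖ ^ 2 := by
    obtain ⟨C, hC⟩ := hc.exists_bound_of_continuous hη
    filter_upwards [coeFn_unfold hN hε U] with x hx
    rw [hx]
    set u := unfoldAt N hε (cidx N (ε⁻¹ • x)) U with hu
    have i1 : Integrable (fun y => inner ℂ (g y) (u y)) (cellMeasure N) :=
      L2.integrable_inner g u
    have i2 : Integrable (fun y => η (unfoldPt N ε x y) * inner ℂ (g y) (u y))
        (cellMeasure N) := by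
      refine i1.bdd_mul (c := C) ?_ (Eventually.of_forall fun y => hC _)
      exact (hη.measurable.comp
        ((measurable_unfoldPt ε).comp measurable_prodMk_left)).aestronglyMeasurable
    have e1 : ∫ y, H (unfoldPt N ε x y) ∂(cellMeasure N) =
        ∫ y, η (unfoldPt N ε x y) * inner ℂ (g y) (u y) ∂(cellMeasure N) := by
      refine integral_congr_ae ?_
      filter_upwards [coeFn_unfoldAt hε x U, ae_mem_cell] with y hy hyc
      simp only [hH, wrap_unfoldPt hN hε x hyc, hu, hy]
    rw [e1, L2.inner_def, ← integral_const_mul, ← integral_sub i2 (i1.const_mul _)]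
    have i3 : Integrable (fun y => K.indicator (fun _ => κ) x * (‖g y‖ ^ 2 + ‖u y‖ ^ 2))
        (cellMeasure N) := ((integrable_sq_norm g).add (integrable_sq_norm u)).const_mul _
    refine (norm_integral_le_of_norm_le i3 ?_).trans ?_
    · filter_upwards [ae_mem_cell] with y hyc
      rw [← sub_mul, norm_mul]
      refine mul_le_mul (h x y hyc) ?_ (norm_nonneg _)
        (Set.indicator_nonneg (fun _ _ => hκ) _)
      refine (norm_inner_le_norm _ _).trans ?_
      nlinarith [sq_nonneg (‖g y‖ - ‖u y‖), sq_nonneg ‖g y‖, sq_nonneg ‖u y‖]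
    · rw [integral_const_mul, integral_add (integrable_sq_norm g) (integrable_sq_norm u),
        integral_sq_norm, integral_sq_norm, mul_add]
      by_cases hxK : x ∈ K
      · simp [hxK]
      · simp only [hxK, not_false_eq_true, Set.indicator_of_notMem, zero_mul, add_zero]
        positivity
  have i4 : Integrable (fun x => K.indicator (fun _ => κ * ‖g‖ ^ 2) x) :=
    (integrable_indicator_iff hK.measurableSet).2 (integrableOn_const hK.measure_lt_top.ne)
  have i5 := (integrable_sq_norm (unfold hN hε U)).const_mul κ
  rw [h4, norm_mul]
  have h5 := norm_integral_le_of_norm_le (i4.add i5) hbound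
  simp only [Pi.add_apply] at h5
  rw [integral_add i4 i5, integral_const_mul, integral_sq_norm, sq_norm_unfold,
    integral_indicator_const _ hK.measurableSet, smul_eq_mul] at h5
  have h6 : ‖((area N : ℂ))⁻¹‖ = (area N)⁻¹ := by
    rw [norm_inv, Complex.norm_real, Real.norm_of_nonneg ha.le]
  rw [h6]
  calc _ ≤ (area N)⁻¹ * (volume.real K * (κ * ‖g‖ ^ 2) + κ * (area N * ‖U‖ ^ 2)) := by gcongr
    _ = _ := by ring

/-- Uniform continuity of `η`. Once the scaled cells have diameter less than `1`, the difference
vanishes outside the `1`-thickening of the support, a compact set independent of `n`. -/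
theorem eventually_norm_unfoldPt_sub_le (hN : ∀ i, 0 < N i) {δ : ℕ → ℝ} (hδ : ∀ n, 0 < δ n)
    (hδ0 : Tendsto δ atTop (𝓝 0)) {η : Plane → ℂ}
    (hη : Continuous η) (hc : HasCompactSupport η) {e : ℝ} (he : 0 < e) :
    ∀ᶠ n in atTop, ∀ x, ∀ y ∈ cell N, ‖η (unfoldPt N (δ n) x y) - η x‖ ≤
      (Metric.cthickening 1 (tsupport η)).indicator (fun _ => e) x := by
  obtain ⟨r, hr, hηr⟩ := Metric.uniformContinuous_iff.1 (hc.uniformContinuous_of_continuous hη) e he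
  have h1 : Tendsto (fun n => δ n * cellDiam N) atTop (𝓝 0) := by
    simpa using hδ0.mul_const (cellDiam N)
  filter_upwards [h1.eventually (gt_mem_nhds hr), h1.eventually (gt_mem_nhds one_pos)]
    with n h2 h3 x y hy
  have hd := dist_unfoldPt_le hN (hδ n) x hy
  by_cases hx : x ∈ Metric.cthickening 1 (tsupport η)
  · rw [Set.indicator_of_mem hx, ← dist_eq_norm]
    exact (hηr (hd.trans_lt h2)).le
  · rw [Set.indicator_of_notMem hx]
    have e1 : η x = 0 := image_eq_zero_of_notMem_tsupport
      fun h => hx (Metric.self_subset_cthickening _ h)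
    have e2 : η (unfoldPt N (δ n) x y) = 0 := by
      refine image_eq_zero_of_notMem_tsupport fun h =>
        hx (Metric.mem_cthickening_of_dist_le _ _ _ _ h ?_)
      rw [dist_comm]
      exact hd.trans h3.le
    rw [e1, e2]
    simp

/-- Two-scale convergence, tested with products of continuous functions and oscillating square
integrable functions. -/
def TS (N : Fin 2 → ℕ) (δ : ℕ → ℝ) (U : ℕ → Lp E 2 (volume : Measure Plane))
    (W : Lp (Lp E 2 (cellMeasure N)) 2 (volume : Measure Plane)) : Prop :=
  ∀ η : Plane → ℂ, Continuous η → HasCompactSupport η → ∀ g : Lp E 2 (cellMeasure N),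
    Tendsto (fun n => ∫ z, η z * inner ℂ (g (wrap N ((δ n)⁻¹ • z))) (U n z)) atTop
      (𝓝 ((area N : ℂ)⁻¹ * ∫ x, η x * inner ℂ g (W x)))

theorem TS.comp {δ : ℕ → ℝ} {U : ℕ → Lp E 2 (volume : Measure Plane)}
    {W : Lp (Lp E 2 (cellMeasure N)) 2 (volume : Measure Plane)} (h : TS N δ U W)
    {k : ℕ → ℕ} (hk : StrictMono k) : TS N (δ ∘ k) (U ∘ k) W :=
  fun η hη hc g => (h η hη hc g).comp hk.tendsto_atTop

/-- The products `conj η · g` are admissible vectors for weak convergence in `L²(ℝ²; H)`. -/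
theorem inner_toLp_smul {H : Type*} [NormedAddCommGroup H] [InnerProductSpace ℂ H]
    {η : Plane → ℂ} (hη : Continuous η) (hc : HasCompactSupport η) (g : H) :
    ∃ G : Lp H 2 (volume : Measure Plane), ∀ W : Lp H 2 (volume : Measure Plane),
      inner ℂ G W = ∫ x, η x * inner ℂ g (W x) := by
  have h1 : Continuous fun x => conj (η x) • g :=
    (Complex.continuous_conj.comp hη).smul continuous_const
  have h2 : HasCompactSupport fun x => conj (η x) • g :=
    (hc.comp_left (g := fun z : ℂ => conj z) (by simp)).smul_right (f' := fun _ => g)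
  have h3 := h1.memLp_of_hasCompactSupport (μ := (volume : Measure Plane)) (p := 2) h2
  refine ⟨h3.toLp _, fun W => ?_⟩
  rw [L2.inner_def]
  refine integral_congr_ae ?_
  filter_upwards [h3.coeFn_toLp] with x hx
  rw [hx, inner_smul_left, Complex.conj_conj]

instance fact_two_ne_top : Fact ((2 : ENNReal) ≠ ⊤) := ⟨by simp⟩

instance [TopologicalSpace.SeparableSpace E] :
    SecondCountableTopology (Lp E 2 (cellMeasure N)) :=
  Lp.SecondCountableTopology

instance [TopologicalSpace.SeparableSpace E] :
    SecondCountableTopology (Lp E 2 (volume : Measure Plane)) :=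
  Lp.SecondCountableTopology

theorem exists_subseq_TS [CompleteSpace E] [TopologicalSpace.SeparableSpace E]
    (hN : ∀ i, 0 < N i) {δ : ℕ → ℝ} (hδ : ∀ n, 0 < δ n)
    (hδ0 : Tendsto δ atTop (𝓝 0)) (U : ℕ → Lp E 2 (volume : Measure Plane)) (C : ℝ)
    (hC : ∀ n, ‖U n‖ ≤ C) :
    ∃ (W : Lp (Lp E 2 (cellMeasure N)) 2 (volume : Measure Plane)) (k : ℕ → ℕ),
      StrictMono k ∧ TS N (δ ∘ k) (U ∘ k) W := by
  have ha := area_pos hN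
  have hb : ∀ n, ‖unfold hN (hδ n) (U n)‖ ≤ Real.sqrt (area N * C ^ 2) := by
    intro n
    apply Real.le_sqrt_of_sq_le
    rw [sq_norm_unfold]
    have := hC n
    gcongr
  have : TopologicalSpace.SeparableSpace
      (Lp (Lp E 2 (cellMeasure N)) 2 (volume : Measure Plane)) :=
    TopologicalSpace.SecondCountableTopology.to_separableSpace
  obtain ⟨W, k, hk, hW⟩ := exists_subseq_tendsto_inner _ _ hb
  refine ⟨W, k, hk, fun η hη hc g => ?_⟩
  obtain ⟨G, hG⟩ := inner_toLp_smul hη hc g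
  have h1 := (hW G).const_mul ((area N : ℂ)⁻¹)
  simp only [hG] at h1
  refine tendsto_of_tendsto_of_dist h1 ?_
  set K := Metric.cthickening 1 (tsupport η)
  have hK : IsCompact K := IsCompact.cthickening hc
  set M := (area N)⁻¹ * (volume.real K * ‖g‖ ^ 2 + area N * C ^ 2) with hM
  have hM0 : 0 ≤ M := by positivity
  rw [Metric.tendsto_atTop']
  intro e he
  have h2 := hk.tendsto_atTop.eventually
    -- The tolerance is chosen so that its product with `M` is strictly below `e`; `M + 1` keeps the
    -- denominator positive when `M = 0`.
    (eventually_norm_unfoldPt_sub_le hN hδ hδ0 hη hc (e := e / (2 * (M + 1))) (by positivity))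
  obtain ⟨n₀, hn₀⟩ := eventually_atTop.1 h2
  refine ⟨n₀, fun n hn => ?_⟩
  rw [Real.dist_eq, sub_zero, abs_of_nonneg dist_nonneg, dist_comm, dist_eq_norm]
  refine (norm_integral_wrap_sub_le hN (hδ (k n)) hη hc g (U (k n)) (by positivity) hK
    (hn₀ n hn.le)).trans_lt ?_
  have h3 : (area N)⁻¹ * (volume.real K * ‖g‖ ^ 2 + area N * ‖U (k n)‖ ^ 2) ≤ M := by
    have := hC (k n)
    rw [hM]
    gcongr
  calc _ ≤ e / (2 * (M + 1)) * M := by gcongr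
    _ < e := by
      rw [div_mul_eq_mul_div, div_lt_iff₀ (by positivity)]
      nlinarith

end TwoScale

/-! ### Periodization -/

section Periodize

variable {N : Fin 2 → ℕ} {E : Type*} [NormedAddCommGroup E]

/-- The sum of all lattice translates of `v`. -/
def periodize (N : Fin 2 → ℕ) (v : Plane → E) (y : Plane) : E :=
  ∑ᶠ k : Fin 2 → ℤ, v (shift N k + y)

theorem shift_add (k l : Fin 2 → ℤ) : shift N (k + l) = shift N k + shift N l := by
  ext i
  simp [shift, mul_add]

theorem shift_single (i : Fin 2) : shift N (Pi.single i 1) = Pi.single i (N i : ℝ) := by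
  ext j
  by_cases h : j = i
  · subst h
    simp [shift]
  · simp [shift, h]

theorem periodize_shift_add (v : Plane → E) (l : Fin 2 → ℤ) (y : Plane) :
    periodize N v (shift N l + y) = periodize N v y := by
  unfold periodize
  conv_rhs => rw [← finsum_comp_equiv (Equiv.addRight l)]
  refine finsum_congr fun k => ?_
  rw [Equiv.coe_addRight, shift_add, add_assoc]

theorem isCellPeriodic_periodize (v : Plane → E) : IsCellPeriodic N (periodize N v) := by
  intro i y
  rw [← shift_single, add_comm, periodize_shift_add]

/-- The periods are at least `1`, so a translate by index `k` can reach the bounded support from the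
ball only if every `|k i| ≤ R₀ + R`. On a ball the periodization is thus one fixed finite sum, which
can be differentiated term by term. -/
theorem exists_finset_periodize (hN : ∀ i, 0 < N i) {v : Plane → E} (hv : HasCompactSupport v)
    (R : ℝ) : ∃ s : Finset (Fin 2 → ℤ), ∀ y ∈ Metric.ball (0 : Plane) R, ∀ k ∉ s,
      shift N k + y ∉ tsupport v := by
  obtain ⟨R₀, hR₀⟩ := hv.isBounded.exists_norm_le
  obtain ⟨M, hM⟩ := exists_nat_ge (R₀ + R)
  refine ⟨Fintype.piFinset fun _ => Finset.Icc (-(M : ℤ)) M, fun y hy k hk hs => hk ?_⟩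
  rw [mem_ball_zero_iff] at hy
  rw [Fintype.mem_piFinset]
  intro i
  have h1 := (norm_le_pi_norm _ i).trans (hR₀ _ hs)
  have h2 := (norm_le_pi_norm y i).trans hy.le
  have h3 : (1 : ℝ) ≤ N i := by exact_mod_cast hN i
  simp only [Pi.add_apply, shift, Real.norm_eq_abs] at h1 h2
  have h4 : |(N i : ℝ) * k i| ≤ M := by
    have := abs_sub_abs_le_abs_sub ((N i : ℝ) * k i) (-y i)
    rw [abs_neg, sub_neg_eq_add] at this
    linarith
  have h5 : |(k i : ℝ)| ≤ M := by
    rw [abs_mul, abs_of_nonneg (by linarith)] at h4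
    nlinarith [abs_nonneg (k i : ℝ)]
  rw [Finset.mem_Icc, ← abs_le]
  exact_mod_cast h5

theorem periodize_eq_sum {v : Plane → E} {y : Plane} {s : Finset (Fin 2 → ℤ)}
    (hs : ∀ k ∉ s, shift N k + y ∉ tsupport v) :
    periodize N v y = ∑ k ∈ s, v (shift N k + y) := by
  refine finsum_eq_sum_of_support_subset _ fun k hk => ?_
  by_contra hks
  exact hk (image_eq_zero_of_notMem_tsupport (hs k hks))

theorem periodize_eq_self (hN : ∀ i, 0 < N i) {v : Plane → E}
    (hv : ∀ y ∉ cell N, v y = 0) {y : Plane} (hy : y ∈ cell N) : periodize N v y = v y := by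
  unfold periodize
  rw [finsum_eq_single _ 0]
  · congr 1
    ext i
    simp [shift]
  · intro k hk
    refine hv _ fun h => hk ?_
    have h1 := cidx_shift_add hN 0 h
    have h2 : shift N 0 = 0 := by
      ext i
      simp [shift]
    rw [h2, zero_add, cidx_shift_add hN k hy] at h1
    exact h1

variable [NormedSpace ℝ E]

theorem contDiff_periodize (hN : ∀ i, 0 < N i) {v : Plane → E} (hv : HasCompactSupport v)
    (hs : ContDiff ℝ ∞ v) : ContDiff ℝ ∞ (periodize N v) := by
  rw [contDiff_iff_contDiffAt]
  intro y
  obtain ⟨s, hsf⟩ := exists_finset_periodize hN hv (‖y‖ + 1)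
  have h1 : ContDiff ℝ ∞ fun z => ∑ k ∈ s, v (shift N k + z) :=
    ContDiff.sum fun k _ => hs.comp (contDiff_const.add contDiff_id)
  refine h1.contDiffAt.congr_of_eventuallyEq ?_
  filter_upwards [Metric.isOpen_ball.mem_nhds
    (show y ∈ Metric.ball (0 : Plane) (‖y‖ + 1) by simp)] with z hz
  exact periodize_eq_sum (hsf z hz)

theorem pderiv_periodize {v : Plane → E}
    (hs : ContDiff ℝ ∞ v) {R : ℝ} {s : Finset (Fin 2 → ℤ)}
    (hsf : ∀ y ∈ Metric.ball (0 : Plane) R, ∀ k ∉ s, shift N k + y ∉ tsupport v)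
    {y : Plane} (hy : y ∈ Metric.ball (0 : Plane) R) (j : Fin 2) :
    pderiv j (periodize N v) y = ∑ k ∈ s, pderiv j v (shift N k + y) := by
  have h1 : periodize N v =ᶠ[𝓝 y] fun z => ∑ k ∈ s, v (shift N k + z) := by
    filter_upwards [Metric.isOpen_ball.mem_nhds hy] with z hz
    exact periodize_eq_sum (hsf z hz)
  have hd : Differentiable ℝ v := hs.differentiable (by simp)
  unfold pderiv
  rw [h1.fderiv_eq, fderiv_fun_sum]
  · simp only [FunLike.coe_sum, Finset.sum_apply, fderiv_comp_add_left]
  · intro k _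
    exact (hd _).comp y ((differentiableAt_const _).add differentiableAt_id)

end Periodize

/-! ### Completeness of the exponentials on the cell -/

section Fourier

variable {N : Fin 2 → ℕ}

/-- The projection of the plane onto the standard torus. -/
def torusProj (N : Fin 2 → ℕ) (y : Plane) : UnitAddTorus (Fin 2) :=
  fun i => ((y i / N i : ℝ) : UnitAddCircle)

/-- A continuous periodic function on the plane descends to a continuous function on the torus
because of this quotient property. -/
theorem isOpenQuotientMap_torusProj (hN : ∀ i, 0 < N i) : IsOpenQuotientMap (torusProj N) := by
  have h : ∀ i, (N i : ℝ) ≠ 0 := fun i => by exact_mod_cast (hN i).ne'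
  refine IsOpenQuotientMap.piMap (f := fun i (t : ℝ) => ((t / N i : ℝ) : UnitAddCircle))
    fun i => ?_
  exact QuotientAddGroup.isOpenQuotientMap_mk.comp
    (Homeomorph.mulRight₀ (N i : ℝ)⁻¹ (inv_ne_zero (h i))).isOpenQuotientMap

theorem torusProj_eq (hN : ∀ i, 0 < N i) {y z : Plane} (h : torusProj N y = torusProj N z) :
    ∃ k : Fin 2 → ℤ, z = shift N k + y := by
  have h1 : ∀ i, ∃ k : ℤ, z i = N i * k + y i := by
    intro i
    have hi : (N i : ℝ) ≠ 0 := by exact_mod_cast (hN i).ne'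
    have h2 := congrFun h i
    simp only [torusProj] at h2
    rw [← sub_eq_zero, ← AddCircle.coe_sub, AddCircle.coe_eq_zero_iff] at h2
    obtain ⟨n, hn⟩ := h2
    refine ⟨-n, ?_⟩
    rw [zsmul_one] at hn
    push_cast
    rw [hn]
    field_simp
    ring
  choose k hk using h1
  exact ⟨k, funext hk⟩

/-- The exponential with frequency `m` on the cell. -/
def expo (N : Fin 2 → ℕ) (m : Fin 2 → ℤ) (y : Plane) : ℂ :=
  Complex.exp (2 * Real.pi * Complex.I * (m 0 * (y 0 / N 0) + m 1 * (y 1 / N 1)))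

theorem mFourier_torusProj (m : Fin 2 → ℤ) (y : Plane) :
    UnitAddTorus.mFourier m (torusProj N y) = expo N m y := by
  simp only [UnitAddTorus.mFourier, ContinuousMap.coe_mk, Fin.prod_univ_two, torusProj,
    fourier_coe_apply, expo, ← Complex.exp_add]
  congr 1
  push_cast
  ring

/-- The functional `F ↦ ∫ F g` on continuous functions on the torus is bounded and vanishes on
trigonometric polynomials, which are dense. Every smooth bump supported in the open cell periodizes
to such an `F`, so `g` vanishes as a distribution there, and the boundary of the cell is null. -/
theorem ae_eq_zero_of_expo (hN : ∀ i, 0 < N i) {g : Plane → ℂ}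
    (hg : Integrable g (cellMeasure N)) (h : ∀ m, ∫ y, expo N m y * g y ∂(cellMeasure N) = 0) :
    g =ᵐ[cellMeasure N] 0 := by
  have hcont : Continuous (torusProj N) := (isOpenQuotientMap_torusProj hN).continuous
  have hint : ∀ F : C(UnitAddTorus (Fin 2), ℂ),
      Integrable (fun y => F (torusProj N y) * g y) (cellMeasure N) := fun F =>
    hg.bdd_mul (c := ‖F‖) (F.continuous.comp hcont).aestronglyMeasurable
      (Eventually.of_forall fun y => F.norm_coe_le_norm _)
  let T : C(UnitAddTorus (Fin 2), ℂ) →L[ℂ] ℂ := LinearMap.mkContinuous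
    { toFun := fun F => ∫ y, F (torusProj N y) * g y ∂(cellMeasure N)
      map_add' := fun F G => by
        rw [← integral_add (hint F) (hint G)]
        simp [add_mul]
      map_smul' := fun c F => by
        rw [RingHom.id_apply, smul_eq_mul, ← integral_const_mul]
        simp [mul_assoc] }
    (∫ y, ‖g y‖ ∂(cellMeasure N)) (fun F => by
      change ‖∫ y, F (torusProj N y) * g y ∂(cellMeasure N)‖ ≤ _
      rw [← integral_mul_const]
      refine norm_integral_le_of_norm_le (hg.norm.mul_const _) (Eventually.of_forall fun y => ?_)
      rw [norm_mul, mul_comm]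
      exact mul_le_mul_of_nonneg_left (F.norm_coe_le_norm _) (norm_nonneg _))
  have hT : ∀ F, T F = 0 := by
    have h1 : Submodule.span ℂ (Set.range (UnitAddTorus.mFourier (d := Fin 2))) ≤
        LinearMap.ker T.toLinearMap := by
      rw [Submodule.span_le]
      rintro _ ⟨m, rfl⟩
      change ∫ y, UnitAddTorus.mFourier m (torusProj N y) * g y ∂(cellMeasure N) = 0
      simp only [mFourier_torusProj, h]
    have h2 := Submodule.topologicalClosure_minimal _ h1 T.isClosed_ker
    rw [UnitAddTorus.span_mFourier_closure_eq_top] at h2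
    intro F
    exact h2 (Submodule.mem_top (x := F))
  set U : Set Plane := Set.univ.pi fun i => Set.Ioo (0 : ℝ) (N i) with hU
  have hUo : IsOpen U := isOpen_set_pi Set.finite_univ fun _ _ => isOpen_Ioo
  have hUc : U ⊆ cell N := fun y hy i => Set.Ioo_subset_Ico_self (hy i (Set.mem_univ i))
  have hloc : LocallyIntegrableOn g U volume :=
    (IntegrableOn.mono_set hg hUc).locallyIntegrableOn
  have hmain := hUo.ae_eq_zero_of_integral_contDiff_smul_eq_zero hloc (fun φ hφ hφc hφs => by
    have hφ0 : ∀ y ∉ cell N, φ y = 0 := fun y hy =>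
      image_eq_zero_of_notMem_tsupport fun h => hy (hUc (hφs h))
    have hper := contDiff_periodize hN hφc hφ
    -- The periodized bump is read off at an arbitrary preimage of `t`; by periodicity the choice is
    -- immaterial.
    let F : UnitAddTorus (Fin 2) → ℂ := fun t =>
      (periodize N φ (Function.surjInv (isOpenQuotientMap_torusProj hN).surjective t) : ℝ)
    have hF : ∀ y, F (torusProj N y) = (periodize N φ y : ℝ) := by
      intro y
      obtain ⟨k, hk⟩ := torusProj_eq hN (Function.surjInv_eq
        (isOpenQuotientMap_torusProj hN).surjective (torusProj N y))
      simp only [F]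
      conv_rhs => rw [hk, periodize_shift_add]
    have hFc : Continuous F := by
      rw [← (isOpenQuotientMap_torusProj hN).continuous_comp_iff]
      have : F ∘ torusProj N = fun y => ((periodize N φ y : ℝ) : ℂ) := funext hF
      rw [this]
      exact Complex.continuous_ofReal.comp hper.continuous
    have h3 := hT ⟨F, hFc⟩
    change ∫ y, F (torusProj N y) * g y ∂(cellMeasure N) = 0 at h3
    rw [← setIntegral_eq_integral_of_forall_compl_eq_zero (s := cell N)
      (fun y hy => by rw [hφ0 y hy, zero_smul])]
    rw [← h3]
    refine integral_congr_ae ?_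
    filter_upwards [ae_mem_cell] with y hy
    rw [hF, periodize_eq_self hN hφ0 hy, Complex.real_smul])
  have hae : ∀ᵐ y ∂(cellMeasure N), y ∈ U := by
    have h4 : U =ᵐ[volume] cell N := by
      rw [cell_eq_pi]
      exact Measure.univ_pi_Ioo_ae_eq_Icc.trans Measure.univ_pi_Ico_ae_eq_Icc.symm
    rw [cellMeasure, ← Measure.restrict_congr_set h4]
    exact ae_restrict_mem hUo.measurableSet
  filter_upwards [ae_restrict_of_ae hmain, hae] with y hy hyU
  exact hy hyU

end Fourier

/-! ### Algebra of jets -/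

section JetAlgebra

/-- The continuous linear map between Euclidean spaces given by a coordinate formula. -/
def coordMap {ι κ : Type*} [Fintype ι] [Fintype κ] (f : (ι → ℂ) →ₗ[ℂ] (κ → ℂ)) :
    EuclideanSpace ℂ ι →L[ℂ] EuclideanSpace ℂ κ :=
  LinearMap.toContinuousLinearMap
    ((WithLp.linearEquiv 2 ℂ (κ → ℂ)).symm.toLinearMap ∘ₗ f ∘ₗ
      (WithLp.linearEquiv 2 ℂ (ι → ℂ)).toLinearMap)

@[simp] theorem coordMap_apply {ι κ : Type*} [Fintype ι] [Fintype κ]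
    (f : (ι → ℂ) →ₗ[ℂ] (κ → ℂ)) (p : EuclideanSpace ℂ ι) (k : κ) :
    coordMap f p k = f (fun i => p i) k := rfl

/-- The value part of a jet, with zero derivatives. -/
def valPart : Jet →L[ℂ] Jet := coordMap
  { toFun := fun p q => match q with
      | (i, none) => p (i, none)
      | (_, some _) => 0
    map_add' := fun p q => by ext ⟨i, o⟩; cases o <;> simp
    map_smul' := fun c p => by ext ⟨i, o⟩; cases o <;> simp }

/-- The derivative part of a jet, with zero values. -/
def derPart : Jet →L[ℂ] Jet := coordMap
  { toFun := fun p q => match q with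
      | (_, none) => 0
      | (i, some j) => p (i, some j)
    map_add' := fun p q => by ext ⟨i, o⟩; cases o <;> simp
    map_smul' := fun c p => by ext ⟨i, o⟩; cases o <;> simp }

/-- The jet with zero values whose `j`-th derivatives are the values of the given jet. -/
def valToDer (j : Fin 2) : Jet →L[ℂ] Jet := coordMap
  { toFun := fun p q => match q with
      | (_, none) => 0
      | (i, some l) => if l = j then p (i, none) else 0
    map_add' := fun p q => by ext ⟨i, o⟩; cases o <;> simp; split_ifs <;> simp
    map_smul' := fun c p => by ext ⟨i, o⟩; cases o <;> simp }

@[simp] theorem valPart_none (p : Jet) (i : Fin 2) : valPart p (i, none) = p (i, none) := rfl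
@[simp] theorem valPart_some (p : Jet) (i j : Fin 2) : valPart p (i, some j) = 0 := rfl
@[simp] theorem derPart_none (p : Jet) (i : Fin 2) : derPart p (i, none) = 0 := rfl
@[simp] theorem derPart_some (p : Jet) (i j : Fin 2) :
    derPart p (i, some j) = p (i, some j) := rfl
@[simp] theorem valToDer_none (p : Jet) (i j : Fin 2) : valToDer j p (i, none) = 0 := rfl
@[simp] theorem valToDer_some (p : Jet) (i j l : Fin 2) :
    valToDer j p (i, some l) = if l = j then p (i, none) else 0 := rfl

/-- The operator `p ↦ (a v, b_j v + c ∂_j v)` on jets `p = (v, ∂_j v)`. -/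
def jetMul (a : ℂ) (b : Fin 2 → ℂ) (c : ℂ) : Jet →L[ℂ] Jet :=
  a • valPart + (b 0 • valToDer 0 + b 1 • valToDer 1) + c • derPart

@[simp] theorem jetMul_none (a : ℂ) (b : Fin 2 → ℂ) (c : ℂ) (p : Jet) (i : Fin 2) :
    jetMul a b c p (i, none) = a * p (i, none) := by
  simp [jetMul]

@[simp] theorem jetMul_some (a : ℂ) (b : Fin 2 → ℂ) (c : ℂ) (p : Jet) (i j : Fin 2) :
    jetMul a b c p (i, some j) = b j * p (i, none) + c * p (i, some j) := by
  fin_cases j <;> simp [jetMul]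

theorem inner_jet (p q : Jet) : inner ℂ p q =
    (q (0, none) * conj (p (0, none)) + q (1, none) * conj (p (1, none))) +
    (q (0, some 0) * conj (p (0, some 0)) + q (0, some 1) * conj (p (0, some 1)) +
      q (1, some 0) * conj (p (1, some 0)) + q (1, some 1) * conj (p (1, some 1))) := by
  rw [PiLp.inner_apply, Fintype.sum_prod_type]
  simp only [Fin.sum_univ_two, Fintype.sum_option, RCLike.inner_apply]
  ring

end JetAlgebra

/-! ### Smooth periodic functions, cutoffs, and the passage between the plane and the cell -/

section Smooth

variable {N : Fin 2 → ℕ}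

theorem contDiff_pderiv {E : Type*} [NormedAddCommGroup E] [NormedSpace ℝ E] {v : Plane → E}
    (hv : ContDiff ℝ ∞ v) (j : Fin 2) : ContDiff ℝ ∞ (pderiv j v) :=
  (hv.fderiv_right (m := ∞) (by simp)).clm_apply contDiff_const

theorem hasCompactSupport_pderiv {E : Type*} [NormedAddCommGroup E] [NormedSpace ℝ E]
    {v : Plane → E} (hv : HasCompactSupport v) (j : Fin 2) : HasCompactSupport (pderiv j v) :=
  hv.fderiv_apply (𝕜 := ℝ) _

theorem tsupport_pderiv_subset {E : Type*} [NormedAddCommGroup E] [NormedSpace ℝ E]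
    (v : Plane → E) (j : Fin 2) : tsupport (pderiv j v) ⊆ tsupport v :=
  tsupport_fderiv_apply_subset ℝ _

theorem continuous_jet {v : Plane → C2} (hv : ContDiff ℝ ∞ v) : Continuous (jet v) := by
  refine (PiLp.continuous_toLp 2 _).comp (continuous_pi fun q => ?_)
  obtain ⟨i, o⟩ := q
  cases o with
  | none => exact (EuclideanSpace.proj (𝕜 := ℂ) i).continuous.comp hv.continuous
  | some j =>
    exact (EuclideanSpace.proj (𝕜 := ℂ) i).continuous.comp (contDiff_pderiv hv j).continuous

theorem memLp_cell_of_continuous {E : Type*} [NormedAddCommGroup E] {v : Plane → E}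
    (hv : Continuous v) : MemLp v 2 (cellMeasure N) := by
  have hK : IsCompact (Set.univ.pi fun i => Set.Icc (0 : ℝ) (N i)) :=
    isCompact_univ_pi fun _ => isCompact_Icc
  obtain ⟨C, hC⟩ := hK.exists_bound_of_continuousOn hv.continuousOn
  refine MemLp.of_bound hv.aestronglyMeasurable C ?_
  filter_upwards [ae_mem_cell] with y hy
  exact hC y fun i _ => Set.Ico_subset_Icc_self (hy i)

theorem toLp_jet_mem_H1Per {v : Plane → C2} (hv : ContDiff ℝ ∞ v) (hp : IsCellPeriodic N v) :
    (memLp_cell_of_continuous (N := N) (continuous_jet hv)).toLp _ ∈ H1Per N :=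
  Submodule.le_topologicalClosure _ ⟨v, hp, hv, MemLp.coeFn_toLp _⟩

theorem IsCellPeriodic.shift_add {E : Type*} {v : Plane → E} (hv : IsCellPeriodic N v)
    (k : Fin 2 → ℤ) (y : Plane) : v (shift N k + y) = v y := by
  have h1 : ∀ (i : Fin 2) (n : ℤ) (y : Plane), v (y + Pi.single i (N i * n : ℝ)) = v y := by
    intro i n
    induction n using Int.induction_on with
    | zero => intro y; simp
    | succ n ih =>
      intro y
      have e : y + Pi.single i (N i * ((n + 1 : ℤ) : ℝ)) =
          y + Pi.single i (N i * ((n : ℤ) : ℝ)) + Pi.single i (N i : ℝ) := by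
        rw [add_assoc, ← Pi.single_add]
        push_cast
        ring_nf
      rw [e, hv, ih]
    | pred n ih =>
      intro y
      have e : y + Pi.single i (N i * ((-(n : ℤ) : ℤ) : ℝ)) =
          y + Pi.single i (N i * ((-(n : ℤ) - 1 : ℤ) : ℝ)) + Pi.single i (N i : ℝ) := by
        rw [add_assoc, ← Pi.single_add]
        push_cast
        ring_nf
      rw [← hv, ← e, ih]
  have h2 : shift N k + y = y + Pi.single 0 (N 0 * k 0 : ℝ) + Pi.single 1 (N 1 * k 1 : ℝ) := by
    ext i
    fin_cases i <;> simp [shift] <;> ring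
  rw [h2, h1, h1]

theorem jet_shift_add {v : Plane → C2} (hv : IsCellPeriodic N v)
    (k : Fin 2 → ℤ) (y : Plane) : jet v (shift N k + y) = jet v y := by
  have h : (fun z => v (shift N k + z)) = v := funext (hv.shift_add k)
  ext ⟨i, o⟩
  cases o with
  | none => simp [jet, hv.shift_add k y]
  | some j =>
    simp only [jet, pderiv]
    rw [← fderiv_comp_add_left, h]

theorem jet_wrap {v : Plane → C2} (hv : IsCellPeriodic N v) (y : Plane) :
    jet v (wrap N y) = jet v y := by
  conv_rhs => rw [← shift_add_wrap (N := N) y, jet_shift_add hv]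

theorem jet_smul_comp {η : Plane → ℂ} {v : Plane → C2} (hη : ContDiff ℝ ∞ η)
    (hv : ContDiff ℝ ∞ v) (c : ℝ) (z : Plane) :
    jet (fun z => η z • v (c • z)) z =
      jetMul (η z) (fun j => pderiv j η z) (c * η z) (jet v (c • z)) := by
  have h1 : DifferentiableAt ℝ η z := hη.differentiable (by simp) z
  have h2 : Differentiable ℝ v := hv.differentiable (by simp)
  have h3 : HasFDerivAt (fun z : Plane => v (c • z))
      ((fderiv ℝ v (c • z)).comp (c • ContinuousLinearMap.id ℝ Plane)) z :=
    (h2 (c • z)).hasFDerivAt.comp z ((hasFDerivAt_id z).const_smul c)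
  ext ⟨i, o⟩
  cases o with
  | none => simp [jet]
  | some j =>
    rw [jetMul_some]
    simp only [jet, pderiv]
    have h4 : HasFDerivAt (fun z => η z • v (c • z)) _ z := h1.hasFDerivAt.smul h3
    rw [h4.fderiv]
    simp
    ring

theorem jet_smul_scaled {η : Plane → ℂ} {v : Plane → C2} (hη : ContDiff ℝ ∞ η)
    (hv : ContDiff ℝ ∞ v) (c : ℝ) (y : Plane) :
    jet (fun y => η (c • y) • v (c • y)) y =
      jetMul (η (c • y)) (fun j => c * pderiv j η (c • y)) (c * η (c • y)) (jet v (c • y)) := by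
  have hη2 : ContDiff ℝ ∞ (fun y => η (c • y)) := hη.comp (contDiff_id.const_smul c)
  rw [jet_smul_comp hη2 hv]
  congr 2
  ext j
  have h3 : HasFDerivAt (fun z : Plane => η (c • z))
      ((fderiv ℝ η (c • y)).comp (c • ContinuousLinearMap.id ℝ Plane)) y :=
    (hη.differentiable (by simp) (c • y)).hasFDerivAt.comp y ((hasFDerivAt_id y).const_smul c)
  simp [pderiv, h3.fderiv]

theorem isBddFamily_jetMul {μ : Measure Plane} {a : Plane → ℂ} {b : Plane → Fin 2 → ℂ}
    {c : Plane → ℂ} (ha : Continuous a) (ha' : HasCompactSupport a) (hb : ∀ j, Continuous (b · j))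
    (hb' : ∀ j, HasCompactSupport (b · j)) (hc : Continuous c) (hc' : HasCompactSupport c) :
    IsBddFamily μ fun z => jetMul (a z) (b z) (c z) := by
  have hcont : Continuous fun z => jetMul (a z) (b z) (c z) := by
    unfold jetMul
    have := hb 0
    have := hb 1
    fun_prop
  have hcs : HasCompactSupport fun z => jetMul (a z) (b z) (c z) := by
    unfold jetMul
    exact ((ha'.smul_right (f' := fun _ => valPart)).add
      (((hb' 0).smul_right (f' := fun _ => valToDer 0)).add
        ((hb' 1).smul_right (f' := fun _ => valToDer 1)))).add
      (hc'.smul_right (f' := fun _ => derPart))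
  obtain ⟨C, hC⟩ := hcs.exists_bound_of_continuous hcont
  exact ⟨hcont.aestronglyMeasurable, C, (norm_nonneg _).trans (hC 0), hC⟩

/-- The family of operators realizing multiplication by a smooth cutoff function. -/
def cutoffFamily (η : Plane → ℂ) (s t : ℝ) (z : Plane) : Jet →L[ℂ] Jet :=
  jetMul (η z) (fun j => s * pderiv j η z) (t * η z)

theorem isBddFamily_cutoff {μ : Measure Plane} {η : Plane → ℂ} (hη : ContDiff ℝ ∞ η)
    (hc : HasCompactSupport η) (s t : ℝ) : IsBddFamily μ (cutoffFamily η s t) :=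
  isBddFamily_jetMul hη.continuous hc
    (fun j => continuous_const.mul (contDiff_pderiv hη j).continuous)
    (fun j => (hasCompactSupport_pderiv hc j).mul_left)
    (continuous_const.mul hη.continuous) hc.mul_left

theorem cutoffFamily_eq_zero {η : Plane → ℂ} (s t : ℝ) {z : Plane} (hz : z ∉ tsupport η) :
    cutoffFamily η s t z = 0 := by
  have h2 : ∀ j, pderiv j η z = 0 := fun j =>
    image_eq_zero_of_notMem_tsupport fun h => hz (tsupport_pderiv_subset η j h)
  ext p ⟨i, o⟩
  cases o <;> simp [cutoffFamily, image_eq_zero_of_notMem_tsupport hz, h2]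

/-- Products of cutoff functions with scaled periodic `H¹` functions belong to `H¹`. -/
theorem exists_cutoff_mem_H1Plane (hN : ∀ i, 0 < N i) {ε : ℝ} (hε : 0 < ε) {η : Plane → ℂ}
    (hη : ContDiff ℝ ∞ η) (hc : HasCompactSupport η) {b : Lp Jet 2 (cellMeasure N)}
    (hb : b ∈ H1Per N) :
    ∃ Θ ∈ H1Plane, Θ =ᵐ[volume] fun z => cutoffFamily η 1 ε⁻¹ z (b (wrap N (ε⁻¹ • z))) := by
  have hm : IsBddFamily (volume : Measure Plane) (cutoffFamily η 1 ε⁻¹) :=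
    isBddFamily_cutoff hη hc _ _
  set M := (mulOp _ hm).comp (wrapOp (E := Jet) hN hε hc) with hM
  have hMe : ∀ b, M b =ᵐ[volume] fun z => cutoffFamily η 1 ε⁻¹ z (b (wrap N (ε⁻¹ • z))) := by
    intro b
    filter_upwards [coeFn_mulOp hm (wrapOp hN hε hc b), coeFn_wrapOp hN hε hc b] with z h1 h2
    rw [hM, ContinuousLinearMap.comp_apply, h1, h2]
    by_cases hz : z ∈ tsupport η
    · rw [Set.indicator_of_mem hz]
    · rw [cutoffFamily_eq_zero _ _ hz]
      simp
  -- Both `H¹` spaces are closures of smooth jets and `M` is continuous, so it suffices that `M`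
  -- sends the jet of a smooth periodic `v` to that of `η(z) v(z/ε)`.
  refine ⟨M b, map_mem_closure M.continuous hb fun a ha => ?_, hMe b⟩
  obtain ⟨v, hvp, hvs, hav⟩ := ha
  refine ⟨fun z => η z • v (ε⁻¹ • z), hc.smul_right,
    hη.smul (hvs.comp (contDiff_id.const_smul _)), ?_⟩
  filter_upwards [hMe a, (quasiMeasurePreserving_wrap hN hε).ae hav] with z h1 h2
  rw [h1, h2, jet_wrap hvp, jet_smul_comp hη hvs]
  simp [cutoffFamily]

theorem integral_eq_sum_cell (hN : ∀ i, 0 < N i) {H : Plane → ℂ} (hH : Integrable H)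
    {s : Finset (Fin 2 → ℤ)} (hs : ∀ y ∈ cell N, ∀ k ∉ s, H (shift N k + y) = 0) :
    ∫ z, H z = ∑ k ∈ s, ∫ y, H (shift N k + y) ∂(cellMeasure N) := by
  have hm : ∀ k, MeasurableSet (cidx N ⁻¹' {k}) := fun k =>
    measurable_cidx (measurableSet_singleton k)
  rw [← setIntegral_eq_integral_of_forall_compl_eq_zero
    (s := ⋃ k ∈ s, cidx N ⁻¹' {k}) (fun z hz => ?_),
    integral_biUnion_finset s (fun k _ => hm k) ?_ (fun k _ => hH.integrableOn)]
  · refine Finset.sum_congr rfl fun k _ => ?_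
    rw [← integral_indicator (hm k), ← integral_add_left_eq_self _ (shift N k), cellMeasure,
      ← integral_indicator measurableSet_cell]
    congr 1
    ext y
    by_cases hy : y ∈ cell N
    · rw [Set.indicator_of_mem hy, Set.indicator_of_mem ((cidx_preimage hN k y).2 hy)]
    · rw [Set.indicator_of_notMem hy,
        Set.indicator_of_notMem (fun h => hy ((cidx_preimage hN k y).1 h))]
  · intro k _ l _ hkl
    exact Disjoint.preimage _ (Set.disjoint_singleton.2 hkl)
  · rw [← shift_add_wrap (N := N) z]
    refine hs _ (wrap_mem_cell hN z) _ fun h => hz ?_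
    simpa using h

theorem jet_eq_zero_of_notMem_tsupport {v : Plane → C2} {y : Plane} (hy : y ∉ tsupport v) :
    jet v y = 0 := by
  ext ⟨i, o⟩
  cases o with
  | none => simp [jet, image_eq_zero_of_notMem_tsupport hy]
  | some j =>
    have : pderiv j v y = 0 :=
      image_eq_zero_of_notMem_tsupport fun h => hy (tsupport_pderiv_subset v j h)
    simp [jet, this]

theorem jet_periodize (hN : ∀ i, 0 < N i) {v : Plane → C2} (hs : ContDiff ℝ ∞ v)
    (hc : HasCompactSupport v) :
    ∃ s : Finset (Fin 2 → ℤ), ∀ y ∈ cell N, (∀ k ∉ s, jet v (shift N k + y) = 0) ∧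
      jet (periodize N v) y = ∑ k ∈ s, jet v (shift N k + y) := by
  obtain ⟨s, hsf⟩ := exists_finset_periodize hN hc (cellDiam N + 1)
  refine ⟨s, fun y hy => ?_⟩
  have h0 : (0 : ℝ) ≤ N 0 := by positivity
  have h1 : (0 : ℝ) ≤ N 1 := by positivity
  have hyb : y ∈ Metric.ball (0 : Plane) (cellDiam N + 1) := by
    rw [mem_ball_zero_iff, pi_norm_lt_iff (by unfold cellDiam; positivity)]
    intro i
    rw [Real.norm_eq_abs, abs_lt]
    have h2 := hy i
    unfold cellDiam
    constructor <;> fin_cases i <;> simp at * <;> linarith [h2.1, h2.2]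
  refine ⟨fun k hk => jet_eq_zero_of_notMem_tsupport (hsf y hyb k hk), ?_⟩
  ext ⟨i, o⟩
  cases o with
  | none => simp [jet, periodize_eq_sum (hsf y hyb)]
  | some j => simp [jet, pderiv_periodize hs hsf hyb]

/-- A periodic vector orthogonal to periodic `H¹` is orthogonal to scaled cutoffs of `H¹`. -/
theorem integral_inner_cutoff_eq_zero (hN : ∀ i, 0 < N i) {ε : ℝ} (hε : 0 < ε) {η : Plane → ℂ}
    (hη : ContDiff ℝ ∞ η) (hc : HasCompactSupport η) {g : Lp Jet 2 (cellMeasure N)}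
    (hg : ∀ b ∈ H1Per N, inner ℂ g b = 0) {u : Lp Jet 2 (volume : Measure Plane)}
    (hu : u ∈ H1Plane) :
    ∫ z, inner ℂ (g (wrap N (ε⁻¹ • z))) (cutoffFamily η ε ε z (u z)) = 0 := by
  have hm : IsBddFamily (volume : Measure Plane) (cutoffFamily η ε ε) :=
    isBddFamily_cutoff hη hc _ _
  have key : ∀ u : Lp Jet 2 (volume : Measure Plane),
      (fun z => inner ℂ (wrapOp hN hε hc g z) (mulOp _ hm u z)) =ᵐ[volume]
        fun z => inner ℂ (g (wrap N (ε⁻¹ • z))) (cutoffFamily η ε ε z (u z)) := by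
    intro u
    filter_upwards [coeFn_mulOp hm u, coeFn_wrapOp hN hε hc g] with z h1 h2
    rw [h1, h2]
    by_cases hz : z ∈ tsupport η
    · rw [Set.indicator_of_mem hz]
    · rw [cutoffFamily_eq_zero _ _ hz]
      simp
  have key2 : ∀ u : Lp Jet 2 (volume : Measure Plane),
      inner ℂ (wrapOp hN hε hc g) (mulOp _ hm u) =
        ∫ z, inner ℂ (g (wrap N (ε⁻¹ • z))) (cutoffFamily η ε ε z (u z)) := fun u => by
    rw [L2.inner_def]
    exact integral_congr_ae (key u)
  have hclosed : IsClosed {u : Lp Jet 2 (volume : Measure Plane) |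
      inner ℂ (wrapOp hN hε hc g) (mulOp _ hm u) = 0} :=
    isClosed_eq (continuous_const.inner (mulOp _ hm).continuous) continuous_const
  -- The integral is continuous in `u`, so only jets of smooth compactly supported functions need to
  -- be treated.
  suffices h : (smoothJets volume compactSupportFns : Set (Lp Jet 2 (volume : Measure Plane))) ⊆
      {u | inner ℂ (wrapOp hN hε hc g) (mulOp _ hm u) = 0} by
    rw [← key2]
    exact closure_minimal h hclosed hu
  rintro u ⟨v, hvc, hvs, huv⟩
  rw [Set.mem_ofPred_eq, key2]
  -- In the variable `y = z/ε` the operator `cutoffFamily η ε ε` produces exactly the jet of `w`;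
  -- the factors `ε` come from the chain rule.
  set w : Plane → C2 := fun y => η (ε • y) • v (ε • y) with hw
  have hws : ContDiff ℝ ∞ w :=
    (hη.comp (contDiff_id.const_smul ε)).smul (hvs.comp (contDiff_id.const_smul ε))
  have hwc : HasCompactSupport w :=
    (hc.comp_homeomorph (Homeomorph.smulOfNeZero ε hε.ne')).smul_right
  have e1 : (fun z => inner ℂ (g (wrap N (ε⁻¹ • z))) (cutoffFamily η ε ε z (u z))) =ᵐ[volume]
      fun z => inner ℂ (g (wrap N (ε⁻¹ • z))) (jet w (ε⁻¹ • z)) := by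
    filter_upwards [huv] with z hz
    rw [hz, hw, jet_smul_scaled hη hvs, smul_inv_smul₀ hε.ne']
    rfl
  set H : Plane → ℂ := fun y => inner ℂ (g (wrap N y)) (jet w y) with hH
  have hi : Integrable fun z => H (ε⁻¹ • z) :=
    ((L2.integrable_inner (wrapOp hN hε hc g) (mulOp _ hm u)).congr (key u)).congr e1
  have hHi : Integrable H := by
    have := hi.comp_smul hε.ne'
    simpa only [inv_smul_smul₀ hε.ne'] using this
  rw [integral_congr_ae e1]
  change ∫ z, H (ε⁻¹ • z) = 0
  rw [Measure.integral_comp_smul]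
  obtain ⟨s, hs⟩ := jet_periodize hN hws hwc
  rw [integral_eq_sum_cell hN hHi (s := s) (fun y hy k hk => by
    simp only [hH]
    rw [(hs y hy).1 k hk, inner_zero_right])]
  -- The translates of `w` over all cells add up to a smooth periodic function, and orthogonality of
  -- `g` to its jet is the hypothesis.
  have h2 := hg _ (toLp_jet_mem_H1Per (contDiff_periodize hN hwc hws) (isCellPeriodic_periodize w))
  have hic : ∀ k, Integrable (fun y => inner ℂ (g y) (jet w (shift N k + y)))
      (cellMeasure N) := fun k => by
    have h3 : MemLp (fun y => jet w (shift N k + y)) 2 (cellMeasure N) :=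
      memLp_cell_of_continuous ((continuous_jet hws).comp (continuous_const.add continuous_id))
    refine (L2.integrable_inner (𝕜 := ℂ) g (h3.toLp _)).congr ?_
    filter_upwards [h3.coeFn_toLp] with y hy
    rw [hy]
  have h4 : ∑ k ∈ s, ∫ y, H (shift N k + y) ∂(cellMeasure N) = 0 := by
    rw [← h2, L2.inner_def, Finset.sum_congr rfl fun k _ => integral_congr_ae
      (g := fun y => inner ℂ (g y) (jet w (shift N k + y))) ?_, ← integral_finsetSum]
    · refine integral_congr_ae ?_
      filter_upwards [MemLp.coeFn_toLp (memLp_cell_of_continuous (N := N)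
        (continuous_jet (contDiff_periodize hN hwc hws))), ae_mem_cell] with y h5 h6
      rw [h5, (hs y h6).2, inner_sum]
    · exact fun k _ => hic k
    · filter_upwards [ae_mem_cell] with y hy
      simp only [hH]
      rw [wrap_shift_add hN k hy]
  rw [h4, smul_zero]

end Smooth

/-! ### The two phases -/

section Phases

variable {N : Fin 2 → ℕ} {Q₀ : Set Plane}

theorem wrap_one (y : Plane) : wrap 1 y = fun i => Int.fract (y i) := by
  ext i
  simp only [wrap, Pi.one_apply, Nat.cast_one, div_one, one_mul]
  exact Int.self_sub_floor _

theorem perExt_eq (S : Set Plane) : perExt S = wrap 1 ⁻¹' S := by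
  ext y
  simp [perExt, wrap_one]

theorem wrap_mem_perExt (S : Set Plane) (y : Plane) : wrap N y ∈ perExt S ↔ y ∈ perExt S := by
  have h : (fun i => Int.fract (wrap N y i)) = fun i => Int.fract (y i) := by
    ext i
    have : wrap N y i = y i - ((N i * ⌊y i / N i⌋ : ℤ) : ℝ) := by simp [wrap]
    rw [this, Int.fract_sub_intCast]
  simp only [perExt, Set.mem_ofPred_eq, h]

theorem measurableSet_F0 (hopen : IsOpen Q₀) : MeasurableSet (F0 Q₀) := by
  rw [F0, perExt_eq]
  exact measurable_wrap hopen.measurableSet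

theorem measurableSet_F1 : MeasurableSet (F1 Q₀) := by
  rw [F1, perExt_eq]
  exact measurable_wrap (measurableSet_cell.diff isClosed_closure.measurableSet)

theorem notMem_F1_of_mem_F0 {y : Plane} (h : y ∈ F0 Q₀) : y ∉ F1 Q₀ :=
  fun h1 => h1.2 (subset_closure h)

theorem one_pos_cell : ∀ i : Fin 2, 0 < (1 : Fin 2 → ℕ) i := fun _ => one_pos

/-- The two phases miss only the periodic extension of the boundary of `Q₀`. -/
theorem ae_mem_F0_or_F1 (hopen : IsOpen Q₀) (hbdry : volume (frontier Q₀) = 0) :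
    ∀ᵐ y : Plane, y ∈ F0 Q₀ ∨ y ∈ F1 Q₀ := by
  have h1 : ∀ᵐ y ∂(cellMeasure 1), y ∉ frontier Q₀ :=
    ae_restrict_of_ae (measure_eq_zero_iff_ae_notMem.1 hbdry)
  filter_upwards [(quasiMeasurePreserving_wrap one_pos_cell one_pos).ae h1] with y hy
  rw [inv_one, one_smul] at hy
  simp only [F0, F1, perExt_eq, Set.mem_preimage]
  by_cases h2 : wrap 1 y ∈ Q₀
  · exact Or.inl h2
  · refine Or.inr ⟨wrap_mem_cell one_pos_cell y, fun h3 => hy ?_⟩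
    rw [frontier, hopen.interior_eq]
    exact ⟨h3, h2⟩

/-- The cell contains the unit cell, hence the non-empty open set `Q₀`. Positivity of this measure
is what excludes non-zero constants in the rigidity argument. -/
theorem cellMeasure_F0_ne_zero (hN : ∀ i, 0 < N i) (hopen : IsOpen Q₀) (hne : Q₀.Nonempty)
    (hsub : closure Q₀ ⊆ cell 1) : cellMeasure N (F0 Q₀) ≠ 0 := by
  have h1 : Q₀ ⊆ F0 Q₀ ∩ cell N := by
    intro y hy
    have hc := hsub (subset_closure hy)
    constructor
    · rw [F0, perExt_eq, Set.mem_preimage]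
      have := wrap_shift_add one_pos_cell 0 hc
      have h0 : shift 1 0 = 0 := by
        ext i
        simp [shift]
      rw [h0, zero_add] at this
      rwa [this]
    · intro i
      have h2 := hc i
      have h3 : (1 : ℝ) ≤ N i := by exact_mod_cast hN i
      simp only [Pi.one_apply, Nat.cast_one] at h2
      exact ⟨h2.1, h2.2.trans_le h3⟩
  intro h
  rw [cellMeasure, Measure.restrict_apply (measurableSet_F0 hopen)] at h
  exact (hopen.measure_pos volume hne).ne' (measure_mono_null h1 h)

theorem chi0_of_mem {y : Plane} (h : y ∈ F0 Q₀) : chi0 Q₀ y = 1 := by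
  simp [chi0, h]

theorem chi0_of_mem_F1 {y : Plane} (h : y ∈ F1 Q₀) : chi0 Q₀ y = 0 := by
  have : y ∉ F0 Q₀ := fun h0 => notMem_F1_of_mem_F0 h0 h
  simp [chi0, this]

theorem chi1_of_mem {y : Plane} (h : y ∈ F1 Q₀) : chi1 Q₀ y = 1 := by
  simp [chi1, h]

theorem chi1_of_mem_F0 {y : Plane} (h : y ∈ F0 Q₀) : chi1 Q₀ y = 0 := by
  simp [chi1, notMem_F1_of_mem_F0 h]

theorem chi0_wrap (y : Plane) : chi0 Q₀ (wrap N y) = chi0 Q₀ y := by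
  have h1 : wrap N y ∈ F0 Q₀ ↔ y ∈ F0 Q₀ := wrap_mem_perExt Q₀ y
  by_cases h : y ∈ F0 Q₀ <;> simp [chi0, h, h1]

theorem chi1_wrap (y : Plane) : chi1 Q₀ (wrap N y) = chi1 Q₀ y := by
  have h1 : wrap N y ∈ F1 Q₀ ↔ y ∈ F1 Q₀ := wrap_mem_perExt (cell 1 \ closure Q₀) y
  by_cases h : y ∈ F1 Q₀ <;> simp [chi1, h, h1]

theorem measurable_chi0 (hopen : IsOpen Q₀) : Measurable (chi0 Q₀) :=
  measurable_one.indicator (measurableSet_F0 hopen)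

theorem measurable_chi1 : Measurable (chi1 Q₀) :=
  measurable_one.indicator measurableSet_F1

theorem norm_chi0_le (y : Plane) : ‖chi0 Q₀ y‖ ≤ 1 := by
  by_cases h : y ∈ F0 Q₀ <;> simp [chi0, h]

theorem norm_chi1_le (y : Plane) : ‖chi1 Q₀ y‖ ≤ 1 := by
  by_cases h : y ∈ F1 Q₀ <;> simp [chi1, h]

end Phases

/-! ### Rigidity of periodic solutions of the Cauchy–Riemann system -/

section Rigidity

variable {N : Fin 2 → ℕ}

/-- The operator `p ↦ (div v, div v^⊥)`. -/
def divOp : Jet →L[ℂ] C2 := coordMap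
  { toFun := fun p => ![p (0, some 0) + p (1, some 1), -p (1, some 0) + p (0, some 1)]
    map_add' := fun p q => by ext i; fin_cases i <;> simp <;> ring
    map_smul' := fun c p => by ext i; fin_cases i <;> simp <;> ring }

@[simp] theorem divOp_zero (p : Jet) : divOp p 0 = p (0, some 0) + p (1, some 1) := rfl
@[simp] theorem divOp_one (p : Jet) : divOp p 1 = -p (1, some 0) + p (0, some 1) := rfl

theorem contDiff_expo (m : Fin 2 → ℤ) : ContDiff ℝ ∞ (expo N m) := by
  unfold expo
  have h : ∀ i : Fin 2, ContDiff ℝ ∞ fun y : Plane => ((y i : ℝ) : ℂ) := fun i =>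
    Complex.ofRealCLM.contDiff.comp (contDiff_apply ℝ ℝ i)
  have h0 := h 0
  have h1 := h 1
  fun_prop

theorem expo_shift_add (hN : ∀ i, 0 < N i) (m k : Fin 2 → ℤ) (y : Plane) :
    expo N m (shift N k + y) = expo N m y := by
  have h0 : (N 0 : ℂ) ≠ 0 := by exact_mod_cast (hN 0).ne'
  have h1 : (N 1 : ℂ) ≠ 0 := by exact_mod_cast (hN 1).ne'
  unfold expo
  rw [Complex.exp_eq_exp_iff_exists_int]
  refine ⟨m 0 * k 0 + m 1 * k 1, ?_⟩
  simp only [Pi.add_apply, shift]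
  push_cast
  field_simp
  ring

theorem isCellPeriodic_expo (hN : ∀ i, 0 < N i) (m : Fin 2 → ℤ) :
    IsCellPeriodic N (expo N m) := by
  intro i y
  rw [← shift_single, add_comm, expo_shift_add hN]

theorem conj_expo (m : Fin 2 → ℤ) (y : Plane) : conj (expo N m y) = expo N (-m) y := by
  unfold expo
  rw [← Complex.exp_conj]
  congr 1
  simp only [map_mul, map_add, map_div₀, map_ofNat, Complex.conj_I, Complex.conj_ofReal,
    map_natCast, map_intCast, Pi.neg_apply, Int.cast_neg]
  ring

theorem pderiv_expo (m : Fin 2 → ℤ) (j : Fin 2) (y : Plane) :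
    pderiv j (expo N m) y = 2 * Real.pi * Complex.I * (m j / N j) * expo N m y := by
  have h : ∀ i : Fin 2, HasFDerivAt (fun y : Plane => ((y i : ℝ) : ℂ))
      (Complex.ofRealCLM.comp (ContinuousLinearMap.proj i)) y := fun i =>
    Complex.ofRealCLM.hasFDerivAt.comp y (ContinuousLinearMap.proj i : Plane →L[ℝ] ℝ).hasFDerivAt
  have h2 : ∀ i : Fin 2, HasFDerivAt (fun y : Plane => (m i : ℂ) * ((y i : ℝ) / N i))
      (((m i : ℂ) / N i) • Complex.ofRealCLM.comp (ContinuousLinearMap.proj i)) y := fun i => by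
    have := (h i).const_mul ((m i : ℂ) / N i)
    refine this.congr_of_eventuallyEq (Eventually.of_forall fun z => ?_)
    ring
  have h3 := (((h2 0).add (h2 1)).const_mul (2 * Real.pi * Complex.I)).cexp
  have h4 : HasFDerivAt (expo N m) _ y := h3
  rw [pderiv, h4.fderiv]
  fin_cases j <;> simp [expo] <;> ring

theorem integral_expo (hN : ∀ i, 0 < N i) {m : Fin 2 → ℤ} (hm : m ≠ 0) :
    ∫ y, expo N m y ∂(cellMeasure N) = 0 := by
  have e1 : ∀ y : Plane, expo N m y =
      ∏ i : Fin 2, Complex.exp (2 * Real.pi * Complex.I * m i / N i * (y i : ℝ)) := by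
    intro y
    rw [Fin.prod_univ_two, ← Complex.exp_add, expo]
    congr 1
    ring
  have e2 : cellMeasure N = Measure.pi fun i : Fin 2 =>
      (volume : Measure ℝ).restrict (Set.Ico (0 : ℝ) (N i)) := by
    rw [cellMeasure, cell_eq_pi, volume_pi, Measure.restrict_pi_pi]
  simp only [e1]
  rw [e2, integral_fintype_prod_eq_prod (𝕜 := ℂ) fun (i : Fin 2) (t : ℝ) =>
    Complex.exp (2 * Real.pi * Complex.I * m i / N i * (t : ℝ))]
  obtain ⟨i, hi⟩ := Function.ne_iff.1 hm
  rw [Pi.zero_apply] at hi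
  refine Finset.prod_eq_zero (Finset.mem_univ i) ?_
  have hNi : (N i : ℂ) ≠ 0 := by exact_mod_cast (hN i).ne'
  have hmi : (m i : ℂ) ≠ 0 := by exact_mod_cast hi
  have hc : (2 * Real.pi * Complex.I * m i / N i : ℂ) ≠ 0 := by
    exact div_ne_zero (mul_ne_zero Complex.two_pi_I_ne_zero hmi) hNi
  rw [restrict_Ico_eq_restrict_Ioc, ← intervalIntegral.integral_of_le (by positivity),
    integral_exp_mul_complex hc]
  have e3 : (2 * Real.pi * Complex.I * m i / N i * (N i : ℝ) : ℂ) =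
      m i * (2 * Real.pi * Complex.I) := by
    push_cast
    field_simp
  rw [e3, Complex.exp_int_mul_two_pi_mul_I]
  simp

/-- Subtracting the mean kills the zero frequency as well, and completeness applies. -/
theorem ae_const_of_expo (hN : ∀ i, 0 < N i) {g : Plane → ℂ}
    (hg : Integrable g (cellMeasure N))
    (h : ∀ m ≠ 0, ∫ y, expo N m y * g y ∂(cellMeasure N) = 0) :
    ∃ c : ℂ, g =ᵐ[cellMeasure N] fun _ => c := by
  have ha := area_pos hN
  have hvol : (cellMeasure N).real Set.univ = area N := by
    rw [cellMeasure, measureReal_restrict_apply_univ, Measure.real, volume_cell,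
      ENNReal.toReal_ofReal ha.le]
  have hac : (area N : ℂ) ≠ 0 := by exact_mod_cast ha.ne'
  set c : ℂ := (area N : ℂ)⁻¹ * ∫ y, g y ∂(cellMeasure N) with hc
  have hexp : ∀ m, Integrable (expo N m) (cellMeasure N) := fun m =>
    (memLp_cell_of_continuous (contDiff_expo m).continuous).integrable (by simp)
  have hexpg : ∀ m, Integrable (fun y => expo N m y * g y) (cellMeasure N) := fun m => by
    refine hg.bdd_mul (c := 1) (hexp m).1 (Eventually.of_forall fun y => ?_)
    have : expo N m y = Complex.exp ((2 * Real.pi * (m 0 * (y 0 / N 0) + m 1 * (y 1 / N 1)) : ℝ)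
        * Complex.I) := by
      rw [expo]
      congr 1
      push_cast
      ring
    rw [this, Complex.norm_exp_ofReal_mul_I]
  have h2 := ae_eq_zero_of_expo hN (g := fun y => g y - c) (hg.sub (integrable_const c)) (by
    intro m
    simp only [mul_sub]
    rw [integral_sub (hexpg m) ((hexp m).mul_const c), integral_mul_const]
    by_cases hm : m = 0
    · subst hm
      have e0 : ∀ y, expo N 0 y = 1 := by simp [expo]
      simp only [e0, one_mul, integral_const, hvol, hc, Complex.real_smul]
      field_simp
      ring
    · rw [h m hm, integral_expo hN hm]
      simp)
  refine ⟨c, ?_⟩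
  filter_upwards [h2] with y hy
  simpa [sub_eq_zero] using hy

/-- Orthogonality to all `(div b, div b^⊥)` is a weak Cauchy–Riemann system for `p`. For each
frequency it is a linear system for the two Fourier coefficients, with determinant `-((m₀/N₀)² +
(m₁/N₁)²)`, so only the zero frequency survives. The resulting constant vanishes because `p = 0` on
a set that is not null. -/
theorem eq_zero_of_orthogonal_divOp (hN : ∀ i, 0 < N i) {S : Set Plane}
    (hS : cellMeasure N S ≠ 0) {p : Lp C2 2 (cellMeasure N)}
    (hp : ∀ b ∈ H1Per N, ∫ y, inner ℂ (divOp (b y)) (p y) ∂(cellMeasure N) = 0)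
    (hpS : ∀ᵐ y ∂(cellMeasure N), y ∈ S → p y = 0) : p = 0 := by
  have hpi : ∀ i, Integrable (fun y => p y i) (cellMeasure N) := fun i =>
    MemLp.integrable (q := 2) (by simp)
      ((EuclideanSpace.proj (𝕜 := ℂ) i).comp_memLp' (Lp.memLp p))
  have hexpp : ∀ m i, Integrable (fun y => expo N m y * p y i) (cellMeasure N) := fun m i =>
    (memLp_cell_of_continuous (N := N) (contDiff_expo m).continuous).integrable_mul
      ((EuclideanSpace.proj (𝕜 := ℂ) i).comp_memLp' (Lp.memLp p))
  have key : ∀ (m : Fin 2 → ℤ) (c : C2),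
      (conj (c 0) * (m 0 / N 0) + conj (c 1) * (m 1 / N 1)) *
        (∫ y, expo N m y * p y 0 ∂(cellMeasure N)) +
      (- conj (c 1) * (m 0 / N 0) + conj (c 0) * (m 1 / N 1)) *
        (∫ y, expo N m y * p y 1 ∂(cellMeasure N)) = 0 := by
    intro m c
    -- The frequency is `-m` because the test field is conjugated by the inner product.
    have hvs : ContDiff ℝ ∞ fun y => expo N (-m) y • c := (contDiff_expo _).smul contDiff_const
    have hvp : IsCellPeriodic N fun y => expo N (-m) y • c := fun i y => by
      simp only
      rw [isCellPeriodic_expo hN (-m) i y]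
    have h1 := hp _ (toLp_jet_mem_H1Per hvs hvp)
    have hder : ∀ i j y, jet (fun y => expo N (-m) y • c) y (i, some j) =
        2 * Real.pi * Complex.I * (-(m j) / N j) * expo N (-m) y * c i := by
      intro i j y
      have h3 : HasFDerivAt (fun y => expo N (-m) y • c) _ y :=
        (((contDiff_expo (N := N) (-m)).differentiable (by simp)) y).hasFDerivAt.smul_const c
      have h4 := pderiv_expo (N := N) (-m) j y
      rw [pderiv] at h4
      simp only [jet, pderiv, h3.fderiv, ContinuousLinearMap.smulRight_apply, PiLp.smul_apply, h4,
        smul_eq_mul]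
      simp
    have h2 : ∫ y, inner ℂ (divOp (jet (fun y => expo N (-m) y • c) y)) (p y)
        ∂(cellMeasure N) = 0 := by
      rw [← h1]
      refine integral_congr_ae ?_
      filter_upwards [MemLp.coeFn_toLp (memLp_cell_of_continuous (N := N)
        (continuous_jet hvs))] with y hy
      rw [hy]
    have h5 : ∀ y, inner ℂ (divOp (jet (fun y => expo N (-m) y • c) y)) (p y) =
        (2 * Real.pi * Complex.I) *
          ((conj (c 0) * (m 0 / N 0) + conj (c 1) * (m 1 / N 1)) * (expo N m y * p y 0) +
          (- conj (c 1) * (m 0 / N 0) + conj (c 0) * (m 1 / N 1)) * (expo N m y * p y 1)) := by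
      intro y
      rw [PiLp.inner_apply, Fin.sum_univ_two]
      simp only [RCLike.inner_apply, divOp_zero, divOp_one, hder]
      simp only [map_add, map_mul, map_neg, map_div₀, conj_expo, neg_neg, map_natCast, map_intCast,
        Complex.conj_I, Complex.conj_ofReal, map_ofNat]
      ring
    simp only [h5] at h2
    rw [integral_const_mul, integral_add ((hexpp m 0).const_mul _) ((hexpp m 1).const_mul _),
      integral_const_mul, integral_const_mul] at h2
    exact (mul_eq_zero.1 h2).resolve_left (by simp [Real.pi_ne_zero])
  have hfour : ∀ m ≠ 0, ∀ i, ∫ y, expo N m y * p y i ∂(cellMeasure N) = 0 := by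
    intro m hm
    -- The two coordinate directions of `c` give the two equations `a P0 + b P1 = 0` and `b P0 - a
    -- P1 = 0`, with `a = m 0 / N 0` and `b = m 1 / N 1`.
    have k0 := key m (WithLp.toLp 2 ![1, 0])
    have k1 := key m (WithLp.toLp 2 ![0, 1])
    simp only [Matrix.cons_val_zero, Matrix.cons_val_one, map_one, map_zero, one_mul, zero_mul,
      add_zero, zero_add, neg_zero, neg_mul] at k0 k1
    set P0 := ∫ y, expo N m y * p y 0 ∂(cellMeasure N)
    set P1 := ∫ y, expo N m y * p y 1 ∂(cellMeasure N)
    have hnz : ((m 0 / N 0 : ℂ)) ^ 2 + ((m 1 / N 1 : ℂ)) ^ 2 ≠ 0 := by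
      have : (m 0 / N 0 : ℝ) ^ 2 + (m 1 / N 1 : ℝ) ^ 2 ≠ 0 := by
        obtain ⟨i, hi⟩ := Function.ne_iff.1 hm
        rw [Pi.zero_apply] at hi
        have h1 : (m i / N i : ℝ) ≠ 0 :=
          div_ne_zero (by exact_mod_cast hi) (by exact_mod_cast (hN i).ne')
        have h2 := pow_pos (abs_pos.2 h1) 2
        rw [sq_abs] at h2
        fin_cases i
        · exact (add_pos_of_pos_of_nonneg h2 (sq_nonneg _)).ne'
        · exact (add_pos_of_nonneg_of_pos (sq_nonneg _) h2).ne'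
      exact_mod_cast this
    intro i
    fin_cases i
    · refine (mul_eq_zero.1 (?_ : (((m 0 / N 0 : ℂ)) ^ 2 + ((m 1 / N 1 : ℂ)) ^ 2) * P0 = 0)
        ).resolve_left hnz
      linear_combination (m 0 / N 0 : ℂ) * k0 + (m 1 / N 1 : ℂ) * k1
    · refine (mul_eq_zero.1 (?_ : (((m 0 / N 0 : ℂ)) ^ 2 + ((m 1 / N 1 : ℂ)) ^ 2) * P1 = 0)
        ).resolve_left hnz
      linear_combination (m 1 / N 1 : ℂ) * k0 - (m 0 / N 0 : ℂ) * k1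
  have hconst := fun i => ae_const_of_expo hN (hpi i) (fun m hm => hfour m hm i)
  choose c hc using hconst
  have hall : ∀ᵐ y ∂(cellMeasure N), ∀ i, p y i = c i := by
    rw [ae_all_iff]
    exact hc
  have hc0 : ∀ i, c i = 0 := by
    by_contra hcon
    push Not at hcon
    obtain ⟨i, hi⟩ := hcon
    refine hS (measure_eq_zero_iff_ae_notMem.2 ?_)
    filter_upwards [hall, hpS] with y h1 h2 hy
    refine hi ?_
    rw [← h1 i, h2 hy]
    rfl
  rw [Lp.eq_zero_iff_ae_eq_zero]
  filter_upwards [hall] with y hy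
  ext i
  rw [hy i, hc0 i]
  rfl

end Rigidity

/-! ### The operators of the resolvent problem -/

section ResolventOperators

/-- The first component of the value of a jet. -/
def valFst : Jet →L[ℂ] Jet := coordMap
  { toFun := fun p q => match q with
      | (i, none) => if i = 0 then p (i, none) else 0
      | (_, some _) => 0
    map_add' := fun p q => by ext ⟨i, o⟩; cases o <;> simp; split_ifs <;> simp
    map_smul' := fun c p => by ext ⟨i, o⟩; cases o <;> simp }

/-- The gradient of the first component. -/
def derFst : Jet →L[ℂ] Jet := coordMap
  { toFun := fun p q => match q with
      | (_, none) => 0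
      | (i, some j) => if i = 0 then p (i, some j) else 0
    map_add' := fun p q => by ext ⟨i, o⟩; cases o <;> simp; split_ifs <;> simp
    map_smul' := fun c p => by ext ⟨i, o⟩; cases o <;> simp }

/-- The off-diagonal part of the tensor of the resolvent problem. -/
def offOp : Jet →L[ℂ] Jet := coordMap
  { toFun := fun p q => match q with
      | (_, none) => 0
      | (0, some 0) => p (1, some 1)
      | (0, some 1) => -p (1, some 0)
      | (1, some 0) => -p (0, some 1)
      | (1, some 1) => p (0, some 0)
    map_add' := fun p q => by
      ext ⟨i, o⟩
      cases o with
      | none => simp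
      | some j => fin_cases i <;> fin_cases j <;> simp <;> ring
    map_smul' := fun c p => by
      ext ⟨i, o⟩
      cases o with
      | none => simp
      | some j => fin_cases i <;> fin_cases j <;> simp }

/-- The jet with given values and zero derivatives. -/
def valIn : C2 →L[ℂ] Jet := coordMap
  { toFun := fun p q => match q with
      | (i, none) => p i
      | (_, some _) => 0
    map_add' := fun p q => by ext ⟨i, o⟩; cases o <;> simp
    map_smul' := fun c p => by ext ⟨i, o⟩; cases o <;> simp }

@[simp] theorem valFst_none (p : Jet) (i : Fin 2) :
    valFst p (i, none) = if i = 0 then p (i, none) else 0 := rfl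
@[simp] theorem valFst_some (p : Jet) (i j : Fin 2) : valFst p (i, some j) = 0 := rfl
@[simp] theorem derFst_none (p : Jet) (i : Fin 2) : derFst p (i, none) = 0 := rfl
@[simp] theorem derFst_some (p : Jet) (i j : Fin 2) :
    derFst p (i, some j) = if i = 0 then p (i, some j) else 0 := rfl
@[simp] theorem offOp_none (p : Jet) (i : Fin 2) : offOp p (i, none) = 0 := rfl
@[simp] theorem offOp_zero_zero (p : Jet) : offOp p (0, some 0) = p (1, some 1) := rfl
@[simp] theorem offOp_zero_one (p : Jet) : offOp p (0, some 1) = -p (1, some 0) := rfl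
@[simp] theorem offOp_one_zero (p : Jet) : offOp p (1, some 0) = -p (0, some 1) := rfl
@[simp] theorem offOp_one_one (p : Jet) : offOp p (1, some 1) = p (0, some 0) := rfl
@[simp] theorem valIn_none (p : C2) (i : Fin 2) : valIn p (i, none) = p i := rfl
@[simp] theorem valIn_some (p : C2) (i j : Fin 2) : valIn p (i, some j) = 0 := rfl

theorem inner_C2 (a b : C2) : inner ℂ a b = b 0 * conj (a 0) + b 1 * conj (a 1) := by
  rw [PiLp.inner_apply, Fin.sum_univ_two]
  rfl

/-- The coefficient of the tensor in the inclusions. -/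
def contrast (ε₀ ε₁ ε : ℝ) : ℝ := ε ^ 2 / (ε₀ - ε₁ + ε ^ 2)

/-- The tensor of the resolvent problem, acting on jets. -/
def fluxFam (Q₀ : Set Plane) (ε₀ ε₁ ε : ℝ) (y : Plane) : Jet →L[ℂ] Jet :=
  chi1 Q₀ y • (derPart + (offDiag ε₁ ε : ℂ) • offOp) +
    chi0 Q₀ y • ((contrast ε₀ ε₁ ε : ℂ) •
      (derPart + (gam ε₀ ε₁ : ℂ) • derFst + (offDiag ε₁ ε : ℂ) • offOp))

/-- The weight of the resolvent problem, acting on jets. -/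
def weightFam (Q₀ : Set Plane) (ε₀ ε₁ : ℝ) (y : Plane) : Jet →L[ℂ] Jet :=
  chi1 Q₀ y • valPart + chi0 Q₀ y • (valPart + (gam ε₀ ε₁ : ℂ) • valFst)

/-- The weight of the resolvent problem, acting on values. -/
def dataFam (Q₀ : Set Plane) (ε₀ ε₁ : ℝ) (y : Plane) : C2 →L[ℂ] Jet :=
  chi1 Q₀ y • valIn + chi0 Q₀ y • (valIn + (gam ε₀ ε₁ : ℂ) • valFst.comp valIn)

/-- On gradients `divOp* divOp = 1 + offOp`, so `1 + s offOp = s divOp* divOp + (1 - s)`. This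
identity separates the stiff part of the tensor from the part of order `ε²`. -/
theorem inner_flux (s : ℂ) (p q : Jet) : inner ℂ q ((derPart + s • offOp) p) =
    s * inner ℂ (divOp q) (divOp p) + (1 - s) * inner ℂ (derPart q) (derPart p) := by
  simp only [inner_jet, inner_C2]
  simp
  ring

theorem inner_derFst (p q : Jet) : inner ℂ q (derFst p) = inner ℂ (derFst q) (derFst p) := by
  simp [inner_jet]

theorem inner_valFst (p q : Jet) : inner ℂ q (valFst p) = inner ℂ (valFst q) (valFst p) := by
  simp [inner_jet]

theorem inner_valPart (p q : Jet) : inner ℂ q (valPart p) = inner ℂ (valPart q) (valPart p) := by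
  simp [inner_jet]

theorem inner_fluxFam (Q₀ : Set Plane) (ε₀ ε₁ ε : ℝ) (y : Plane) (p q : Jet) :
    inner ℂ q (fluxFam Q₀ ε₀ ε₁ ε y p) =
      chi1 Q₀ y * (offDiag ε₁ ε * inner ℂ (divOp q) (divOp p) +
        (1 - offDiag ε₁ ε) * inner ℂ (derPart q) (derPart p)) +
      chi0 Q₀ y * (contrast ε₀ ε₁ ε * (gam ε₀ ε₁ * inner ℂ (derFst q) (derFst p) +
        (offDiag ε₁ ε * inner ℂ (divOp q) (divOp p) +
          (1 - offDiag ε₁ ε) * inner ℂ (derPart q) (derPart p)))) := by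
  have h : derPart + (gam ε₀ ε₁ : ℂ) • derFst + (offDiag ε₁ ε : ℂ) • offOp =
      (gam ε₀ ε₁ : ℂ) • derFst + (derPart + (offDiag ε₁ ε : ℂ) • offOp) := by abel
  rw [fluxFam, h]
  simp only [add_apply, smul_apply, inner_add_right, inner_smul_right]
  rw [← inner_derFst, ← inner_flux]
  simp only [add_apply, smul_apply, inner_add_right, inner_smul_right]

theorem inner_weightFam (Q₀ : Set Plane) (ε₀ ε₁ : ℝ) (y : Plane) (p q : Jet) :
    inner ℂ q (weightFam Q₀ ε₀ ε₁ y p) =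
      chi1 Q₀ y * inner ℂ (valPart q) (valPart p) +
      chi0 Q₀ y * (inner ℂ (valPart q) (valPart p) +
        gam ε₀ ε₁ * inner ℂ (valFst q) (valFst p)) := by
  rw [weightFam]
  simp only [add_apply, smul_apply, inner_add_right, inner_smul_right]
  rw [← inner_valFst, ← inner_valPart]

theorem gam_add_one {ε₀ ε₁ : ℝ} : ε₀ / ε₁ = gam ε₀ ε₁ + 1 := by
  rw [gam]
  ring

/-- This and the next two lemmas translate the matrix formulation into operators on jets, where
Hilbert space arguments apply. -/
theorem cdot_tensorA (Q₀ : Set Plane) (ε₀ ε₁ ε : ℝ) (y : Plane) (p q : Jet) :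
    cdot ((tensorA Q₀ ε₀ ε₁ ε y).mulVec p.grad) q.grad =
      inner ℂ q (fluxFam Q₀ ε₀ ε₁ ε y p) := by
  have hk : ε ^ 2 / (ε₀ - ε₁ + ε ^ 2) = contrast ε₀ ε₁ ε := rfl
  simp only [cdot, Fin.sum_univ_four, inner_jet, fluxFam, tensorA, A1, A0, hk,
    gam_add_one (ε₀ := ε₀) (ε₁ := ε₁), Matrix.mulVec, dotProduct, Jet.grad, Jet.der]
  simp
  ring

theorem cdot_rho (Q₀ : Set Plane) (ε₀ ε₁ : ℝ) (y : Plane) (p q : Jet) :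
    cdot ((rho Q₀ ε₀ ε₁ y).mulVec p.val) q.val =
      inner ℂ q (weightFam Q₀ ε₀ ε₁ y p) := by
  simp only [cdot, Fin.sum_univ_two, inner_jet, weightFam, rho, gam_add_one,
    Matrix.mulVec, dotProduct, Jet.val]
  simp
  ring

theorem cdot_rho_data (Q₀ : Set Plane) (ε₀ ε₁ : ℝ) (y : Plane) (p : C2) (q : Jet) :
    cdot ((rho Q₀ ε₀ ε₁ y).mulVec p) q.val =
      inner ℂ q (dataFam Q₀ ε₀ ε₁ y p) := by
  simp only [cdot, Fin.sum_univ_two, inner_jet, dataFam, rho, gam_add_one,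
    Matrix.mulVec, dotProduct, Jet.val]
  simp
  ring

theorem isBddFamily_const {X E F : Type*} [MeasurableSpace X] [NormedAddCommGroup E]
    [NormedSpace ℂ E] [NormedAddCommGroup F] [NormedSpace ℂ F] {μ : Measure X} (T : E →L[ℂ] F) :
    IsBddFamily μ (fun _ => T) :=
  ⟨aestronglyMeasurable_const, ‖T‖, norm_nonneg _, fun _ => le_rfl⟩

theorem isBddFamily_smul {X E F : Type*} [MeasurableSpace X] [NormedAddCommGroup E]
    [NormedSpace ℂ E] [NormedAddCommGroup F] [NormedSpace ℂ F] {μ : Measure X} {c : X → ℂ}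
    (hc : Measurable c) (hc' : ∀ x, ‖c x‖ ≤ 1) (T : E →L[ℂ] F) :
    IsBddFamily μ (fun x => c x • T) := by
  refine ⟨hc.aestronglyMeasurable.smul_const T, ‖T‖, norm_nonneg _, fun x => ?_⟩
  rw [norm_smul]
  exact mul_le_of_le_one_left (norm_nonneg _) (hc' x)

theorem IsBddFamily.add {X E F : Type*} [MeasurableSpace X] [NormedAddCommGroup E]
    [NormedSpace ℂ E] [NormedAddCommGroup F] [NormedSpace ℂ F] {μ : Measure X}
    {m m' : X → E →L[ℂ] F} (h : IsBddFamily μ m) (h' : IsBddFamily μ m') :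
    IsBddFamily μ (fun x => m x + m' x) := by
  obtain ⟨C, h0, hC⟩ := h.bdd
  obtain ⟨C', h0', hC'⟩ := h'.bdd
  exact ⟨h.meas.add h'.meas, C + C', by positivity, fun x => norm_add_le_of_le (hC x) (hC' x)⟩

variable {Q₀ : Set Plane} {ε₀ ε₁ : ℝ} {μ : Measure Plane}

theorem isBddFamily_chi {E F : Type*} [NormedAddCommGroup E]
    [NormedSpace ℂ E] [NormedAddCommGroup F] [NormedSpace ℂ F] (hopen : IsOpen Q₀) (c : ℝ)
    (T T' : E →L[ℂ] F) :
    IsBddFamily μ (fun z => chi1 Q₀ (c • z) • T + chi0 Q₀ (c • z) • T') :=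
  (isBddFamily_smul (measurable_chi1.comp (measurable_const_smul c)) (fun _ => norm_chi1_le _)
    T).add (isBddFamily_smul ((measurable_chi0 hopen).comp (measurable_const_smul c))
      (fun _ => norm_chi0_le _) T')

theorem isBddFamily_flux (hopen : IsOpen Q₀) (ε c : ℝ) :
    IsBddFamily μ (fun z => fluxFam Q₀ ε₀ ε₁ ε (c • z)) := isBddFamily_chi hopen c _ _

theorem isBddFamily_weight (hopen : IsOpen Q₀) (c : ℝ) :
    IsBddFamily μ (fun z => weightFam Q₀ ε₀ ε₁ (c • z)) := isBddFamily_chi hopen c _ _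

theorem isBddFamily_data (hopen : IsOpen Q₀) (c : ℝ) :
    IsBddFamily μ (fun z => dataFam Q₀ ε₀ ε₁ (c • z)) := isBddFamily_chi hopen c _ _

theorem isBddFamily_div (c : ℝ) : IsBddFamily μ (fun z => chi1 Q₀ (c • z) • divOp) :=
  isBddFamily_smul (measurable_chi1.comp (measurable_const_smul c)) (fun _ => norm_chi1_le _) _

/-- The weak formulation of the resolvent problem holds for all `H¹` test functions. -/
theorem IsResolventSolution.inner_eq (hopen : IsOpen Q₀) {ε : ℝ}
    {f : Lp C2 2 (volume : Measure Plane)} {u : H1Plane}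
    (h : IsResolventSolution Q₀ ε₀ ε₁ ε f u) {Θ : Lp Jet 2 (volume : Measure Plane)}
    (hΘ : Θ ∈ H1Plane) :
    inner ℂ Θ (mulOp _ (isBddFamily_flux (ε₀ := ε₀) (ε₁ := ε₁) hopen ε ε⁻¹) u.1) +
      inner ℂ Θ (mulOp _ (isBddFamily_weight (ε₀ := ε₀) (ε₁ := ε₁) hopen ε⁻¹) u.1) =
    inner ℂ Θ (mulOp _ (isBddFamily_data (ε₀ := ε₀) (ε₁ := ε₁) hopen ε⁻¹) f) := by
  set a := mulOp _ (isBddFamily_flux (μ := volume) (ε₀ := ε₀) (ε₁ := ε₁) hopen ε ε⁻¹) u.1 with ha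
  set b := mulOp _ (isBddFamily_weight (μ := volume) (ε₀ := ε₀) (ε₁ := ε₁) hopen ε⁻¹) u.1 with hb
  set c := mulOp _ (isBddFamily_data (μ := volume) (ε₀ := ε₀) (ε₁ := ε₁) hopen ε⁻¹) f with hc
  have hclosed : IsClosed {Θ : Lp Jet 2 (volume : Measure Plane) |
      inner ℂ Θ a + inner ℂ Θ b = inner ℂ Θ c} :=
    isClosed_eq ((continuous_id.inner continuous_const).add (continuous_id.inner continuous_const))
      (continuous_id.inner continuous_const)
  refine closure_minimal ?_ hclosed hΘ
  rintro Θ ⟨v, hvc, hvs, hΘv⟩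
  have h1 := h v hvs hvc
  rw [Set.mem_ofPred_eq, L2.inner_def, L2.inner_def, L2.inner_def]
  have e1 : ∀ y, v y = (jet v y).val := fun y => rfl
  simp only [e1, cdot_tensorA, cdot_rho, cdot_rho_data] at h1
  refine Eq.trans (congrArg₂ (· + ·) (integral_congr_ae ?_) (integral_congr_ae ?_))
    (h1.trans (integral_congr_ae ?_))
  · filter_upwards [hΘv, coeFn_mulOp (isBddFamily_flux (μ := volume) (ε₀ := ε₀) (ε₁ := ε₁)
      hopen ε ε⁻¹) u.1] with z h2 h3
    rw [h2, ha, h3]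
  · filter_upwards [hΘv, coeFn_mulOp (isBddFamily_weight (μ := volume) (ε₀ := ε₀) (ε₁ := ε₁)
      hopen ε⁻¹) u.1] with z h2 h3
    rw [h2, hb, h3]
  · filter_upwards [hΘv, coeFn_mulOp (isBddFamily_data (μ := volume) (ε₀ := ε₀) (ε₁ := ε₁)
      hopen ε⁻¹) f] with z h2 h3
    rw [h2, hc, h3]

end ResolventOperators

/-! ### Energy estimates -/

section Energy

variable {Q₀ : Set Plane} {ε₀ ε₁ : ℝ}

theorem sq_norm_jet (p : Jet) : ‖p‖ ^ 2 =
    (‖p (0, none)‖ ^ 2 + ‖p (1, none)‖ ^ 2) +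
    (‖p (0, some 0)‖ ^ 2 + ‖p (0, some 1)‖ ^ 2 + ‖p (1, some 0)‖ ^ 2 +
      ‖p (1, some 1)‖ ^ 2) := by
  rw [EuclideanSpace.norm_sq_eq, Fintype.sum_prod_type]
  simp only [Fin.sum_univ_two, Fintype.sum_option]
  ring

theorem sq_norm_C2 (p : C2) : ‖p‖ ^ 2 = ‖p 0‖ ^ 2 + ‖p 1‖ ^ 2 := by
  rw [EuclideanSpace.norm_sq_eq, Fin.sum_univ_two]

/-- The second component is controlled through `∂₂v₂ = div v - ∂₁v₁` and `∂₁v₂ = ∂₂v₁ - div v^⊥`,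
each estimated by `|a + b|² ≤ 2|a|² + 2|b|²`. It makes the inclusion tensor coercive on full
gradients. -/
theorem sq_norm_derPart_le (p : Jet) :
    ‖derPart p‖ ^ 2 ≤ 3 * ‖derFst p‖ ^ 2 + 2 * ‖divOp p‖ ^ 2 := by
  rw [sq_norm_jet, sq_norm_jet (derFst p), sq_norm_C2]
  simp
  have h1 : ‖p (1, some 1)‖ ≤ ‖p (0, some 0) + p (1, some 1)‖ + ‖p (0, some 0)‖ := by
    have := norm_sub_le (p (0, some 0) + p (1, some 1)) (p (0, some 0))
    simpa using this
  have h2 : ‖p (1, some 0)‖ ≤ ‖-p (1, some 0) + p (0, some 1)‖ + ‖p (0, some 1)‖ := by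
    have := norm_sub_le (-p (1, some 0) + p (0, some 1)) (p (0, some 1))
    simpa using this
  have h3 := pow_le_pow_left₀ (norm_nonneg _) h1 2
  have h4 := pow_le_pow_left₀ (norm_nonneg _) h2 2
  have h5 := sq_nonneg (‖p (0, some 0) + p (1, some 1)‖ - ‖p (0, some 0)‖)
  have h6 := sq_nonneg (‖-p (1, some 0) + p (0, some 1)‖ - ‖p (0, some 1)‖)
  nlinarith

/-- With `t = ε²/ε₁ ≤ 1/2`, these follow from `1 - t ≤ √(1 - t) ≤ 1 - t/2`. -/
theorem one_sub_offDiag {ε : ℝ} (hε₁ : 0 < ε₁) (hε : ε ^ 2 ≤ ε₁ / 2) :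
    ε ^ 2 / (2 * ε₁) ≤ 1 - offDiag ε₁ ε ∧ 1 / 2 ≤ offDiag ε₁ ε ∧ offDiag ε₁ ε ≤ 1 := by
  have ht : ε ^ 2 / ε₁ ≤ 1 / 2 := by
    rw [div_le_iff₀ hε₁]
    linarith
  have ht0 : 0 ≤ ε ^ 2 / ε₁ := by positivity
  have h2 : ε ^ 2 / (2 * ε₁) = (ε ^ 2 / ε₁) / 2 := by field_simp
  rw [h2]
  unfold offDiag
  set t := ε ^ 2 / ε₁
  have hs := Real.sq_sqrt (show 0 ≤ 1 - t by linarith)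
  have hs0 := Real.sqrt_nonneg (1 - t)
  refine ⟨?_, ?_, ?_⟩ <;> nlinarith

theorem exists_energy_constant (hε₁ : 0 < ε₁) (hε₀ : ε₁ < ε₀) :
    ∃ c : ℝ, 0 < c ∧ c ≤ 1 / 2 ∧ ∀ ε : ℝ, 0 < ε → ε ≤ 1 → ε ^ 2 ≤ ε₁ / 2 →
      ∀ y, (y ∈ F0 Q₀ ∨ y ∈ F1 Q₀) → ∀ p : Jet,
        c * ε ^ 2 * ‖derPart p‖ ^ 2 + c * ‖(chi1 Q₀ y • divOp) p‖ ^ 2 + ‖valPart p‖ ^ 2 ≤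
          (inner ℂ p (fluxFam Q₀ ε₀ ε₁ ε y p)).re +
            (inner ℂ p (weightFam Q₀ ε₀ ε₁ y p)).re := by
  have hg : 0 < gam ε₀ ε₁ := by
    rw [gam, sub_pos, one_lt_div hε₁]
    exact hε₀
  -- The three bounds serve in turn: `1/2` for the divergence term in the matrix, where `s ≥ 1/2`;
  -- `1/(2ε₁)` for the lower bound of `1 - s`; and the last for the inclusions. There `1/(ε₀ - ε₁ +
  -- 1)` bounds the contrast over `ε²` from below for `ε ≤ 1`, and `min (γ/3) (1/4)` balances the
  -- constants `3` and `2` of `sq_norm_derPart_le` against `γ` and `s ≥ 1/2`.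
  set c : ℝ := min (1 / 2) (min (1 / (2 * ε₁))
    (1 / (ε₀ - ε₁ + 1) * min (gam ε₀ ε₁ / 3) (1 / 4))) with hc
  have hd : 0 < ε₀ - ε₁ + 1 := by linarith
  have hc0 : 0 < c := by
    rw [hc]
    positivity
  have hc1 : c ≤ 1 / 2 := min_le_left _ _
  have hc2 : c ≤ 1 / (2 * ε₁) := (min_le_right _ _).trans (min_le_left _ _)
  have hc3 : c ≤ 1 / (ε₀ - ε₁ + 1) * min (gam ε₀ ε₁ / 3) (1 / 4) :=
    (min_le_right _ _).trans (min_le_right _ _)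
  refine ⟨c, hc0, hc1, fun ε hε hε1 hε2 y hy p => ?_⟩
  obtain ⟨h1, h2, h3⟩ := one_sub_offDiag hε₁ hε2
  have hin : ∀ {E : Type} [NormedAddCommGroup E] [InnerProductSpace ℂ E] (x : E),
      inner ℂ x x = ((‖x‖ ^ 2 : ℝ) : ℂ) := fun x => by
    rw [inner_self_eq_norm_sq_to_K]
    push_cast
    rfl
  rw [inner_fluxFam, inner_weightFam]
  simp only [hin]
  rcases hy with hy | hy
  · have e0 : ‖(chi1 Q₀ y • divOp) p‖ = 0 := by
      rw [smul_apply, chi1_of_mem_F0 hy, zero_smul, norm_zero]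
    rw [e0, chi0_of_mem hy, chi1_of_mem_F0 hy]
    simp only [zero_mul, one_mul, zero_add, zero_pow two_ne_zero, mul_zero, add_zero]
    norm_cast
    have hk : ε ^ 2 * (1 / (ε₀ - ε₁ + 1)) ≤ contrast ε₀ ε₁ ε := by
      rw [contrast, mul_one_div]
      refine div_le_div_of_nonneg_left (by positivity) (by nlinarith) (by nlinarith)
    have hco : min (gam ε₀ ε₁ / 3) (1 / 4) * ‖derPart p‖ ^ 2 ≤
        gam ε₀ ε₁ * ‖derFst p‖ ^ 2 + (offDiag ε₁ ε * ‖divOp p‖ ^ 2 +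
          (1 - offDiag ε₁ ε) * ‖derPart p‖ ^ 2) := by
      set k := min (gam ε₀ ε₁ / 3) (1 / 4) with hk
      have hk1 : k ≤ gam ε₀ ε₁ / 3 := min_le_left _ _
      have hk2 : k ≤ 1 / 4 := min_le_right _ _
      have hk0 : 0 < k := by positivity
      have h5 := mul_le_mul_of_nonneg_left (sq_norm_derPart_le p) hk0.le
      have h6 := mul_le_mul_of_nonneg_right hk1 (sq_nonneg ‖derFst p‖)
      have h7 := mul_le_mul_of_nonneg_right hk2 (sq_nonneg ‖divOp p‖)
      have h8 := mul_le_mul_of_nonneg_right h2 (sq_nonneg ‖divOp p‖)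
      have h9 := mul_nonneg (sub_nonneg.2 h3) (sq_nonneg ‖derPart p‖)
      linarith
    have h10 := mul_le_mul hk hco (by positivity) (le_trans (by positivity) hk)
    have h11 : c * ε ^ 2 * ‖derPart p‖ ^ 2 ≤ ε ^ 2 * (1 / (ε₀ - ε₁ + 1)) *
        (min (gam ε₀ ε₁ / 3) (1 / 4) * ‖derPart p‖ ^ 2) := by
      have := mul_le_mul_of_nonneg_right hc3 (show 0 ≤ ε ^ 2 * ‖derPart p‖ ^ 2 by positivity)
      calc _ = c * (ε ^ 2 * ‖derPart p‖ ^ 2) := by ring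
        _ ≤ _ := this
        _ = _ := by ring
    have h12 : 0 ≤ gam ε₀ ε₁ * ‖valFst p‖ ^ 2 := by positivity
    linarith
  · rw [chi0_of_mem_F1 hy, chi1_of_mem hy]
    simp only [zero_mul, one_mul, add_zero, one_smul]
    norm_cast
    have h5 := mul_le_mul_of_nonneg_right (hc1.trans h2) (sq_nonneg ‖divOp p‖)
    have h6 : c * ε ^ 2 ≤ 1 - offDiag ε₁ ε := by
      refine le_trans ?_ h1
      have := mul_le_mul_of_nonneg_right hc2 (sq_nonneg ε)
      rwa [one_div_mul_eq_div] at this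
    have h7 := mul_le_mul_of_nonneg_right h6 (sq_nonneg ‖derPart p‖)
    linarith

end Energy

/-! ### A priori bounds for the solutions -/

section EnergyBound

variable {Q₀ : Set Plane} {ε₀ ε₁ : ℝ}

/-- The jets `(v, ε ∇v)`. -/
def scaleJet (ε : ℝ) : Lp Jet 2 (volume : Measure Plane) →L[ℂ] Lp Jet 2 (volume : Measure Plane) :=
  mulOp _ (isBddFamily_const (valPart + (ε : ℂ) • derPart))

/-- The divergences `(div v, div v^⊥)` in the matrix phase. -/
def divPhase (Q₀ : Set Plane) (ε : ℝ) :
    Lp Jet 2 (volume : Measure Plane) →L[ℂ] Lp C2 2 (volume : Measure Plane) :=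
  mulOp _ (isBddFamily_div (Q₀ := Q₀) ε⁻¹)

theorem coeFn_scaleJet (ε : ℝ) (u : Lp Jet 2 (volume : Measure Plane)) :
    scaleJet ε u =ᵐ[volume] fun z => (valPart + (ε : ℂ) • derPart) (u z) := coeFn_mulOp _ u

theorem coeFn_divPhase (ε : ℝ) (u : Lp Jet 2 (volume : Measure Plane)) :
    divPhase Q₀ ε u =ᵐ[volume] fun z => (chi1 Q₀ (ε⁻¹ • z) • divOp) (u z) := coeFn_mulOp _ u

theorem ae_smul_mem_F0_or_F1 (hopen : IsOpen Q₀) (hbdry : volume (frontier Q₀) = 0) {ε : ℝ}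
    (hε : 0 < ε) : ∀ᵐ z : Plane, ε⁻¹ • z ∈ F0 Q₀ ∨ ε⁻¹ • z ∈ F1 Q₀ := by
  have h1 : ∀ᵐ y ∂(cellMeasure 1), y ∈ F0 Q₀ ∨ y ∈ F1 Q₀ :=
    ae_restrict_of_ae (ae_mem_F0_or_F1 hopen hbdry)
  filter_upwards [(quasiMeasurePreserving_wrap one_pos_cell hε).ae h1] with z hz
  simpa only [F0, F1, wrap_mem_perExt] using hz

theorem sq_norm_scale (ε : ℝ) (p : Jet) :
    ‖(valPart + (ε : ℂ) • derPart) p‖ ^ 2 = ‖valPart p‖ ^ 2 + ε ^ 2 * ‖derPart p‖ ^ 2 := by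
  simp only [sq_norm_jet, add_apply, smul_apply, PiLp.add_apply, PiLp.smul_apply,
    valPart_none, valPart_some, derPart_none, derPart_some, smul_zero, add_zero, zero_add,
    norm_smul, mul_pow, Complex.norm_real, Real.norm_eq_abs, sq_abs, norm_zero]
  ring

/-- Young's inequality, with the weight bounded by `ε₀/ε₁ ≥ 1`. The half of `‖valPart p‖²` is to be
absorbed by the energy. -/
theorem re_inner_dataFam_le (hε₁ : 0 < ε₁) (hε₀ : ε₁ < ε₀) {y : Plane}
    (hy : y ∈ F0 Q₀ ∨ y ∈ F1 Q₀) (p : Jet) (a : C2) :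
    (inner ℂ p (dataFam Q₀ ε₀ ε₁ y a)).re ≤
      ‖valPart p‖ ^ 2 / 2 + (ε₀ / ε₁) ^ 2 * ‖a‖ ^ 2 / 2 := by
  have hg : 0 < gam ε₀ ε₁ := by
    rw [gam, sub_pos, one_lt_div hε₁]
    exact hε₀
  have h1 : ‖dataFam Q₀ ε₀ ε₁ y a‖ ^ 2 ≤ (ε₀ / ε₁) ^ 2 * ‖a‖ ^ 2 := by
    have hp0 := sq_nonneg ‖a 0‖
    have hp1 := sq_nonneg ‖a 1‖
    have hr : 1 ≤ (gam ε₀ ε₁ + 1) ^ 2 := by nlinarith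
    rw [gam_add_one, sq_norm_jet, sq_norm_C2]
    rcases hy with hy | hy
    · have e1 : dataFam Q₀ ε₀ ε₁ y a (0, none) = (gam ε₀ ε₁ + 1 : ℝ) * a 0 := by
        simp [dataFam, chi0_of_mem hy, chi1_of_mem_F0 hy]
        ring
      have e2 : dataFam Q₀ ε₀ ε₁ y a (1, none) = a 1 := by
        simp [dataFam, chi0_of_mem hy, chi1_of_mem_F0 hy]
      have e3 : ∀ i j, dataFam Q₀ ε₀ ε₁ y a (i, some j) = 0 := by
        intro i j
        simp [dataFam]
      rw [e1, e2]
      simp only [e3, norm_mul, Complex.norm_real, mul_pow, Real.norm_eq_abs, sq_abs, norm_zero]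
      nlinarith
    · have e1 : ∀ i, dataFam Q₀ ε₀ ε₁ y a (i, none) = a i := by
        intro i
        simp [dataFam, chi0_of_mem_F1 hy, chi1_of_mem hy]
      have e3 : ∀ i j, dataFam Q₀ ε₀ ε₁ y a (i, some j) = 0 := by
        intro i j
        simp [dataFam]
      simp only [e1, e3, norm_zero]
      nlinarith
  have h2 : inner ℂ p (dataFam Q₀ ε₀ ε₁ y a) =
      inner ℂ (valPart p) (dataFam Q₀ ε₀ ε₁ y a) := by
    simp [inner_jet, dataFam]
  rw [h2]
  have h3 := (Complex.re_le_norm _).trans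
    (norm_inner_le_norm (𝕜 := ℂ) (valPart p) (dataFam Q₀ ε₀ ε₁ y a))
  nlinarith [sq_nonneg (‖valPart p‖ - ‖dataFam Q₀ ε₀ ε₁ y a‖)]

/-- The solution is itself an admissible test function. The data term uses up half of the squared
values, and `c ≤ 1/2` leaves enough to control `u` as well. -/
theorem exists_energy_bound (hopen : IsOpen Q₀) (hbdry : volume (frontier Q₀) = 0)
    (hε₁ : 0 < ε₁) (hε₀ : ε₁ < ε₀) :
    ∃ C : ℝ, 0 ≤ C ∧ ∀ ε : ℝ, 0 < ε → ε ≤ 1 → ε ^ 2 ≤ ε₁ / 2 →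
      ∀ (f : Lp C2 2 (volume : Measure Plane)) (u : H1Plane),
        IsResolventSolution Q₀ ε₀ ε₁ ε f u →
          ‖scaleJet ε u.1‖ ^ 2 ≤ C * ‖f‖ ^ 2 ∧ ‖divPhase Q₀ ε u.1‖ ^ 2 ≤ C * ‖f‖ ^ 2 := by
  obtain ⟨c, hc0, hc1, hc⟩ := exists_energy_constant (Q₀ := Q₀) hε₁ hε₀
  refine ⟨(ε₀ / ε₁) ^ 2 / 2 / c, by positivity, fun ε hε hε1 hε2 f u hu => ?_⟩
  have h1 := congrArg Complex.re (hu.inner_eq hopen u.2)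
  rw [L2.inner_def, L2.inner_def, L2.inner_def, Complex.add_re] at h1
  have hm1 := isBddFamily_flux (μ := (volume : Measure Plane)) (ε₀ := ε₀) (ε₁ := ε₁) hopen ε ε⁻¹
  have hm2 := isBddFamily_weight (μ := (volume : Measure Plane)) (ε₀ := ε₀) (ε₁ := ε₁) hopen ε⁻¹
  have hm3 := isBddFamily_data (μ := (volume : Measure Plane)) (ε₀ := ε₀) (ε₁ := ε₁) hopen ε⁻¹
  have i1 := L2.integrable_inner (𝕜 := ℂ) u.1 (mulOp _ hm1 u.1)
  have i2 := L2.integrable_inner (𝕜 := ℂ) u.1 (mulOp _ hm2 u.1)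
  have i3 := L2.integrable_inner (𝕜 := ℂ) u.1 (mulOp _ hm3 f)
  have hre : ∀ {g : Plane → ℂ}, Integrable g → (∫ z, g z).re = ∫ z, (g z).re := fun hg =>
    (integral_re hg).symm
  have hri : ∀ {g : Plane → ℂ}, Integrable g → Integrable fun z => (g z).re := fun hg => hg.re
  have r1 := hri i1
  have r2 := hri i2
  have r3 := hri i3
  rw [hre i1, hre i2, hre i3, ← integral_add r1 r2] at h1
  have j1 := integrable_sq_norm (scaleJet ε u.1)
  have j2 := integrable_sq_norm (divPhase Q₀ ε u.1)
  have j3 := integrable_sq_norm f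
  have j12 : Integrable fun z =>
      c * (‖scaleJet ε u.1 z‖ ^ 2 + ‖divPhase Q₀ ε u.1 z‖ ^ 2) := (j1.add j2).const_mul c
  have r12 : Integrable fun z => (inner ℂ (u.1 z) (mulOp _ hm1 u.1 z)).re +
      (inner ℂ (u.1 z) (mulOp _ hm2 u.1 z)).re := r1.add r2
  have hpt : ∀ᵐ z, c * (‖scaleJet ε u.1 z‖ ^ 2 + ‖divPhase Q₀ ε u.1 z‖ ^ 2) +
      (inner ℂ (u.1 z) (mulOp _ hm3 f z)).re ≤
      ((inner ℂ (u.1 z) (mulOp _ hm1 u.1 z)).re + (inner ℂ (u.1 z) (mulOp _ hm2 u.1 z)).re) +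
        (ε₀ / ε₁) ^ 2 / 2 * ‖f z‖ ^ 2 := by
    filter_upwards [ae_smul_mem_F0_or_F1 hopen hbdry hε, coeFn_scaleJet ε u.1,
      coeFn_divPhase (Q₀ := Q₀) ε u.1, coeFn_mulOp hm1 u.1, coeFn_mulOp hm2 u.1,
      coeFn_mulOp hm3 f] with z hz h2 h3 h4 h5 h6
    rw [h2, h3, h4, h5, h6, sq_norm_scale]
    have h7 := hc ε hε hε1 hε2 _ hz (u.1 z)
    have h8 := re_inner_dataFam_le hε₁ hε₀ hz (u.1 z) (f z)
    have h9 := mul_le_mul_of_nonneg_right hc1 (sq_nonneg ‖valPart (u.1 z)‖)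
    linarith
  have h10 := integral_mono_ae (j12.add r3)
    (r12.add (j3.const_mul ((ε₀ / ε₁) ^ 2 / 2))) hpt
  have e1 : ∫ z, (c * (‖scaleJet ε u.1 z‖ ^ 2 + ‖divPhase Q₀ ε u.1 z‖ ^ 2) +
      (inner ℂ (u.1 z) (mulOp _ hm3 f z)).re) =
      c * (‖scaleJet ε u.1‖ ^ 2 + ‖divPhase Q₀ ε u.1‖ ^ 2) +
        ∫ z, (inner ℂ (u.1 z) (mulOp _ hm3 f z)).re := by
    rw [integral_add j12 r3, integral_const_mul, integral_add j1 j2,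
      integral_sq_norm, integral_sq_norm]
  have e2 : ∫ z, (((inner ℂ (u.1 z) (mulOp _ hm1 u.1 z)).re +
      (inner ℂ (u.1 z) (mulOp _ hm2 u.1 z)).re) + (ε₀ / ε₁) ^ 2 / 2 * ‖f z‖ ^ 2) =
      (∫ z, ((inner ℂ (u.1 z) (mulOp _ hm1 u.1 z)).re +
        (inner ℂ (u.1 z) (mulOp _ hm2 u.1 z)).re)) + (ε₀ / ε₁) ^ 2 / 2 * ‖f‖ ^ 2 := by
    rw [integral_add r12 (j3.const_mul _), integral_const_mul, integral_sq_norm]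
  have h11 := e1.symm.le.trans (h10.trans e2.le)
  have h1' : ∫ z, ((inner ℂ (u.1 z) (mulOp _ hm1 u.1 z)).re +
      (inner ℂ (u.1 z) (mulOp _ hm2 u.1 z)).re) = ∫ z, (inner ℂ (u.1 z) (mulOp _ hm3 f z)).re := h1
  rw [h1'] at h11
  have h12 : c * (‖scaleJet ε u.1‖ ^ 2 + ‖divPhase Q₀ ε u.1‖ ^ 2) ≤
      (ε₀ / ε₁) ^ 2 / 2 * ‖f‖ ^ 2 := by linarith
  have h13 : ‖scaleJet ε u.1‖ ^ 2 + ‖divPhase Q₀ ε u.1‖ ^ 2 ≤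
      (ε₀ / ε₁) ^ 2 / 2 / c * ‖f‖ ^ 2 := by
    rw [div_mul_eq_mul_div, le_div_iff₀ hc0]
    linarith
  constructor <;> linarith [sq_nonneg ‖scaleJet ε u.1‖, sq_nonneg ‖divPhase Q₀ ε u.1‖]

end EnergyBound

/-! ### Oscillating integrals -/

section Osc

variable {N : Fin 2 → ℕ} {ε : ℝ} {E : Type*} [NormedAddCommGroup E] [InnerProductSpace ℂ E]

/-- The integral of `U` against a slowly modulated oscillating function. -/
def osc (N : Fin 2 → ℕ) (ε : ℝ) (η : Plane → ℂ) (g : Lp E 2 (cellMeasure N))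
    (U : Lp E 2 (volume : Measure Plane)) : ℂ :=
  ∫ z, η z * inner ℂ (g (wrap N (ε⁻¹ • z))) (U z)

/-- Unlike the bound that defines `wrapOp`, this one is uniform for `ε ≤ 1`. -/
theorem norm_wrapOp_le (hN : ∀ i, 0 < N i) (hε : 0 < ε) (hε1 : ε ≤ 1) {K : Set Plane}
    (hK : IsCompact K) (g : Lp E 2 (cellMeasure N)) :
    ‖wrapOp hN hε hK g‖ ≤
      Real.sqrt ((area N)⁻¹ * volume.real (Metric.cthickening (cellDiam N) K)) * ‖g‖ := by
  have ha := area_pos hN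
  have hfin : volume (Metric.cthickening (cellDiam N) K) ≠ ⊤ :=
    hK.cthickening.measure_lt_top.ne
  have hd : ε * cellDiam N ≤ cellDiam N :=
    mul_le_of_le_one_left (by unfold cellDiam; positivity) hε1
  have h := (lintegral_wrap_le hN hε (K := K) g).trans
    (mul_le_mul_left (measure_mono (Metric.cthickening_mono hd K)) _)
  have e1 : ∫⁻ z, ‖K.indicator (fun z => g (wrap N (ε⁻¹ • z))) z‖ₑ ^ 2 =
      ‖wrapOp hN hε hK g‖ₑ ^ 2 := by
    rw [sq_enorm_Lp]
    refine lintegral_congr_ae ?_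
    filter_upwards [coeFn_wrapOp hN hε hK g] with z hz
    rw [hz]
  rw [e1] at h
  have h2 := ENNReal.toReal_mono (ENNReal.mul_ne_top hfin (by simp)) h
  simp only [ENNReal.toReal_mul, ENNReal.toReal_pow, toReal_enorm,
    ENNReal.toReal_ofReal ha.le] at h2
  refine abs_le_of_sq_le_sq' ?_ (by positivity) |>.2
  rw [mul_pow, Real.sq_sqrt (by positivity), mul_assoc, inv_mul_eq_div, le_div_iff₀ ha, mul_comm]
  exact h2

theorem exists_norm_osc_le (hN : ∀ i, 0 < N i) {η : Plane → ℂ}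
    (hη : Continuous η) (hc : HasCompactSupport η) :
    ∃ C : ℝ, 0 ≤ C ∧ ∀ ε : ℝ, 0 < ε → ε ≤ 1 → ∀ (g : Lp E 2 (cellMeasure N))
      (U : Lp E 2 (volume : Measure Plane)), ‖osc N ε η g U‖ ≤ C * ‖g‖ * ‖U‖ := by
  obtain ⟨M, hM⟩ := hc.exists_bound_of_continuous hη
  have hm : IsBddFamily (volume : Measure Plane) fun z => η z • ContinuousLinearMap.id ℂ E := by
    refine ⟨hη.aestronglyMeasurable.smul_const _, M, (norm_nonneg _).trans (hM 0), fun z => ?_⟩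
    rw [norm_smul]
    exact (mul_le_of_le_one_right (norm_nonneg _) ContinuousLinearMap.norm_id_le).trans (hM z)
  set S := mulOp _ hm with hS
  refine ⟨Real.sqrt ((area N)⁻¹ * volume.real (Metric.cthickening (cellDiam N) (tsupport η))) *
    ‖S‖, by positivity, fun ε hε hε1 g U => ?_⟩
  have e1 : osc N ε η g U = inner ℂ (wrapOp hN hε hc g) (S U) := by
    rw [L2.inner_def, osc]
    refine integral_congr_ae ?_
    filter_upwards [coeFn_wrapOp hN hε hc g, coeFn_mulOp hm U] with z h1 h2
    rw [hS, h1, h2, smul_apply, inner_smul_right, ContinuousLinearMap.id_apply]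
    by_cases hz : z ∈ tsupport η
    · rw [Set.indicator_of_mem hz]
    · rw [image_eq_zero_of_notMem_tsupport hz, zero_mul, zero_mul]
  rw [e1]
  refine (norm_inner_le_norm _ _).trans ?_
  calc _ ≤ (Real.sqrt ((area N)⁻¹ * volume.real (Metric.cthickening (cellDiam N)
          (tsupport η))) * ‖g‖) * (‖S‖ * ‖U‖) :=
        mul_le_mul (norm_wrapOp_le hN hε hε1 hc g) (S.le_opNorm U) (norm_nonneg _) (by positivity)
    _ = _ := by ring

theorem osc_sub (hN : ∀ i, 0 < N i) (hε : 0 < ε) {η : Plane → ℂ}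
    (hη : Continuous η) (hc : HasCompactSupport η) (g g' : Lp E 2 (cellMeasure N))
    (U : Lp E 2 (volume : Measure Plane)) :
    osc N ε η (g - g') U = osc N ε η g U - osc N ε η g' U := by
  unfold osc
  rw [← integral_sub (integrable_wrap_inner hN hε hη hc g U)
    (integrable_wrap_inner hN hε hη hc g' U)]
  refine integral_congr_ae ?_
  filter_upwards [(quasiMeasurePreserving_wrap hN hε).ae (Lp.coeFn_sub g g')] with z hz
  rw [hz, Pi.sub_apply, inner_sub_left, mul_sub]

/-- Weak convergence tolerates strongly convergent test profiles. This is needed because the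
rescaled tensor acting on a test field still depends on `ε`. -/
theorem TS.tendsto_osc (hN : ∀ i, 0 < N i) {δ : ℕ → ℝ} (hδ : ∀ n, 0 < δ n)
    (hδ0 : Tendsto δ atTop (𝓝 0)) {U : ℕ → Lp E 2 (volume : Measure Plane)} {C : ℝ}
    (hC : ∀ n, ‖U n‖ ≤ C) {W : Lp (Lp E 2 (cellMeasure N)) 2 (volume : Measure Plane)}
    (h : TS N δ U W) {η : Plane → ℂ} (hη : Continuous η) (hc : HasCompactSupport η)
    {g : ℕ → Lp E 2 (cellMeasure N)} {g₀ : Lp E 2 (cellMeasure N)}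
    (hg : Tendsto g atTop (𝓝 g₀)) :
    Tendsto (fun n => osc N (δ n) η (g n) (U n)) atTop
      (𝓝 ((area N : ℂ)⁻¹ * ∫ x, η x * inner ℂ g₀ (W x))) := by
  obtain ⟨M, hM0, hM⟩ := exists_norm_osc_le (E := E) hN hη hc
  have h1 : Tendsto (fun n => osc N (δ n) η (g n) (U n) - osc N (δ n) η g₀ (U n)) atTop
      (𝓝 0) := by
    have h2 : Tendsto (fun n => M * ‖g n - g₀‖ * C) atTop (𝓝 0) := by
      have := ((tendsto_iff_norm_sub_tendsto_zero.1 hg).const_mul M).mul_const C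
      simpa using this
    refine squeeze_zero_norm' ?_ h2
    filter_upwards [hδ0.eventually (gt_mem_nhds one_pos)] with n hn
    rw [← osc_sub hN (hδ n) hη hc]
    refine (hM _ (hδ n) hn.le _ _).trans ?_
    exact mul_le_mul_of_nonneg_left (hC n) (by positivity)
  have h3 := h1.add (h η hη hc g₀)
  rw [zero_add] at h3
  exact h3.congr fun n => sub_add_cancel _ _

end Osc

/-! ### Localization -/

section Localization

theorem ae_eq_zero_of_integral_smooth_mul {J : Plane → ℂ} (hJ : MemLp J 2 volume)
    (h : ∀ η : Plane → ℂ, ContDiff ℝ ∞ η → HasCompactSupport η → ∫ x, η x * J x = 0) :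
    J =ᵐ[volume] 0 := by
  refine ae_eq_zero_of_integral_contDiff_smul_eq_zero
    (hJ.locallyIntegrable (by simp)) fun φ hφ hφc => ?_
  have h1 := h (fun x => (φ x : ℂ)) (Complex.ofRealCLM.contDiff.comp hφ)
    (hφc.comp_left (g := fun t : ℝ => (t : ℂ)) (by simp))
  simpa only [Complex.real_smul] using h1

/-- Exchanges "for every `g`, almost every `x`" with "for almost every `x`, every `g`": a countable
dense set and continuity in `g` suffice. -/
theorem ae_forall_eq_zero {G X : Type*} [TopologicalSpace G] [TopologicalSpace.SeparableSpace G]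
    [MeasurableSpace X] {μ : Measure X} {A : G → X → ℂ} (hA : ∀ x, Continuous fun g => A g x)
    (h : ∀ g, A g =ᵐ[μ] 0) : ∀ᵐ x ∂μ, ∀ g, A g x = 0 := by
  obtain ⟨s, hs, hsd⟩ := TopologicalSpace.exists_countable_dense G
  have h1 : ∀ᵐ x ∂μ, ∀ g ∈ s, A g x = 0 := (ae_ball_iff hs).2 fun g _ => h g
  filter_upwards [h1] with x hx g
  exact congrFun (Continuous.ext_on hsd (hA x) continuous_const hx) g

theorem memLp_inner_const {X H : Type*} [MeasurableSpace X] {μ : Measure X}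
    [NormedAddCommGroup H] [InnerProductSpace ℂ H] (g : H) (W : Lp H 2 μ) :
    MemLp (fun x => inner ℂ g (W x)) 2 μ := (Lp.memLp W).const_inner g

theorem ae_forall_inner_eq_zero {G H : Type*} [TopologicalSpace G]
    [TopologicalSpace.SeparableSpace G] [NormedAddCommGroup H] [InnerProductSpace ℂ H]
    {T : G → H} (hT : Continuous T) {W : Lp H 2 (volume : Measure Plane)}
    (h : ∀ g, ∀ η : Plane → ℂ, ContDiff ℝ ∞ η → HasCompactSupport η →
      ∫ x, η x * inner ℂ (T g) (W x) = 0) : ∀ᵐ x, ∀ g, inner ℂ (T g) (W x) = 0 :=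
  ae_forall_eq_zero (fun _ => hT.inner continuous_const)
    fun g => ae_eq_zero_of_integral_smooth_mul (memLp_inner_const _ W) (h g)

end Localization

/-! ### Adjoints of multiplication operators -/

section MulOpAdjoint

variable {X : Type*} [MeasurableSpace X] {μ : Measure X}
  {E F : Type*} [NormedAddCommGroup E] [InnerProductSpace ℂ E]
  [NormedAddCommGroup F] [InnerProductSpace ℂ F]

theorem inner_mulOp_of_adjoint {m : X → E →L[ℂ] F} {m' : X → F →L[ℂ] E}
    (hm : IsBddFamily μ m) (hm' : IsBddFamily μ m')
    (h : ∀ x p q, inner ℂ q (m x p) = inner ℂ (m' x q) p) (a : Lp E 2 μ) (b : Lp F 2 μ) :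
    inner ℂ b (mulOp m hm a) = inner ℂ (mulOp m' hm' b) a := by
  rw [L2.inner_def, L2.inner_def]
  refine integral_congr_ae ?_
  filter_upwards [coeFn_mulOp hm a, coeFn_mulOp hm' b] with x h1 h2
  rw [h1, h2, h]

end MulOpAdjoint

/-! ### The resolvent problem tested with oscillating functions -/

section CellOperators

variable {N : Fin 2 → ℕ} {Q₀ : Set Plane} {ε₀ ε₁ : ℝ}

/-- The values of a jet. -/
def valOut : Jet →L[ℂ] C2 := coordMap
  { toFun := fun p i => p (i, none)
    map_add' := fun _ _ => rfl
    map_smul' := fun _ _ => rfl }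

@[simp] theorem valOut_apply (p : Jet) (i : Fin 2) : valOut p i = p (i, none) := rfl

/-- The operator `1 + γ P₁ + s J` on gradients. -/
def incOp (ε₀ ε₁ s : ℝ) : Jet →L[ℂ] Jet :=
  derPart + (gam ε₀ ε₁ : ℂ) • derFst + (s : ℂ) • offOp

/-- The adjoint of `dataFam`. -/
def dataAdj (Q₀ : Set Plane) (ε₀ ε₁ : ℝ) (y : Plane) : Jet →L[ℂ] C2 :=
  chi1 Q₀ y • valOut + chi0 Q₀ y • (valOut + (gam ε₀ ε₁ : ℂ) • valOut.comp valFst)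

theorem isBddFamily_weight_cell (hopen : IsOpen Q₀) :
    IsBddFamily (cellMeasure N) (weightFam Q₀ ε₀ ε₁) :=
  (isBddFamily_smul measurable_chi1 norm_chi1_le _).add
    (isBddFamily_smul (measurable_chi0 hopen) norm_chi0_le _)

theorem isBddFamily_dataAdj (hopen : IsOpen Q₀) :
    IsBddFamily (cellMeasure N) (dataAdj Q₀ ε₀ ε₁) :=
  (isBddFamily_smul measurable_chi1 norm_chi1_le _).add
    (isBddFamily_smul (measurable_chi0 hopen) norm_chi0_le _)

theorem isBddFamily_chi1 {E F : Type*} [NormedAddCommGroup E] [NormedSpace ℂ E]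
    [NormedAddCommGroup F] [NormedSpace ℂ F] (Q₀ : Set Plane) (T : E →L[ℂ] F) :
    IsBddFamily (cellMeasure N) (fun y => chi1 Q₀ y • T) :=
  isBddFamily_smul measurable_chi1 norm_chi1_le _

theorem isBddFamily_chi0 {E F : Type*} [NormedAddCommGroup E] [NormedSpace ℂ E]
    [NormedAddCommGroup F] [NormedSpace ℂ F] (hopen : IsOpen Q₀) (T : E →L[ℂ] F) :
    IsBddFamily (cellMeasure N) (fun y => chi0 Q₀ y • T) :=
  isBddFamily_smul (measurable_chi0 hopen) norm_chi0_le _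

/-- Application of a fixed operator to `L²` functions on the cell. -/
def mapCell {E F : Type*} [NormedAddCommGroup E] [NormedSpace ℂ E]
    [NormedAddCommGroup F] [NormedSpace ℂ F] (N : Fin 2 → ℕ) (T : E →L[ℂ] F) :
    Lp E 2 (cellMeasure N) →L[ℂ] Lp F 2 (cellMeasure N) := mulOp _ (isBddFamily_const T)

theorem coeFn_mapCell {E F : Type*} [NormedAddCommGroup E] [NormedSpace ℂ E]
    [NormedAddCommGroup F] [NormedSpace ℂ F] (T : E →L[ℂ] F) (b : Lp E 2 (cellMeasure N)) :
    mapCell N T b =ᵐ[cellMeasure N] fun y => T (b y) := coeFn_mulOp _ b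

/-- The rescaled tensor of the resolvent problem on the cell. -/
def fluxCell (N : Fin 2 → ℕ) (hopen : IsOpen Q₀) (ε₀ ε₁ t k s : ℝ) :
    Lp Jet 2 (cellMeasure N) →L[ℂ] Lp Jet 2 (cellMeasure N) :=
  (t : ℂ) • mulOp _ (isBddFamily_chi1 Q₀ derPart) +
    (k : ℂ) • (mulOp _ (isBddFamily_chi0 hopen (derPart + (gam ε₀ ε₁ : ℂ) • derFst)) +
      (s : ℂ) • mulOp _ (isBddFamily_chi0 hopen offOp))

theorem coeFn_fluxCell (hopen : IsOpen Q₀) (t k s : ℝ) (b : Lp Jet 2 (cellMeasure N)) :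
    fluxCell N hopen ε₀ ε₁ t k s b =ᵐ[cellMeasure N] fun y =>
      (t : ℂ) • chi1 Q₀ y • derPart (b y) + (k : ℂ) • chi0 Q₀ y • incOp ε₀ ε₁ s (b y) := by
  set a1 := mulOp _ (isBddFamily_chi1 (N := N) Q₀ derPart) b with h1
  set a2 := mulOp _ (isBddFamily_chi0 (N := N) hopen
    (derPart + (gam ε₀ ε₁ : ℂ) • derFst)) b with h2
  set a3 := mulOp _ (isBddFamily_chi0 (N := N) hopen offOp) b with h3
  have h : fluxCell N hopen ε₀ ε₁ t k s b = (t : ℂ) • a1 + (k : ℂ) • (a2 + (s : ℂ) • a3) := rfl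
  rw [h]
  filter_upwards [Lp.coeFn_add ((t : ℂ) • a1) ((k : ℂ) • (a2 + (s : ℂ) • a3)),
    Lp.coeFn_smul (t : ℂ) a1, Lp.coeFn_smul (k : ℂ) (a2 + (s : ℂ) • a3),
    Lp.coeFn_add a2 ((s : ℂ) • a3), Lp.coeFn_smul (s : ℂ) a3,
    coeFn_mulOp (isBddFamily_chi1 (N := N) Q₀ derPart) b,
    coeFn_mulOp (isBddFamily_chi0 (N := N) hopen (derPart + (gam ε₀ ε₁ : ℂ) • derFst)) b,
    coeFn_mulOp (isBddFamily_chi0 (N := N) hopen offOp) b] with y e1 e2 e3 e4 e5 e6 e7 e8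
  rw [e1, Pi.add_apply, e2, Pi.smul_apply, e3, Pi.smul_apply, e4, Pi.add_apply, e5,
    Pi.smul_apply, h1, h2, h3, e6, e7, e8]
  simp only [incOp, add_apply, smul_apply]
  module

end CellOperators

/-! ### Pointwise expansion of the problem in powers of `ε` -/

section PointwiseIdentities

variable {Q₀ : Set Plane} {ε₀ ε₁ : ℝ}

theorem inner_derPart_left (p q : Jet) :
    inner ℂ (derPart q) p = inner ℂ (derPart q) (derPart p) := by
  simp [inner_jet]

theorem inner_incOp (s : ℝ) (p q : Jet) : inner ℂ (incOp ε₀ ε₁ s q) p =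
    gam ε₀ ε₁ * inner ℂ (derFst q) (derFst p) + (s * inner ℂ (divOp q) (divOp p) +
      (1 - s) * inner ℂ (derPart q) (derPart p)) := by
  simp only [inner_jet, inner_C2, incOp]
  simp
  ring

theorem pderiv_conj {η : Plane → ℂ} (hη : ContDiff ℝ ∞ η) (j : Fin 2) (z : Plane) :
    pderiv j (fun z => conj (η z)) z = conj (pderiv j η z) := by
  have h : HasFDerivAt (fun z => conj (η z))
      ((Complex.conjCLE : ℂ →L[ℝ] ℂ).comp (fderiv ℝ η z)) z :=
    (Complex.conjCLE : ℂ →L[ℝ] ℂ).hasFDerivAt.comp z (hη.differentiable (by simp) z).hasFDerivAt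
  rw [pderiv, h.fderiv]
  rfl

theorem map_cutoff {F : Type*} [NormedAddCommGroup F] [NormedSpace ℂ F] {T : Jet →L[ℂ] F}
    (hT : ∀ p, T (valPart p) = 0) (hT' : ∀ p, T (derPart p) = T p) {η : Plane → ℂ}
    (hη : ContDiff ℝ ∞ η) (r : ℝ) (z : Plane) (p : Jet) :
    T (cutoffFamily (fun z => conj (η z)) 1 r z p) =
      ((r : ℂ) * conj (η z)) • T p + (conj (pderiv 0 η z) • T (valToDer 0 p) +
        conj (pderiv 1 η z) • T (valToDer 1 p)) := by
  simp only [cutoffFamily, jetMul, pderiv_conj hη, add_apply, smul_apply, map_add, map_smul, hT,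
    hT', Complex.ofReal_one, one_mul, smul_zero, zero_add]
  abel

/-- The test field `η(z) b(z/ε)` has gradient `ε⁻¹ η ∇b + ∇η ⊗ b`. The coefficients `1 - s = t ε²`
and `contrast = k ε²` lend one factor `ε` to the test field and one to `∇u`, so those parts pair
with the bounded jet `(u, ε∇u)`. Only the matrix-phase divergence keeps a factor `ε⁻¹`. -/
theorem inner_cutoff_flux {ε : ℝ} (hε : 0 < ε) {η : Plane → ℂ} (hη : ContDiff ℝ ∞ η)
    {y z : Plane} (hy : y ∈ F0 Q₀ ∨ y ∈ F1 Q₀) (p b : Jet) {t k : ℝ}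
    (ht : 1 - offDiag ε₁ ε = t * ε ^ 2) (hk : contrast ε₀ ε₁ ε = k * ε ^ 2) :
    inner ℂ (cutoffFamily (fun z => conj (η z)) 1 ε⁻¹ z b) (fluxFam Q₀ ε₀ ε₁ ε y p) =
      offDiag ε₁ ε * (((ε : ℂ)⁻¹ * (η z * inner ℂ (divOp b) ((chi1 Q₀ y • divOp) p))) +
        (pderiv 0 η z * inner ℂ ((divOp.comp (valToDer 0)) b) ((chi1 Q₀ y • divOp) p) +
        pderiv 1 η z * inner ℂ ((divOp.comp (valToDer 1)) b) ((chi1 Q₀ y • divOp) p))) +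
      (η z * inner ℂ ((t : ℂ) • chi1 Q₀ y • derPart b + (k : ℂ) • chi0 Q₀ y •
          incOp ε₀ ε₁ (offDiag ε₁ ε) b) ((valPart + (ε : ℂ) • derPart) p) +
        ε * (pderiv 0 η z * inner ℂ ((t : ℂ) • chi1 Q₀ y • derPart (valToDer 0 b) +
            (k : ℂ) • chi0 Q₀ y • incOp ε₀ ε₁ (offDiag ε₁ ε) (valToDer 0 b))
            ((valPart + (ε : ℂ) • derPart) p) +
          pderiv 1 η z * inner ℂ ((t : ℂ) • chi1 Q₀ y • derPart (valToDer 1 b) +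
            (k : ℂ) • chi0 Q₀ y • incOp ε₀ ε₁ (offDiag ε₁ ε) (valToDer 1 b))
            ((valPart + (ε : ℂ) • derPart) p))) := by
  have hεc : (ε : ℂ) ≠ 0 := by exact_mod_cast hε.ne'
  have ht' : (1 - offDiag ε₁ ε : ℂ) = t * ε ^ 2 := by exact_mod_cast ht
  have hk' : (contrast ε₀ ε₁ ε : ℂ) = k * ε ^ 2 := by exact_mod_cast hk
  have hdiv : ∀ q, divOp (valPart q) = 0 := fun q => by ext i; fin_cases i <;> simp
  have hdiv' : ∀ q, divOp (derPart q) = divOp q := fun q => by ext i; fin_cases i <;> simp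
  have hder : ∀ q, derPart (valPart q) = 0 := fun q => by ext ⟨i, o⟩; cases o <;> simp
  have hder' : ∀ q, derPart (derPart q) = derPart q := fun q => by ext ⟨i, o⟩; cases o <;> simp
  have hfst : ∀ q, derFst (valPart q) = 0 := fun q => by ext ⟨i, o⟩; cases o <;> simp
  have hfst' : ∀ q, derFst (derPart q) = derFst q := fun q => by ext ⟨i, o⟩; cases o <;> simp
  rw [inner_fluxFam, map_cutoff hdiv hdiv' hη, map_cutoff hder hder' hη,
    map_cutoff hfst hfst' hη]
  rcases hy with hy | hy
  · rw [chi0_of_mem hy, chi1_of_mem_F0 hy]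
    simp only [inner_add_left, inner_smul_left, inner_incOp, map_add, map_smul, add_apply,
      smul_apply, hdiv, hdiv', hder, hder', hfst, hfst', zero_add, one_smul, zero_mul,
      inner_smul_right, mul_zero, one_mul, map_mul, Complex.conj_conj,
      Complex.conj_ofReal, hk', ContinuousLinearMap.comp_apply, Complex.ofReal_inv, add_zero,
      map_inv₀, zero_smul, smul_zero, inner_zero_right]
    field_simp
    ring
  · rw [chi0_of_mem_F1 hy, chi1_of_mem hy]
    simp only [inner_add_left, inner_smul_left, map_add, map_smul, add_apply,
      smul_apply, inner_derPart_left (valPart p + (ε : ℂ) • derPart p), hder, hder', zero_add,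
      one_smul, zero_mul, inner_smul_right, one_mul, map_mul,
      Complex.conj_conj, Complex.conj_ofReal, ht', ContinuousLinearMap.comp_apply,
      Complex.ofReal_inv, add_zero,
      map_inv₀, zero_smul, smul_zero]
    field_simp

theorem inner_cutoff_weight {η : Plane → ℂ} {ε : ℝ} {y z : Plane}
    (hy : y ∈ F0 Q₀ ∨ y ∈ F1 Q₀) (p b : Jet) (r : ℝ) :
    inner ℂ (cutoffFamily (fun z => conj (η z)) 1 r z b) (weightFam Q₀ ε₀ ε₁ y p) =
      η z * inner ℂ (weightFam Q₀ ε₀ ε₁ y b) ((valPart + (ε : ℂ) • derPart) p) := by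
  rcases hy with hy | hy
  · simp only [weightFam, chi0_of_mem hy, chi1_of_mem_F0 hy, inner_jet, cutoffFamily]
    simp
    ring
  · simp only [weightFam, chi0_of_mem_F1 hy, chi1_of_mem hy, inner_jet, cutoffFamily]
    simp
    ring

theorem inner_cutoff_data {η : Plane → ℂ} {y z : Plane}
    (hy : y ∈ F0 Q₀ ∨ y ∈ F1 Q₀) (a : C2) (b : Jet) (r : ℝ) :
    inner ℂ (cutoffFamily (fun z => conj (η z)) 1 r z b) (dataFam Q₀ ε₀ ε₁ y a) =
      η z * inner ℂ (dataAdj Q₀ ε₀ ε₁ y b) a := by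
  rcases hy with hy | hy
  · simp only [dataFam, dataAdj, chi0_of_mem hy, chi1_of_mem_F0 hy, inner_jet, inner_C2,
      cutoffFamily]
    simp
    ring
  · simp only [dataFam, dataAdj, chi0_of_mem_F1 hy, chi1_of_mem hy, inner_jet, inner_C2,
      cutoffFamily]
    simp
    ring

end PointwiseIdentities

/-! ### The resolvent problem as an identity between oscillating integrals -/

section OscillatingTest

variable {N : Fin 2 → ℕ} {Q₀ : Set Plane} {ε₀ ε₁ ε : ℝ}

theorem integral_combination {X : Type*} [MeasurableSpace X] {μ : Measure X}
    {a₀ a₁ a₂ b₀ b₁ b₂ : X → ℂ} {r s t : ℂ} (h0 : Integrable a₀ μ) (h1 : Integrable a₁ μ)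
    (h2 : Integrable a₂ μ) (h3 : Integrable b₀ μ) (h4 : Integrable b₁ μ)
    (h5 : Integrable b₂ μ) :
    ∫ x, (r * (s * a₀ x + (a₁ x + a₂ x)) + (b₀ x + t * (b₁ x + b₂ x))) ∂μ =
      r * (s * ∫ x, a₀ x ∂μ + (∫ x, a₁ x ∂μ + ∫ x, a₂ x ∂μ)) +
        (∫ x, b₀ x ∂μ + t * (∫ x, b₁ x ∂μ + ∫ x, b₂ x ∂μ)) := by
  have h12 : Integrable (fun x => a₁ x + a₂ x) μ := h1.add h2
  have h45 : Integrable (fun x => t * (b₁ x + b₂ x)) μ := (h4.add h5).const_mul t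
  have h012 : Integrable (fun x => s * a₀ x + (a₁ x + a₂ x)) μ := (h0.const_mul s).add h12
  have h345 : Integrable (fun x => b₀ x + t * (b₁ x + b₂ x)) μ := h3.add h45
  rw [integral_add (h012.const_mul r) h345, integral_const_mul,
    integral_add (h0.const_mul s) h12, integral_const_mul, integral_add h1 h2,
    integral_add h3 h45, integral_const_mul, integral_add h4 h5]

theorem inner_flux_eq_osc (hN : ∀ i, 0 < N i) (hopen : IsOpen Q₀)
    (hbdry : volume (frontier Q₀) = 0) (hε : 0 < ε) {η : Plane → ℂ} (hη : ContDiff ℝ ∞ η)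
    (hc : HasCompactSupport η) (b : Lp Jet 2 (cellMeasure N))
    (u Θ : Lp Jet 2 (volume : Measure Plane)) (hΘ : Θ =ᵐ[volume] fun z =>
      cutoffFamily (fun z => conj (η z)) 1 ε⁻¹ z (b (wrap N (ε⁻¹ • z)))) {t k : ℝ}
    (ht : 1 - offDiag ε₁ ε = t * ε ^ 2) (hk : contrast ε₀ ε₁ ε = k * ε ^ 2) :
    inner ℂ Θ (mulOp _ (isBddFamily_flux (ε₀ := ε₀) (ε₁ := ε₁) hopen ε ε⁻¹) u) =
      offDiag ε₁ ε * ((ε : ℂ)⁻¹ * osc N ε η (mapCell N divOp b) (divPhase Q₀ ε u) +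
        (osc N ε (pderiv 0 η) (mapCell N (divOp.comp (valToDer 0)) b) (divPhase Q₀ ε u) +
          osc N ε (pderiv 1 η) (mapCell N (divOp.comp (valToDer 1)) b) (divPhase Q₀ ε u))) +
      (osc N ε η (fluxCell N hopen ε₀ ε₁ t k (offDiag ε₁ ε) b) (scaleJet ε u) +
        ε * (osc N ε (pderiv 0 η) (fluxCell N hopen ε₀ ε₁ t k (offDiag ε₁ ε)
            (mapCell N (valToDer 0) b)) (scaleJet ε u) +
          osc N ε (pderiv 1 η) (fluxCell N hopen ε₀ ε₁ t k (offDiag ε₁ ε)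
            (mapCell N (valToDer 1) b)) (scaleJet ε u))) := by
  have hQ := quasiMeasurePreserving_wrap hN hε
  have i0 := integrable_wrap_inner hN hε hη.continuous hc (mapCell N divOp b) (divPhase Q₀ ε u)
  have i1 := fun j => integrable_wrap_inner hN hε (contDiff_pderiv hη j).continuous
    (hasCompactSupport_pderiv hc j) (mapCell N (divOp.comp (valToDer j)) b) (divPhase Q₀ ε u)
  have i2 := integrable_wrap_inner hN hε hη.continuous hc
    (fluxCell N hopen ε₀ ε₁ t k (offDiag ε₁ ε) b) (scaleJet ε u)
  have i3 := fun j => integrable_wrap_inner hN hε (contDiff_pderiv hη j).continuous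
    (hasCompactSupport_pderiv hc j) (fluxCell N hopen ε₀ ε₁ t k (offDiag ε₁ ε)
      (mapCell N (valToDer j) b)) (scaleJet ε u)
  unfold osc
  rw [← integral_combination i0 (i1 0) (i1 1) i2 (i3 0) (i3 1), L2.inner_def]
  refine integral_congr_ae ?_
  filter_upwards [hΘ, coeFn_mulOp (isBddFamily_flux (ε₀ := ε₀) (ε₁ := ε₁) hopen ε ε⁻¹) u,
    coeFn_divPhase (Q₀ := Q₀) ε u, coeFn_scaleJet ε u, ae_smul_mem_F0_or_F1 hopen hbdry hε,
    hQ.ae (coeFn_mapCell divOp b), hQ.ae (coeFn_mapCell (divOp.comp (valToDer 0)) b),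
    hQ.ae (coeFn_mapCell (divOp.comp (valToDer 1)) b),
    hQ.ae (coeFn_fluxCell (ε₀ := ε₀) (ε₁ := ε₁) hopen t k (offDiag ε₁ ε) b),
    hQ.ae (coeFn_fluxCell (ε₀ := ε₀) (ε₁ := ε₁) hopen t k (offDiag ε₁ ε)
      (mapCell N (valToDer 0) b)),
    hQ.ae (coeFn_fluxCell (ε₀ := ε₀) (ε₁ := ε₁) hopen t k (offDiag ε₁ ε)
      (mapCell N (valToDer 1) b)), hQ.ae (coeFn_mapCell (valToDer 0) b),
    hQ.ae (coeFn_mapCell (valToDer 1) b)]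
    with z h1 h2 h3 h4 h5 h6 h7 h8 h9 h10 h11 h12 h13
  simp only [h1, h2, h3, h4, h6, h7, h8, h9, h10, h11, h12, h13, chi0_wrap, chi1_wrap]
  exact inner_cutoff_flux hε hη h5 _ _ ht hk

theorem inner_weight_eq_osc (hN : ∀ i, 0 < N i) (hopen : IsOpen Q₀)
    (hbdry : volume (frontier Q₀) = 0) (hε : 0 < ε) {η : Plane → ℂ}
    (b : Lp Jet 2 (cellMeasure N)) (r : ℝ)
    (u Θ : Lp Jet 2 (volume : Measure Plane)) (hΘ : Θ =ᵐ[volume] fun z =>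
      cutoffFamily (fun z => conj (η z)) 1 r z (b (wrap N (ε⁻¹ • z)))) :
    inner ℂ Θ (mulOp _ (isBddFamily_weight (ε₀ := ε₀) (ε₁ := ε₁) hopen ε⁻¹) u) =
      osc N ε η (mulOp _ (isBddFamily_weight_cell (ε₀ := ε₀) (ε₁ := ε₁) hopen) b)
        (scaleJet ε u) := by
  have hQ := quasiMeasurePreserving_wrap hN hε
  rw [L2.inner_def, osc]
  refine integral_congr_ae ?_
  filter_upwards [hΘ, coeFn_mulOp (isBddFamily_weight (ε₀ := ε₀) (ε₁ := ε₁) hopen ε⁻¹) u,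
    coeFn_scaleJet ε u, ae_smul_mem_F0_or_F1 hopen hbdry hε,
    hQ.ae (coeFn_mulOp (isBddFamily_weight_cell (ε₀ := ε₀) (ε₁ := ε₁) hopen) b)]
    with z h1 h2 h3 h4 h5
  rw [h1, h2, h3, h5]
  have h6 : weightFam Q₀ ε₀ ε₁ (wrap N (ε⁻¹ • z)) = weightFam Q₀ ε₀ ε₁ (ε⁻¹ • z) := by
    simp only [weightFam, chi0_wrap, chi1_wrap]
  rw [h6]
  exact inner_cutoff_weight h4 _ _ _

theorem inner_data_eq_osc (hN : ∀ i, 0 < N i) (hopen : IsOpen Q₀)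
    (hbdry : volume (frontier Q₀) = 0) (hε : 0 < ε) {η : Plane → ℂ}
    (b : Lp Jet 2 (cellMeasure N)) (r : ℝ) (f : Lp C2 2 (volume : Measure Plane))
    (Θ : Lp Jet 2 (volume : Measure Plane)) (hΘ : Θ =ᵐ[volume] fun z =>
      cutoffFamily (fun z => conj (η z)) 1 r z (b (wrap N (ε⁻¹ • z)))) :
    inner ℂ Θ (mulOp _ (isBddFamily_data (ε₀ := ε₀) (ε₁ := ε₁) hopen ε⁻¹) f) =
      osc N ε η (mulOp _ (isBddFamily_dataAdj (ε₀ := ε₀) (ε₁ := ε₁) hopen) b) f := by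
  have hQ := quasiMeasurePreserving_wrap hN hε
  rw [L2.inner_def, osc]
  refine integral_congr_ae ?_
  filter_upwards [hΘ, coeFn_mulOp (isBddFamily_data (ε₀ := ε₀) (ε₁ := ε₁) hopen ε⁻¹) f,
    ae_smul_mem_F0_or_F1 hopen hbdry hε,
    hQ.ae (coeFn_mulOp (isBddFamily_dataAdj (ε₀ := ε₀) (ε₁ := ε₁) hopen) b)]
    with z h1 h2 h4 h5
  rw [h1, h2, h5]
  have h6 : dataAdj Q₀ ε₀ ε₁ (wrap N (ε⁻¹ • z)) = dataAdj Q₀ ε₀ ε₁ (ε⁻¹ • z) := by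
    simp only [dataAdj, chi0_wrap, chi1_wrap]
  rw [h6]
  exact inner_cutoff_data h4 _ _ _

/-- The resolvent problem tested with `η(x) b(x/ε)`. -/
theorem IsResolventSolution.osc_eq (hN : ∀ i, 0 < N i) (hopen : IsOpen Q₀)
    (hbdry : volume (frontier Q₀) = 0) (hε : 0 < ε) {f : Lp C2 2 (volume : Measure Plane)}
    {u : H1Plane} (h : IsResolventSolution Q₀ ε₀ ε₁ ε f u) {η : Plane → ℂ}
    (hη : ContDiff ℝ ∞ η) (hc : HasCompactSupport η) {b : Lp Jet 2 (cellMeasure N)}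
    (hb : b ∈ H1Per N) {t k : ℝ}
    (ht : 1 - offDiag ε₁ ε = t * ε ^ 2) (hk : contrast ε₀ ε₁ ε = k * ε ^ 2) :
    offDiag ε₁ ε * ((ε : ℂ)⁻¹ * osc N ε η (mapCell N divOp b) (divPhase Q₀ ε u.1) +
        (osc N ε (pderiv 0 η) (mapCell N (divOp.comp (valToDer 0)) b) (divPhase Q₀ ε u.1) +
          osc N ε (pderiv 1 η) (mapCell N (divOp.comp (valToDer 1)) b) (divPhase Q₀ ε u.1))) +
      (osc N ε η (fluxCell N hopen ε₀ ε₁ t k (offDiag ε₁ ε) b) (scaleJet ε u.1) +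
        ε * (osc N ε (pderiv 0 η) (fluxCell N hopen ε₀ ε₁ t k (offDiag ε₁ ε)
            (mapCell N (valToDer 0) b)) (scaleJet ε u.1) +
          osc N ε (pderiv 1 η) (fluxCell N hopen ε₀ ε₁ t k (offDiag ε₁ ε)
            (mapCell N (valToDer 1) b)) (scaleJet ε u.1))) +
      osc N ε η (mulOp _ (isBddFamily_weight_cell (ε₀ := ε₀) (ε₁ := ε₁) hopen) b)
        (scaleJet ε u.1) =
      osc N ε η (mulOp _ (isBddFamily_dataAdj (ε₀ := ε₀) (ε₁ := ε₁) hopen) b) f := by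
  -- The cutoff is conjugated because the test function sits in the conjugate-linear slot; `η` then
  -- appears linearly.
  obtain ⟨Θ, hΘ, hΘe⟩ := exists_cutoff_mem_H1Plane hN hε
    ((Complex.conjCLE : ℂ →L[ℝ] ℂ).contDiff.comp hη)
    (hc.comp_left (g := fun w : ℂ => conj w) (map_zero _)) hb
  have h1 := h.inner_eq hopen hΘ
  rw [inner_flux_eq_osc hN hopen hbdry hε hη hc b _ Θ hΘe ht hk,
    inner_weight_eq_osc hN hopen hbdry hε b _ _ Θ hΘe,
    inner_data_eq_osc hN hopen hbdry hε b _ f Θ hΘe] at h1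
  exact h1

end OscillatingTest

/-! ### Properties of the two-scale limits -/

section Limits

variable {N : Fin 2 → ℕ} {Q₀ : Set Plane} {ε₀ ε₁ : ℝ}

/-- Expands the orthogonality relation for cutoffs. Localizing by `η` costs only a term with the
factor `ε`, since the derivative in `y` of the slow cutoff is `ε∇η`. -/
theorem osc_add_cutoff (hN : ∀ i, 0 < N i) {ε : ℝ} (hε : 0 < ε) {η : Plane → ℂ}
    (hη : ContDiff ℝ ∞ η) (hc : HasCompactSupport η) {g : Lp Jet 2 (cellMeasure N)}
    (hg : g ∈ (H1Per N)ᗮ) (u : H1Plane) :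
    osc N ε η g (scaleJet ε u.1) +
      ε * (osc N ε (pderiv 0 η) (mapCell N (ContinuousLinearMap.adjoint (valToDer 0)) g)
          (scaleJet ε u.1) +
        osc N ε (pderiv 1 η) (mapCell N (ContinuousLinearMap.adjoint (valToDer 1)) g)
          (scaleJet ε u.1)) = 0 := by
  have hQ := quasiMeasurePreserving_wrap hN hε
  have i2 := integrable_wrap_inner hN hε hη.continuous hc g (scaleJet ε u.1)
  have i3 := fun j => integrable_wrap_inner hN hε (contDiff_pderiv hη j).continuous
    (hasCompactSupport_pderiv hc j)
    (mapCell N (ContinuousLinearMap.adjoint (valToDer j)) g) (scaleJet ε u.1)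
  -- With `r = s = 0` the first three slots do not matter and are filled with any integrable
  -- function.
  have h0 := integral_combination (r := 0) (s := 0) (t := (ε : ℂ)) i2 i2 i2 i2 (i3 0) (i3 1)
  simp only [zero_mul, zero_add] at h0
  unfold osc
  rw [← h0, ← integral_inner_cutoff_eq_zero hN hε hη hc
    (fun b hb => Submodule.inner_left_of_mem_orthogonal hb hg) u.2]
  refine integral_congr_ae ?_
  filter_upwards [coeFn_scaleJet ε u.1,
    hQ.ae (coeFn_mapCell (ContinuousLinearMap.adjoint (valToDer 0)) g),
    hQ.ae (coeFn_mapCell (ContinuousLinearMap.adjoint (valToDer 1)) g)] with z h1 h2 h3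
  rw [h1, h2, h3, ContinuousLinearMap.adjoint_inner_left, ContinuousLinearMap.adjoint_inner_left]
  have h4 : cutoffFamily η ε ε z (u.1 z) = η z • (valPart + (ε : ℂ) • derPart) (u.1 z) +
      (ε : ℂ) • (pderiv 0 η z • valToDer 0 ((valPart + (ε : ℂ) • derPart) (u.1 z)) +
        pderiv 1 η z • valToDer 1 ((valPart + (ε : ℂ) • derPart) (u.1 z))) := by
    ext ⟨i, o⟩
    cases o
    · simp [cutoffFamily]
    · simp [cutoffFamily, jetMul]
      ring_nf
  rw [h4]
  simp only [inner_add_right, inner_smul_right]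

theorem integral_eq_zero_of_tendsto (hN : ∀ i, 0 < N i) {I : ℂ} {a : ℕ → ℂ}
    (h : Tendsto a atTop (𝓝 ((area N : ℂ)⁻¹ * I))) (h0 : Tendsto a atTop (𝓝 0)) : I = 0 := by
  have h1 := tendsto_nhds_unique h h0
  have h2 : (area N : ℂ) ≠ 0 := by exact_mod_cast (area_pos hN).ne'
  simpa [h2] using h1

/-- Membership in the closed space `H1Per N` is orthogonality to its orthogonal complement, and the
latter passes to the limit by `osc_add_cutoff`. -/
theorem ae_mem_H1Per (hN : ∀ i, 0 < N i) {δ : ℕ → ℝ} (hδ : ∀ n, 0 < δ n)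
    (hδ0 : Tendsto δ atTop (𝓝 0)) {u : ℕ → H1Plane}
    {W : Lp (Lp Jet 2 (cellMeasure N)) 2 (volume : Measure Plane)}
    (h : TS N δ (fun n => scaleJet (δ n) (u n).1) W) : ∀ᵐ x, W x ∈ H1Per N := by
  have h1 : ∀ᵐ x, ∀ g : (H1Per N)ᗮ, inner ℂ (g : Lp Jet 2 (cellMeasure N)) (W x) = 0 := by
    refine ae_forall_inner_eq_zero continuous_subtype_val fun g η hη hc => ?_
    refine integral_eq_zero_of_tendsto hN (h η hη.continuous hc g) ?_
    have hδc : Tendsto (fun n => (δ n : ℂ)) atTop (𝓝 0) :=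
      (Complex.continuous_ofReal.tendsto' 0 0 (by simp)).comp hδ0
    have h3 := fun j => h _ (contDiff_pderiv hη j).continuous (hasCompactSupport_pderiv hc j)
      (mapCell N (ContinuousLinearMap.adjoint (valToDer j)) g)
    have h2 := (hδc.mul ((h3 0).add (h3 1))).neg
    rw [zero_mul, neg_zero] at h2
    exact h2.congr fun n =>
      (eq_neg_of_add_eq_zero_left (osc_add_cutoff hN (hδ n) hη hc g.2 (u n))).symm
  filter_upwards [h1] with x hx
  have h3 : W x ∈ (H1Per N)ᗮᗮ := (Submodule.mem_orthogonal _ _).2 fun g hg => hx ⟨g, hg⟩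
  rw [Submodule.orthogonal_orthogonal_eq_closure] at h3
  have h4 : IsClosed (H1Per N : Set (Lp Jet 2 (cellMeasure N))) :=
    Submodule.isClosed_topologicalClosure _
  rwa [h4.submodule_topologicalClosure_eq] at h3

theorem inner_chi1_smul {E F : Type*} [NormedAddCommGroup E] [InnerProductSpace ℂ E]
    [NormedAddCommGroup F] [InnerProductSpace ℂ F] [CompleteSpace E] [CompleteSpace F]
    (T : E →L[ℂ] F) (y : Plane) (p : E) (q : F) :
    inner ℂ q ((chi1 Q₀ y • T) p) =
      inner ℂ ((chi1 Q₀ y • ContinuousLinearMap.adjoint T) q) p := by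
  rw [smul_apply, smul_apply, inner_smul_left, inner_smul_right,
    ContinuousLinearMap.adjoint_inner_left]
  congr 1
  by_cases hy : y ∈ F1 Q₀
  · simp [chi1_of_mem hy]
  · simp [chi1, hy]

theorem inner_chi0_smul {E F : Type*} [NormedAddCommGroup E] [InnerProductSpace ℂ E]
    [NormedAddCommGroup F] [InnerProductSpace ℂ F] [CompleteSpace E] [CompleteSpace F]
    (T : E →L[ℂ] F) (y : Plane) (p : E) (q : F) :
    inner ℂ q ((chi0 Q₀ y • T) p) =
      inner ℂ ((chi0 Q₀ y • ContinuousLinearMap.adjoint T) q) p := by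
  rw [smul_apply, smul_apply, inner_smul_left, inner_smul_right,
    ContinuousLinearMap.adjoint_inner_left]
  congr 1
  by_cases hy : y ∈ F0 Q₀
  · simp [chi0_of_mem hy]
  · simp [chi0, hy]

/-- The divergences of the scaled jet `(u, ε∇u)` in the matrix equal `ε` times `divPhase`, whose
oscillating integrals converge; the limit is therefore zero. -/
theorem ae_chi1_div_eq_zero (hN : ∀ i, 0 < N i) {δ : ℕ → ℝ} (hδ : ∀ n, 0 < δ n)
    (hδ0 : Tendsto δ atTop (𝓝 0)) {u : ℕ → H1Plane}
    {W : Lp (Lp Jet 2 (cellMeasure N)) 2 (volume : Measure Plane)}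
    (h : TS N δ (fun n => scaleJet (δ n) (u n).1) W)
    {P : Lp (Lp C2 2 (cellMeasure N)) 2 (volume : Measure Plane)}
    (hP : TS N δ (fun n => divPhase Q₀ (δ n) (u n).1) P) :
    ∀ᵐ x, mulOp _ (isBddFamily_chi1 Q₀ divOp) (W x) = 0 := by
  have hQ := fun n => quasiMeasurePreserving_wrap hN (hδ n)
  have h1 : ∀ᵐ x, ∀ g : Lp C2 2 (cellMeasure N), inner ℂ (mulOp _ (isBddFamily_chi1 Q₀
      (ContinuousLinearMap.adjoint divOp)) g) (W x) = 0 := by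
    refine ae_forall_inner_eq_zero (ContinuousLinearMap.continuous _) fun g η hη hc => ?_
    refine integral_eq_zero_of_tendsto hN (h η hη.continuous hc _) ?_
    have hδc : Tendsto (fun n => (δ n : ℂ)) atTop (𝓝 0) :=
      (Complex.continuous_ofReal.tendsto' 0 0 (by simp)).comp hδ0
    have h2 := hδc.mul (hP η hη.continuous hc g)
    rw [zero_mul] at h2
    refine h2.congr fun n => ?_
    rw [← integral_const_mul]
    refine integral_congr_ae ?_
    filter_upwards [coeFn_scaleJet (δ n) (u n).1, coeFn_divPhase (Q₀ := Q₀) (δ n) (u n).1,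
      (hQ n).ae (coeFn_mulOp (isBddFamily_chi1 Q₀ (ContinuousLinearMap.adjoint divOp)) g)]
      with z h3 h4 h5
    rw [h3, h4, h5, ← inner_chi1_smul, chi1_wrap]
    have h6 : divOp ((valPart + (δ n : ℂ) • derPart) ((u n).1 z)) =
        (δ n : ℂ) • divOp ((u n).1 z) := by
      ext i
      fin_cases i <;> simp
    rw [smul_apply, smul_apply, h6, smul_comm, inner_smul_right (𝕜 := ℂ) (r := (δ n : ℂ))]
    ring
  filter_upwards [h1] with x hx
  refine ext_inner_left ℂ fun g => ?_
  rw [inner_mulOp_of_adjoint _ (isBddFamily_chi1 Q₀ (ContinuousLinearMap.adjoint divOp))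
    (fun y p q => inner_chi1_smul _ y p q), hx, inner_zero_right]

theorem mem_V_of_div {v : Lp Jet 2 (cellMeasure N)} (hv : v ∈ H1Per N)
    (h : mulOp _ (isBddFamily_chi1 Q₀ divOp) v = 0) : v ∈ V N Q₀ := by
  refine ⟨hv, ?_⟩
  have h1 := coeFn_mulOp (isBddFamily_chi1 (N := N) Q₀ divOp) v
  rw [h] at h1
  filter_upwards [h1, Lp.coeFn_zero C2 2 (cellMeasure N)] with y h2 h3 hy
  rw [h3, chi1_of_mem hy, one_smul] at h2
  exact ⟨by simpa [Jet.div, Jet.der] using (congrArg (fun p : C2 => p 0) h2).symm,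
    by simpa [Jet.divPerp, Jet.der] using (congrArg (fun p : C2 => p 1) h2).symm⟩

theorem ae_divOp_eq_zero {v : Lp Jet 2 (cellMeasure N)} (hv : v ∈ V N Q₀) :
    ∀ᵐ y ∂(cellMeasure N), y ∈ F1 Q₀ → divOp (v y) = 0 := by
  filter_upwards [hv.2] with y hy hyF
  have h := hy hyF
  ext i
  fin_cases i
  · simpa [Jet.div, Jet.der] using h.1
  · simpa [Jet.divPerp, Jet.der] using h.2

theorem tendsto_offDiag {δ : ℕ → ℝ} (hδ0 : Tendsto δ atTop (𝓝 0)) :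
    Tendsto (fun n => offDiag ε₁ (δ n)) atTop (𝓝 1) := by
  have h : Continuous (offDiag ε₁) := by unfold offDiag; fun_prop
  exact (h.tendsto' 0 1 (by simp [offDiag])).comp hδ0

/-- Rationalization: `(1 - s)(1 + s) = ε²/ε₁`. The rescaled coefficient tends to `1/(2ε₁)` as `s →
1`. -/
theorem one_sub_offDiag_eq (hε₁ : 0 < ε₁) {ε : ℝ} (h : ε ^ 2 ≤ ε₁) :
    1 - offDiag ε₁ ε = (ε₁ * (1 + offDiag ε₁ ε))⁻¹ * ε ^ 2 := by
  have h0 : 0 ≤ offDiag ε₁ ε := Real.sqrt_nonneg _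
  have h1 : offDiag ε₁ ε ^ 2 = 1 - ε ^ 2 / ε₁ :=
    Real.sq_sqrt (sub_nonneg.2 ((div_le_one hε₁).2 h))
  have h2 : 1 + offDiag ε₁ ε ≠ 0 := by positivity
  field_simp at h1 ⊢
  linear_combination -h1

theorem contrast_eq (ε : ℝ) : contrast ε₀ ε₁ ε = (ε₀ - ε₁ + ε ^ 2)⁻¹ * ε ^ 2 := by
  rw [contrast, div_eq_inv_mul]

theorem tendsto_fluxCell (hopen : IsOpen Q₀) {t k s : ℕ → ℝ} {t₀ k₀ s₀ : ℝ}
    (ht : Tendsto t atTop (𝓝 t₀)) (hk : Tendsto k atTop (𝓝 k₀)) (hs : Tendsto s atTop (𝓝 s₀))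
    (b : Lp Jet 2 (cellMeasure N)) :
    Tendsto (fun n => fluxCell N hopen ε₀ ε₁ (t n) (k n) (s n) b) atTop
      (𝓝 (fluxCell N hopen ε₀ ε₁ t₀ k₀ s₀ b)) := by
  have hc := fun {r : ℕ → ℝ} {r₀ : ℝ} (h : Tendsto r atTop (𝓝 r₀)) =>
    (Complex.continuous_ofReal.tendsto r₀).comp h
  exact ((hc ht).smul tendsto_const_nhds).add
    ((hc hk).smul (tendsto_const_nhds.add ((hc hs).smul tendsto_const_nhds)))

end Limits

/-! ### The limit of the resolvent problem -/

section LimitProblem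

variable {N : Fin 2 → ℕ} {Q₀ : Set Plane} {ε₀ ε₁ : ℝ}

/-- The two factors live on complementary phases: `divOp b` vanishes in `F_1` and `divPhase`
vanishes in `F_0`. Fields of `V N Q₀` thus never see the `ε⁻¹` term. -/
theorem osc_mapCell_divOp_eq_zero (hN : ∀ i, 0 < N i) (hopen : IsOpen Q₀)
    (hbdry : volume (frontier Q₀) = 0) {ε : ℝ} (hε : 0 < ε) (η : Plane → ℂ)
    {b : Lp Jet 2 (cellMeasure N)} (hb : b ∈ V N Q₀) (u : Lp Jet 2 (volume : Measure Plane)) :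
    osc N ε η (mapCell N divOp b) (divPhase Q₀ ε u) = 0 := by
  have hQ := quasiMeasurePreserving_wrap hN hε
  refine integral_eq_zero_of_ae ?_
  filter_upwards [coeFn_divPhase (Q₀ := Q₀) ε u, hQ.ae (coeFn_mapCell divOp b),
    hQ.ae (ae_divOp_eq_zero hb), ae_smul_mem_F0_or_F1 hopen hbdry hε] with z h1 h2 h3 h4
  rw [h1, h2]
  rcases h4 with h4 | h4
  · simp [chi1_of_mem_F0 h4]
  · rw [h3 ((wrap_mem_perExt _ _).2 h4)]
    simp

theorem osc_chi0_eq_zero (hN : ∀ i, 0 < N i) (hopen : IsOpen Q₀)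
    (hbdry : volume (frontier Q₀) = 0) {ε : ℝ} (hε : 0 < ε) (η : Plane → ℂ)
    (T : C2 →L[ℂ] C2) (g : Lp C2 2 (cellMeasure N)) (u : Lp Jet 2 (volume : Measure Plane)) :
    osc N ε η (mulOp _ (isBddFamily_chi0 hopen T) g) (divPhase Q₀ ε u) = 0 := by
  have hQ := quasiMeasurePreserving_wrap hN hε
  refine integral_eq_zero_of_ae ?_
  filter_upwards [coeFn_divPhase (Q₀ := Q₀) ε u,
    hQ.ae (coeFn_mulOp (isBddFamily_chi0 hopen T) g),
    ae_smul_mem_F0_or_F1 hopen hbdry hε] with z h1 h2 h4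
  rw [h1, h2, chi0_wrap]
  rcases h4 with h4 | h4
  · simp [chi1_of_mem_F0 h4]
  · simp [chi0_of_mem_F1 h4]

/-- The divergences of the solutions in the matrix phase have the two-scale limit zero. -/
theorem ae_divPhase_limit_eq_zero (hN : ∀ i, 0 < N i) (hopen : IsOpen Q₀) (hne : Q₀.Nonempty)
    (hsub : closure Q₀ ⊆ cell 1) (hbdry : volume (frontier Q₀) = 0) (hε₁ : 0 < ε₁)
    (hε₀ : ε₁ < ε₀) {δ : ℕ → ℝ} (hδ : ∀ n, 0 < δ n) (hδ0 : Tendsto δ atTop (𝓝 0))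
    (hδ1 : ∀ n, δ n ^ 2 ≤ ε₁) {f : ℕ → Lp C2 2 (volume : Measure Plane)} {u : ℕ → H1Plane}
    (hu : ∀ n, IsResolventSolution Q₀ ε₀ ε₁ (δ n) (f n) (u n)) {C : ℝ}
    (hUC : ∀ n, ‖scaleJet (δ n) (u n).1‖ ≤ C)
    {W : Lp (Lp Jet 2 (cellMeasure N)) 2 (volume : Measure Plane)}
    (hW : TS N δ (fun n => scaleJet (δ n) (u n).1) W)
    {P F : Lp (Lp C2 2 (cellMeasure N)) 2 (volume : Measure Plane)}
    (hP : TS N δ (fun n => divPhase Q₀ (δ n) (u n).1) P) (hF : TS N δ f F) :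
    ∀ᵐ x, P x = 0 := by
  have hc {r : ℕ → ℝ} {r₀ : ℝ} (h : Tendsto r atTop (𝓝 r₀)) :
    Tendsto (fun n => (r n : ℂ)) atTop (𝓝 (r₀ : ℂ)) :=
    (Complex.continuous_ofReal.tendsto r₀).comp h
  have hs := tendsto_offDiag (ε₁ := ε₁) hδ0
  have ht : Tendsto (fun n => (ε₁ * (1 + offDiag ε₁ (δ n)))⁻¹) atTop (𝓝 (ε₁ * (1 + 1))⁻¹) :=
    (tendsto_const_nhds.mul (tendsto_const_nhds.add hs)).inv₀ (by positivity)
  have hk : Tendsto (fun n => (ε₀ - ε₁ + δ n ^ 2)⁻¹) atTop (𝓝 (ε₀ - ε₁ + 0 ^ 2)⁻¹) :=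
    (tendsto_const_nhds.add (hδ0.pow 2)).inv₀ (by simpa using (sub_pos.2 hε₀).ne')
  have h1 : ∀ᵐ x, ∀ b : H1Per N,
      inner ℂ (mapCell N divOp (b : Lp Jet 2 (cellMeasure N))) (P x) = 0 := by
    refine ae_forall_inner_eq_zero ((mapCell N divOp).continuous.comp continuous_subtype_val)
      fun b η hη hηc => ?_
    have hη' := fun j => (contDiff_pderiv hη j).continuous
    have hηc' := fun j => hasCompactSupport_pderiv hηc j
    have e0 := hP η hη.continuous hηc (mapCell N divOp b)
    have e1 := fun j => hP _ (hη' j) (hηc' j) (mapCell N (divOp.comp (valToDer j)) b)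
    have e2 := hW.tendsto_osc hN hδ hδ0 hUC hη.continuous hηc
      (tendsto_fluxCell (ε₀ := ε₀) (ε₁ := ε₁) hopen ht hk hs b.1)
    have e3 := fun j => hW.tendsto_osc hN hδ hδ0 hUC (hη' j) (hηc' j)
      (tendsto_fluxCell (ε₀ := ε₀) (ε₁ := ε₁) hopen ht hk hs (mapCell N (valToDer j) b.1))
    have e4 := hW η hη.continuous hηc
      (mulOp _ (isBddFamily_weight_cell (ε₀ := ε₀) (ε₁ := ε₁) hopen) b)
    have e5 := hF η hη.continuous hηc
      (mulOp _ (isBddFamily_dataAdj (ε₀ := ε₀) (ε₁ := ε₁) hopen) b)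
    have hd := hc hδ0
    -- The tested identity is multiplied by `ε`. Every term except the singular one then tends to
    -- zero, and dividing by `s → 1` isolates the singular one.
    have l1 := hd.mul (e5.sub ((e2.add (hd.mul ((e3 0).add (e3 1)))).add e4))
    have l2 := (hc hs).mul (hd.mul ((e1 0).add (e1 1)))
    have l3 := (l1.sub l2).mul ((hc hs).inv₀ (by simp))
    simp only [Complex.ofReal_zero, zero_mul, mul_zero, sub_zero] at l3
    refine integral_eq_zero_of_tendsto hN e0 (l3.congr' ?_)
    have hs0 : ∀ᶠ n in atTop, offDiag ε₁ (δ n) ≠ 0 :=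
      hs.eventually_ne one_ne_zero
    filter_upwards [hs0] with n hn
    have hsc : (offDiag ε₁ (δ n) : ℂ) ≠ 0 := by exact_mod_cast hn
    have hdc : (δ n : ℂ) ≠ 0 := by exact_mod_cast (hδ n).ne'
    have hm := (hu n).osc_eq hN hopen hbdry (hδ n) hη hηc b.2
      (one_sub_offDiag_eq hε₁ (hδ1 n)) (contrast_eq (δ n))
    simp only [osc] at hm ⊢
    rw [← hm]
    field_simp
    ring
  -- The limit inherits from `divPhase` that it vanishes in the inclusions.
  have h2 : ∀ᵐ x, ∀ g : Lp C2 2 (cellMeasure N), inner ℂ (mulOp _ (isBddFamily_chi0 hopen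
      (ContinuousLinearMap.adjoint (ContinuousLinearMap.id ℂ C2))) g) (P x) = 0 := by
    refine ae_forall_inner_eq_zero (ContinuousLinearMap.continuous _) fun g η hη hηc => ?_
    refine integral_eq_zero_of_tendsto hN (hP η hη.continuous hηc _) ?_
    exact tendsto_const_nhds.congr fun n =>
      (osc_chi0_eq_zero hN hopen hbdry (hδ n) η _ g _).symm
  filter_upwards [h1, h2] with x hx1 hx2
  refine eq_zero_of_orthogonal_divOp hN (cellMeasure_F0_ne_zero hN hopen hne hsub)
    (fun b hb => ?_) ?_
  · rw [← hx1 ⟨b, hb⟩, L2.inner_def]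
    refine integral_congr_ae ?_
    filter_upwards [coeFn_mapCell divOp b] with y hy
    rw [hy]
  · have h3 : mulOp _ (isBddFamily_chi0 (N := N) hopen (ContinuousLinearMap.id ℂ C2)) (P x) = 0 := by
      refine ext_inner_left ℂ fun g => ?_
      rw [inner_mulOp_of_adjoint _ (isBddFamily_chi0 hopen
        (ContinuousLinearMap.adjoint (ContinuousLinearMap.id ℂ C2)))
        (fun y p q => inner_chi0_smul _ y p q), hx2, inner_zero_right]
    have h4 := coeFn_mulOp (isBddFamily_chi0 (N := N) hopen (ContinuousLinearMap.id ℂ C2)) (P x)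
    rw [h3] at h4
    filter_upwards [h4, Lp.coeFn_zero C2 2 (cellMeasure N)] with y h5 h6 hy
    rw [h6, chi0_of_mem hy, one_smul] at h5
    exact h5.symm

/-- The two-scale limit of the solutions solves the limit problem in almost every cell. -/
theorem ae_limit_eq (hN : ∀ i, 0 < N i) (hopen : IsOpen Q₀) (hne : Q₀.Nonempty)
    (hsub : closure Q₀ ⊆ cell 1) (hbdry : volume (frontier Q₀) = 0) (hε₁ : 0 < ε₁)
    (hε₀ : ε₁ < ε₀) {δ : ℕ → ℝ} (hδ : ∀ n, 0 < δ n) (hδ0 : Tendsto δ atTop (𝓝 0))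
    (hδ1 : ∀ n, δ n ^ 2 ≤ ε₁) {f : ℕ → Lp C2 2 (volume : Measure Plane)} {u : ℕ → H1Plane}
    (hu : ∀ n, IsResolventSolution Q₀ ε₀ ε₁ (δ n) (f n) (u n)) {C : ℝ}
    (hUC : ∀ n, ‖scaleJet (δ n) (u n).1‖ ≤ C)
    {W : Lp (Lp Jet 2 (cellMeasure N)) 2 (volume : Measure Plane)}
    (hW : TS N δ (fun n => scaleJet (δ n) (u n).1) W)
    {P F : Lp (Lp C2 2 (cellMeasure N)) 2 (volume : Measure Plane)}
    (hP : TS N δ (fun n => divPhase Q₀ (δ n) (u n).1) P) (hF : TS N δ f F) :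
    ∀ᵐ x, ∀ b : V N Q₀,
      inner ℂ (fluxCell N hopen ε₀ ε₁ (ε₁ * (1 + 1))⁻¹ (ε₀ - ε₁)⁻¹ 1 b.1) (W x) +
        inner ℂ (mulOp _ (isBddFamily_weight_cell (ε₀ := ε₀) (ε₁ := ε₁) hopen) b.1) (W x) -
        inner ℂ (mulOp _ (isBddFamily_dataAdj (ε₀ := ε₀) (ε₁ := ε₁) hopen) b.1) (F x) = 0 := by
  have hP0 := ae_divPhase_limit_eq_zero hN hopen hne hsub hbdry hε₁ hε₀ hδ hδ0 hδ1 hu hUC hW hP hF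
  have hc {r : ℕ → ℝ} {r₀ : ℝ} (h : Tendsto r atTop (𝓝 r₀)) :
    Tendsto (fun n => (r n : ℂ)) atTop (𝓝 (r₀ : ℂ)) :=
    (Complex.continuous_ofReal.tendsto r₀).comp h
  have hs := tendsto_offDiag (ε₁ := ε₁) hδ0
  have ht : Tendsto (fun n => (ε₁ * (1 + offDiag ε₁ (δ n)))⁻¹) atTop (𝓝 (ε₁ * (1 + 1))⁻¹) :=
    (tendsto_const_nhds.mul (tendsto_const_nhds.add hs)).inv₀ (by positivity)
  have hk : Tendsto (fun n => (ε₀ - ε₁ + δ n ^ 2)⁻¹) atTop (𝓝 (ε₀ - ε₁)⁻¹) := by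
    have h0 := (tendsto_const_nhds (x := ε₀ - ε₁)).add (hδ0.pow 2)
    rw [zero_pow two_ne_zero, add_zero] at h0
    exact h0.inv₀ (sub_pos.2 hε₀).ne'
  have hcV : Continuous fun b : V N Q₀ => b.1 := continuous_subtype_val
  refine ae_forall_eq_zero (fun x => ?_) fun b => ?_
  · exact ((((ContinuousLinearMap.continuous _).comp hcV).inner continuous_const).add
      (((ContinuousLinearMap.continuous _).comp hcV).inner continuous_const)).sub
      (((ContinuousLinearMap.continuous _).comp hcV).inner continuous_const)
  · set G := fluxCell N hopen ε₀ ε₁ (ε₁ * (1 + 1))⁻¹ (ε₀ - ε₁)⁻¹ 1 b.1 with hG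
    set A := mulOp _ (isBddFamily_weight_cell (N := N) (ε₀ := ε₀) (ε₁ := ε₁) hopen) b.1 with hA
    set D := mulOp _ (isBddFamily_dataAdj (N := N) (ε₀ := ε₀) (ε₁ := ε₁) hopen) b.1 with hD
    refine ae_eq_zero_of_integral_smooth_mul
      (((memLp_inner_const G W).add (memLp_inner_const A W)).sub (memLp_inner_const D F))
      fun η hη hηc => ?_
    have hη' := fun j => (contDiff_pderiv hη j).continuous
    have hηc' := fun j => hasCompactSupport_pderiv hηc j
    have e1 := fun j => hP _ (hη' j) (hηc' j) (mapCell N (divOp.comp (valToDer j)) b)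
    -- Here the rigidity result enters: the products of `∇η` with the divergences do not carry a
    -- factor `ε` and disappear only because `P = 0`.
    have e1z : ∀ j, ∫ x, pderiv j η x * inner ℂ (mapCell N (divOp.comp (valToDer j)) b) (P x)
        = 0 := fun j => by
      refine integral_eq_zero_of_ae ?_
      filter_upwards [hP0] with x hx
      rw [hx, inner_zero_right, mul_zero, Pi.zero_apply]
    have e2 := hW.tendsto_osc hN hδ hδ0 hUC hη.continuous hηc
      (tendsto_fluxCell (ε₀ := ε₀) (ε₁ := ε₁) hopen ht hk hs b.1)
    have e3 := fun j => hW.tendsto_osc hN hδ hδ0 hUC (hη' j) (hηc' j)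
      (tendsto_fluxCell (ε₀ := ε₀) (ε₁ := ε₁) hopen ht hk hs (mapCell N (valToDer j) b.1))
    have e4 := hW η hη.continuous hηc A
    have e5 := hF η hη.continuous hηc D
    have l1 := ((hc hs).mul ((e1 0).add (e1 1))).add
      ((e2.add ((hc hδ0).mul ((e3 0).add (e3 1)))).add e4)
    rw [e1z, e1z] at l1
    simp only [Complex.ofReal_zero, zero_mul, mul_zero, add_zero, zero_add] at l1
    -- By the tested identity the sequence of differences is identically zero, while its limit is
    -- the localized cell equation.
    have l2 : Tendsto (fun _ : ℕ => (0 : ℂ)) atTop (𝓝 ((area N : ℂ)⁻¹ *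
        ∫ x, η x * (inner ℂ G (W x) + inner ℂ A (W x) - inner ℂ D (F x)))) := by
      have i1 := integrable_mul_inner hη.continuous hηc G W
      have i2 := integrable_mul_inner hη.continuous hηc A W
      have i3 := integrable_mul_inner hη.continuous hηc D F
      have h1 : ∫ x, η x * (inner ℂ G (W x) + inner ℂ A (W x) - inner ℂ D (F x)) =
          (∫ x, η x * inner ℂ G (W x)) + (∫ x, η x * inner ℂ A (W x)) -
            ∫ x, η x * inner ℂ D (F x) := by
        have i12 : Integrable (fun x => η x * inner ℂ G (W x) + η x * inner ℂ A (W x)) :=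
          i1.add i2
        rw [← integral_add i1 i2, ← integral_sub i12 i3]
        refine integral_congr_ae (Eventually.of_forall fun x => ?_)
        ring
      rw [h1, mul_sub, mul_add]
      refine (l1.sub e5).congr fun n => ?_
      have hm := (hu n).osc_eq hN hopen hbdry (hδ n) hη hηc b.2.1
        (one_sub_offDiag_eq hε₁ (hδ1 n)) (contrast_eq (δ n))
      rw [osc_mapCell_divOp_eq_zero hN hopen hbdry (hδ n) η b.2, mul_zero, zero_add] at hm
      simp only [osc] at hm ⊢
      rw [← hm]
      ring
    exact integral_eq_zero_of_tendsto hN l2 tendsto_const_nhds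

end LimitProblem

/-! ### The limit problem in a cell -/

section CellProblem

variable {N : Fin 2 → ℕ} {Q₀ : Set Plane} {ε₀ ε₁ : ℝ}

/-- When both divergences vanish, `∂₁v₁ = -∂₂v₂` and `∂₂v₁ = ∂₁v₂`, so the two components contribute
equally to the full gradient product. The factor `ε₁/(2ε₁) = 1/2` leaves the product of the first
gradients. -/
theorem limitForm_eq_of_mem_F1 (hε₁ : 0 < ε₁) {y : Plane} (hy : y ∈ F1 Q₀) {p q : Jet}
    (hp : divOp p = 0) (hq : divOp q = 0) (k s : ℝ) :
    limitForm ε₀ ε₁ p q = ε₁ * inner ℂ (((ε₁ * (1 + 1))⁻¹ : ℝ) • chi1 Q₀ y • derPart q +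
      (k : ℂ) • chi0 Q₀ y • incOp ε₀ ε₁ s q) p := by
  have p0 : p (0, some 0) = -p (1, some 1) := by
    have := congrArg (fun v : C2 => v 0) hp
    simp only [divOp_zero, PiLp.zero_apply] at this
    linear_combination this
  have p1 : p (0, some 1) = p (1, some 0) := by
    have := congrArg (fun v : C2 => v 1) hp
    simp only [divOp_one, PiLp.zero_apply] at this
    linear_combination this
  have q0 : q (0, some 0) = -q (1, some 1) := by
    have := congrArg (fun v : C2 => v 0) hq
    simp only [divOp_zero, PiLp.zero_apply] at this
    linear_combination this
  have q1 : q (0, some 1) = q (1, some 0) := by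
    have := congrArg (fun v : C2 => v 1) hq
    simp only [divOp_one, PiLp.zero_apply] at this
    linear_combination this
  have hc : (ε₁ : ℂ) ≠ 0 := by exact_mod_cast hε₁.ne'
  rw [chi1_of_mem hy, chi0_of_mem_F1 hy]
  simp only [limitForm, cdot, inner_jet, Jet.div, Jet.divPerp, Jet.der, Fin.sum_univ_two]
  simp [p0, p1, q0, q1]
  field_simp
  ring

/-- At `s = 1` the inclusion operator has the form `γ ∇v₁ · ∇w₁` plus the divergence products, and
`ε₁/(ε₀ - ε₁) = γ⁻¹`. -/
theorem limitForm_eq_of_mem_F0 (hε₁ : 0 < ε₁) (hε₀ : ε₁ < ε₀) {y : Plane} (hy : y ∈ F0 Q₀)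
    (p q : Jet) (t : ℝ) :
    limitForm ε₀ ε₁ p q = ε₁ * inner ℂ ((t : ℂ) • chi1 Q₀ y • derPart q +
      ((ε₀ - ε₁)⁻¹ : ℝ) • chi0 Q₀ y • incOp ε₀ ε₁ 1 q) p := by
  have hc : (ε₁ : ℂ) ≠ 0 := by exact_mod_cast hε₁.ne'
  have hc' : (ε₀ - ε₁ : ℂ) ≠ 0 := by exact_mod_cast (sub_pos.2 hε₀).ne'
  have hg : (gam ε₀ ε₁ : ℂ) = (ε₀ - ε₁) / ε₁ := by
    rw [gam]
    push_cast
    field_simp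
  rw [chi1_of_mem_F0 hy, chi0_of_mem hy]
  have h1 : (t : ℂ) • (0 : ℂ) • derPart q + ((ε₀ - ε₁)⁻¹ : ℝ) • (1 : ℂ) • incOp ε₀ ε₁ 1 q =
      (((ε₀ - ε₁)⁻¹ : ℝ) : ℂ) • incOp ε₀ ε₁ 1 q := by
    rw [zero_smul, smul_zero, zero_add, one_smul, Complex.coe_smul]
  rw [h1, inner_smul_left, inner_incOp]
  simp only [limitForm, cdot, inner_jet, inner_C2, Jet.div, Jet.divPerp, Jet.der,
    Fin.sum_univ_two]
  simp [hg]
  field_simp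

theorem ae_limitForm_eq (hopen : IsOpen Q₀) (hbdry : volume (frontier Q₀) = 0) (hε₁ : 0 < ε₁)
    (hε₀ : ε₁ < ε₀) {v b : Lp Jet 2 (cellMeasure N)} (hv : v ∈ V N Q₀) (hb : b ∈ V N Q₀) :
    ∀ᵐ y ∂(cellMeasure N), limitForm ε₀ ε₁ (v y) (b y) =
      ε₁ * inner ℂ (fluxCell N hopen ε₀ ε₁ (ε₁ * (1 + 1))⁻¹ (ε₀ - ε₁)⁻¹ 1 b y) (v y) := by
  filter_upwards [ae_divOp_eq_zero hv, ae_divOp_eq_zero hb,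
    coeFn_fluxCell (ε₀ := ε₀) (ε₁ := ε₁) hopen (ε₁ * (1 + 1))⁻¹ (ε₀ - ε₁)⁻¹ 1 b,
    ae_restrict_of_ae (ae_mem_F0_or_F1 hopen hbdry)] with y h1 h2 h3 h4
  rw [h3]
  rcases h4 with h4 | h4
  · exact limitForm_eq_of_mem_F0 hε₁ hε₀ h4 _ _ _
  · exact limitForm_eq_of_mem_F1 hε₁ h4 (h1 h4) (h2 h4) _ _

theorem ae_limitWeight_eq (hopen : IsOpen Q₀) (hbdry : volume (frontier Q₀) = 0)
    (v b : Lp Jet 2 (cellMeasure N)) :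
    ∀ᵐ y ∂(cellMeasure N), limitWeight Q₀ ε₀ ε₁ y (v y).val (b y).val =
      ε₁ * inner ℂ (mulOp _ (isBddFamily_weight_cell (ε₀ := ε₀) (ε₁ := ε₁) hopen) b y) (v y) := by
  filter_upwards [coeFn_mulOp (isBddFamily_weight_cell (ε₀ := ε₀) (ε₁ := ε₁) hopen) b,
    ae_restrict_of_ae (ae_mem_F0_or_F1 hopen hbdry)] with y h3 h4
  rw [h3]
  rcases h4 with h4 | h4
  · simp only [limitWeight, weightFam, cdot, inner_jet, chi0_of_mem h4, chi1_of_mem_F0 h4,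
      Jet.val]
    simp
    left
    ring
  · simp only [limitWeight, weightFam, cdot, inner_jet, chi0_of_mem_F1 h4, chi1_of_mem h4,
      Jet.val]
    simp

theorem ae_limitWeight_data_eq (hopen : IsOpen Q₀) (hbdry : volume (frontier Q₀) = 0)
    (a : Lp C2 2 (cellMeasure N)) (b : Lp Jet 2 (cellMeasure N)) :
    ∀ᵐ y ∂(cellMeasure N), limitWeight Q₀ ε₀ ε₁ y (a y) (b y).val =
      ε₁ * inner ℂ (mulOp _ (isBddFamily_dataAdj (ε₀ := ε₀) (ε₁ := ε₁) hopen) b y) (a y) := by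
  filter_upwards [coeFn_mulOp (isBddFamily_dataAdj (ε₀ := ε₀) (ε₁ := ε₁) hopen) b,
    ae_restrict_of_ae (ae_mem_F0_or_F1 hopen hbdry)] with y h3 h4
  rw [h3]
  rcases h4 with h4 | h4
  · simp only [limitWeight, dataAdj, cdot, inner_C2, chi0_of_mem h4, chi1_of_mem_F0 h4,
      Jet.val]
    simp
    left
    ring
  · simp only [limitWeight, dataAdj, cdot, inner_C2, chi0_of_mem_F1 h4, chi1_of_mem h4,
      Jet.val]
    simp

theorem integral_limitForm (hopen : IsOpen Q₀) (hbdry : volume (frontier Q₀) = 0)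
    (hε₁ : 0 < ε₁) (hε₀ : ε₁ < ε₀) {v b : Lp Jet 2 (cellMeasure N)} (hv : v ∈ V N Q₀)
    (hb : b ∈ V N Q₀) : ∫ y, limitForm ε₀ ε₁ (v y) (b y) ∂(cellMeasure N) =
      ε₁ * inner ℂ (fluxCell N hopen ε₀ ε₁ (ε₁ * (1 + 1))⁻¹ (ε₀ - ε₁)⁻¹ 1 b) v := by
  rw [integral_congr_ae (ae_limitForm_eq hopen hbdry hε₁ hε₀ hv hb), integral_const_mul,
    L2.inner_def]

theorem integral_limitWeight (hopen : IsOpen Q₀) (hbdry : volume (frontier Q₀) = 0)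
    (v b : Lp Jet 2 (cellMeasure N)) :
    ∫ y, limitWeight Q₀ ε₀ ε₁ y (v y).val (b y).val ∂(cellMeasure N) =
      ε₁ * inner ℂ (mulOp _ (isBddFamily_weight_cell (ε₀ := ε₀) (ε₁ := ε₁) hopen) b) v := by
  rw [integral_congr_ae (ae_limitWeight_eq hopen hbdry v b), integral_const_mul, L2.inner_def]

theorem integral_limitWeight_data (hopen : IsOpen Q₀) (hbdry : volume (frontier Q₀) = 0)
    (a : Lp C2 2 (cellMeasure N)) (b : Lp Jet 2 (cellMeasure N)) :
    ∫ y, limitWeight Q₀ ε₀ ε₁ y (a y) (b y).val ∂(cellMeasure N) =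
      ε₁ * inner ℂ (mulOp _ (isBddFamily_dataAdj (ε₀ := ε₀) (ε₁ := ε₁) hopen) b) a := by
  rw [integral_congr_ae (ae_limitWeight_data_eq hopen hbdry a b), integral_const_mul,
    L2.inner_def]

theorem re_mul_conj (z : ℂ) : (z * conj z).re = ‖z‖ ^ 2 := by
  rw [Complex.mul_conj, Complex.normSq_eq_norm_sq, Complex.ofReal_re]

theorem re_limitForm_add_limitWeight (y : Plane) (p : Jet) :
    (limitForm ε₀ ε₁ p p + limitWeight Q₀ ε₀ ε₁ y p.val p.val).re =
      ‖p.der 0 0‖ ^ 2 + ‖p.der 0 1‖ ^ 2 + (gam ε₀ ε₁)⁻¹ * (‖p.div‖ ^ 2 + ‖p.divPerp‖ ^ 2) +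
        ε₁ * (‖p.val 0‖ ^ 2 + ‖p.val 1‖ ^ 2 +
          gam ε₀ ε₁ * ((F0 Q₀).indicator 1 y * ‖p.val 0‖ ^ 2)) := by
  have h : chi0 Q₀ y = (((F0 Q₀).indicator 1 y : ℝ) : ℂ) := by
    by_cases hy : y ∈ F0 Q₀ <;> simp [chi0, hy]
  rw [limitForm, limitWeight, h]
  simp only [cdot, Fin.sum_univ_two, Complex.add_re, Complex.re_ofReal_mul, mul_assoc,
    re_mul_conj]

/-- A sum of non-negative terms vanishes only if each does; `∇v₁`, the two divergences and the
values together determine the whole jet. -/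
theorem eq_zero_of_re_eq_zero (hε₁ : 0 < ε₁) (hε₀ : ε₁ < ε₀) {y : Plane} {p : Jet}
    (h : (limitForm ε₀ ε₁ p p + limitWeight Q₀ ε₀ ε₁ y p.val p.val).re = 0) : p = 0 := by
  have hg : 0 < gam ε₀ ε₁ := sub_pos.2 ((one_lt_div hε₁).2 hε₀)
  have hi : (0 : ℝ) ≤ (F0 Q₀).indicator 1 y := Set.indicator_nonneg (by simp) y
  rw [re_limitForm_add_limitWeight] at h
  have hgi := inv_pos.2 hg
  have e : ∀ {z : ℂ}, ‖z‖ ^ 2 ≤ 0 → z = 0 := fun {z} hz => by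
    have := sq_nonneg ‖z‖
    simpa using le_antisymm hz this
  have t1 := sq_nonneg ‖p.der 0 0‖
  have t2 := sq_nonneg ‖p.der 0 1‖
  have t3 := mul_nonneg hgi.le (sq_nonneg ‖p.div‖)
  have t4 := mul_nonneg hgi.le (sq_nonneg ‖p.divPerp‖)
  have t5 := mul_nonneg hε₁.le (sq_nonneg ‖p.val 0‖)
  have t6 := mul_nonneg hε₁.le (sq_nonneg ‖p.val 1‖)
  have t7 := mul_nonneg hε₁.le (mul_nonneg hg.le (mul_nonneg hi (sq_nonneg ‖p.val 0‖)))
  simp only [mul_add] at h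
  have d0 : p.der 0 0 = 0 := e (by linarith)
  have d1 : p.der 0 1 = 0 := e (by linarith)
  have d2 : p.div = 0 := e (nonpos_of_mul_nonpos_right (a := (gam ε₀ ε₁)⁻¹) (by linarith) hgi)
  have d3 : p.divPerp = 0 := e (nonpos_of_mul_nonpos_right (a := (gam ε₀ ε₁)⁻¹) (by linarith) hgi)
  have d4 : p.val 0 = 0 := e (nonpos_of_mul_nonpos_right (a := ε₁) (by linarith) hε₁)
  have d5 : p.val 1 = 0 := e (nonpos_of_mul_nonpos_right (a := ε₁) (by linarith) hε₁)
  have d6 : p.der 1 1 = 0 := by rw [Jet.div, d0, zero_add] at d2; exact d2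
  have d7 : p.der 1 0 = 0 := by rw [Jet.divPerp, d1, add_zero, neg_eq_zero] at d3; exact d3
  ext ⟨i, o⟩
  match i, o with
  | 0, none => exact d4
  | 1, none => exact d5
  | 0, some 0 => exact d0
  | 0, some 1 => exact d1
  | 1, some 0 => exact d7
  | 1, some 1 => exact d6

/-- Uniqueness for the limit problem in a cell. -/
theorem eq_zero_of_forall_inner (hopen : IsOpen Q₀) (hbdry : volume (frontier Q₀) = 0)
    (hε₁ : 0 < ε₁) (hε₀ : ε₁ < ε₀) {v : Lp Jet 2 (cellMeasure N)} (hv : v ∈ V N Q₀)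
    (h : inner ℂ (fluxCell N hopen ε₀ ε₁ (ε₁ * (1 + 1))⁻¹ (ε₀ - ε₁)⁻¹ 1 v) v +
      inner ℂ (mulOp _ (isBddFamily_weight_cell (ε₀ := ε₀) (ε₁ := ε₁) hopen) v) v = 0) :
    v = 0 := by
  set G := fluxCell N hopen ε₀ ε₁ (ε₁ * (1 + 1))⁻¹ (ε₀ - ε₁)⁻¹ 1 v with hG
  set A := mulOp _ (isBddFamily_weight_cell (N := N) (ε₀ := ε₀) (ε₁ := ε₁) hopen) v with hA
  have i1 := (L2.integrable_inner (𝕜 := ℂ) G v).const_mul (ε₁ : ℂ)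
  have i2 := (L2.integrable_inner (𝕜 := ℂ) A v).const_mul (ε₁ : ℂ)
  have hae : ∀ᵐ y ∂(cellMeasure N), (ε₁ : ℂ) * inner ℂ (G y) (v y) + ε₁ * inner ℂ (A y) (v y) =
      limitForm ε₀ ε₁ (v y) (v y) + limitWeight Q₀ ε₀ ε₁ y (v y).val (v y).val := by
    filter_upwards [ae_limitForm_eq hopen hbdry hε₁ hε₀ hv hv,
      ae_limitWeight_eq (ε₀ := ε₀) (ε₁ := ε₁) hopen hbdry v v] with y h1 h2
    rw [h1, h2]
  have i3 := ((i1.add i2).congr hae).re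
  have h0 : ∫ y, RCLike.re (limitForm ε₀ ε₁ (v y) (v y) +
      limitWeight Q₀ ε₀ ε₁ y (v y).val (v y).val) ∂(cellMeasure N) = 0 := by
    have h5 := integral_re ((i1.add i2).congr hae)
    rw [h5, ← integral_congr_ae hae, integral_add i1 i2, integral_const_mul,
      integral_const_mul, ← L2.inner_def, ← L2.inner_def, ← mul_add, h, mul_zero, map_zero]
  have hg : 0 < gam ε₀ ε₁ := sub_pos.2 ((one_lt_div hε₁).2 hε₀)
  rw [integral_eq_zero_iff_of_nonneg (fun y => ?_) i3] at h0
  · refine Lp.ext ?_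
    filter_upwards [h0, Lp.coeFn_zero Jet 2 (cellMeasure N)] with y h1 h2
    rw [h2]
    exact eq_zero_of_re_eq_zero hε₁ hε₀ h1
  · have hi : (0 : ℝ) ≤ (F0 Q₀).indicator 1 y := Set.indicator_nonneg (by simp) y
    have h6 := re_limitForm_add_limitWeight (Q₀ := Q₀) (ε₀ := ε₀) (ε₁ := ε₁) y (v y)
    simp only [Pi.zero_apply]
    refine le_of_le_of_eq ?_ h6.symm
    positivity

end CellProblem

/-! ### Comparison of the two notions of two-scale convergence -/

section TestVectors

variable {N : Fin 2 → ℕ} {ι : Type*} [Fintype ι]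

theorem memLp_two_apply {X : Type*} [MeasurableSpace X] {μ : Measure X}
    {g : X → EuclideanSpace ℂ ι} (hg : MemLp g 2 μ) (i : ι) : MemLp (fun x => g x i) 2 μ :=
  (EuclideanSpace.proj (𝕜 := ℂ) i).comp_memLp' hg

variable [DecidableEq ι]

theorem continuous_single_conj (i : ι) {ψ : Plane → ℂ} (hψ : Continuous ψ) :
    Continuous fun y => EuclideanSpace.single i (conj (ψ y)) := by
  have h : (fun y => EuclideanSpace.single i (conj (ψ y))) =
      fun y => conj (ψ y) • (EuclideanSpace.single i 1 : EuclideanSpace ℂ ι) := by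
    ext y j
    by_cases hj : j = i <;> simp [hj]
  rw [h]
  exact (Complex.continuous_conj.comp hψ).smul continuous_const

/-- The function `conj ψ` in the `i`-th coordinate, as an element of `L²(NQ)`. -/
def testVec (N : Fin 2 → ℕ) (i : ι) {ψ : Plane → ℂ} (hψ : Continuous ψ) :
    Lp (EuclideanSpace ℂ ι) 2 (cellMeasure N) :=
  (memLp_cell_of_continuous (continuous_single_conj i hψ)).toLp _

theorem coeFn_testVec (i : ι) {ψ : Plane → ℂ} (hψ : Continuous ψ) :
    testVec N i hψ =ᵐ[cellMeasure N] fun y => EuclideanSpace.single i (conj (ψ y)) :=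
  MemLp.coeFn_toLp _

theorem inner_single_conj (i : ι) (a : ℂ) (v : EuclideanSpace ℂ ι) :
    inner ℂ (EuclideanSpace.single i (conj a)) v = a * v i := by
  rw [EuclideanSpace.inner_single_left, Complex.conj_conj]

theorem inner_testVec (i : ι) {ψ : Plane → ℂ} (hψ : Continuous ψ)
    (w : Lp (EuclideanSpace ℂ ι) 2 (cellMeasure N)) :
    inner ℂ (testVec N i hψ) w = ∫ y, ψ y * w y i ∂(cellMeasure N) := by
  rw [L2.inner_def]
  refine integral_congr_ae ?_
  filter_upwards [coeFn_testVec (N := N) i hψ] with y hy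
  rw [hy, inner_single_conj]

theorem IsCellPeriodic.apply_wrap {E : Type*} {v : Plane → E} (hv : IsCellPeriodic N v)
    (y : Plane) : v (wrap N y) = v y := by
  conv_rhs => rw [← shift_add_wrap (N := N) y, hv.shift_add]

theorem osc_testVec (hN : ∀ i, 0 < N i) {ε : ℝ} (hε : 0 < ε) (η : Plane → ℂ) (i : ι)
    {ψ : Plane → ℂ} (hψ : Continuous ψ) (hp : IsCellPeriodic N ψ)
    (U : Lp (EuclideanSpace ℂ ι) 2 (volume : Measure Plane)) :
    osc N ε η (testVec N i hψ) U = ∫ z, U z i * η z * ψ (ε⁻¹ • z) := by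
  refine integral_congr_ae ?_
  filter_upwards [(quasiMeasurePreserving_wrap hN hε).ae (coeFn_testVec (N := N) i hψ)] with z hz
  rw [hz, inner_single_conj, hp.apply_wrap]
  ring

theorem coe_area : (area N : ℂ) = (N 0 : ℂ) * (N 1 : ℂ) := by
  rw [area]
  push_cast
  rfl

/-- The scalar test functions `φ(x) ψ(x/ε)` are the special case of the vector `conj ψ` in one
coordinate. -/
theorem TS.twoScaleConverges (hN : ∀ i, 0 < N i) {δ : ℕ → ℝ} (hδ : ∀ n, 0 < δ n)
    {U : ℕ → Lp (EuclideanSpace ℂ ι) 2 (volume : Measure Plane)} {C : ℝ}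
    (hC : ∀ n, ‖U n‖ ≤ C) {W : Lp (Lp (EuclideanSpace ℂ ι) 2 (cellMeasure N)) 2
      (volume : Measure Plane)} (h : TS N δ U W) (i : ι) :
    TwoScaleConverges N δ (fun n x => U n x i) (fun x y => W x y i) := by
  refine ⟨⟨C.toNNReal, fun n => ⟨memLp_two_apply (Lp.memLp _) i, ?_⟩⟩, ?_⟩
  · have h1 : eLpNorm (fun x => U n x i) 2 volume ≤ eLpNorm (U n) 2 volume :=
      eLpNorm_mono fun x => PiLp.norm_apply_le _ i
    refine h1.trans ?_
    rw [← Lp.enorm_def, ← ofReal_norm]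
    exact ENNReal.ofReal_le_ofReal (hC n)
  · intro φ hφ hφc ψ hψ hp
    have h1 := h φ hφ.continuous hφc (testVec N i hψ.continuous)
    have h2 : ∀ x, ∫ y, W x y i * φ x * ψ y ∂(cellMeasure N) =
        φ x * inner ℂ (testVec N i hψ.continuous) (W x) := fun x => by
      rw [inner_testVec, ← integral_const_mul]
      refine integral_congr_ae (Eventually.of_forall fun y => ?_)
      ring
    simp only [h2]
    rw [← coe_area]
    exact h1.congr fun n => osc_testVec hN (hδ n) φ i hψ.continuous hp (U n)

end TestVectors

/-! ### Identification of the limit of the data -/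

section Identification

variable {N : Fin 2 → ℕ}

theorem exists_norm_le_of_twoScaleConverges {δ : ℕ → ℝ}
    {U : ℕ → Lp C2 2 (volume : Measure Plane)} {g : Fin 2 → Plane → Plane → ℂ}
    (h : ∀ i, TwoScaleConverges N δ (fun n x => U n x i) (g i)) :
    ∃ C : ℝ, ∀ n, ‖U n‖ ≤ C := by
  obtain ⟨C0, h0⟩ := (h 0).1
  obtain ⟨C1, h1⟩ := (h 1).1
  refine ⟨C0 + C1, fun n => ?_⟩
  have h2 : eLpNorm (U n) 2 volume ≤ C0 + C1 := by
    have e1 : eLpNorm (U n) 2 volume ≤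
        eLpNorm (fun x => ‖U n x 0‖ + ‖U n x 1‖) 2 volume := by
      refine eLpNorm_mono fun x => ?_
      have hs := sq_norm_C2 (U n x)
      have n0 := norm_nonneg (U n x 0)
      have n1 := norm_nonneg (U n x 1)
      rw [Real.norm_of_nonneg (add_nonneg n0 n1)]
      refine abs_le_of_sq_le_sq' ?_ (add_nonneg n0 n1) |>.2
      nlinarith [mul_nonneg n0 n1]
    refine e1.trans ((eLpNorm_add_le (h0 n).1.norm.1 (h1 n).1.norm.1 (by norm_num)).trans ?_)
    rw [eLpNorm_norm, eLpNorm_norm]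
    exact add_le_add (h0 n).2 (h1 n).2
  rw [Lp.norm_def]
  have h3 := ENNReal.toReal_mono (by simp) h2
  rwa [← ENNReal.coe_add, ENNReal.coe_toReal, NNReal.coe_add] at h3

/-- Over a compact set of `x` the product measure is finite, so `ψ` is square integrable there too
and Hölder and Fubini apply. -/
theorem locallyIntegrable_integral_mul {f : Plane × Plane → ℂ} {ψ : Plane → ℂ}
    (hf : MemLp f 2 ((volume : Measure Plane).prod (cellMeasure N))) (hψ : Continuous ψ) :
    LocallyIntegrable (fun x => ∫ y, f (x, y) * ψ y ∂(cellMeasure N)) volume := by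
  rw [MeasureTheory.locallyIntegrable_iff]
  intro K hK
  have : IsFiniteMeasure ((volume : Measure Plane).restrict K) :=
    ⟨by simpa using hK.measure_lt_top⟩
  have h1 : MemLp f 2 (((volume : Measure Plane).restrict K).prod (cellMeasure N)) := by
    have e : ((volume : Measure Plane).restrict K).prod (cellMeasure N) =
        ((volume : Measure Plane).prod (cellMeasure N)).restrict (K ×ˢ Set.univ) := by
      rw [← Measure.prod_restrict, Measure.restrict_univ]
    rw [e]
    exact hf.restrict _
  have h2 : MemLp (fun z : Plane × Plane => ψ z.2) 2
      (((volume : Measure Plane).restrict K).prod (cellMeasure N)) :=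
    (memLp_cell_of_continuous hψ).comp_snd _
  exact (h1.integrable_mul h2).integral_prod_left

theorem ae_memLp_prod_right {f : Plane × Plane → C2}
    (hf : MemLp f 2 ((volume : Measure Plane).prod (cellMeasure N))) :
    ∀ᵐ x, MemLp (fun y => f (x, y)) 2 (cellMeasure N) := by
  have h1 := (hf.integrable_norm_pow (by simp)).prod_right_ae
  filter_upwards [h1, hf.1.prodMk_left] with x hx hm
  refine (memLp_two_iff_integrable_sq_norm hm).2 ?_
  simpa using hx

/-- Both limits are tested with the smooth periodic exponentials. There are countably many, so for
almost every `x` all Fourier coefficients in `y` agree, and completeness finishes. -/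
theorem TS.ae_eq (hN : ∀ i, 0 < N i) {δ : ℕ → ℝ} (hδ : ∀ n, 0 < δ n)
    {U : ℕ → Lp C2 2 (volume : Measure Plane)}
    {F : Lp (Lp C2 2 (cellMeasure N)) 2 (volume : Measure Plane)} (hF : TS N δ U F)
    (f : Lp C2 2 ((volume : Measure Plane).prod (cellMeasure N)))
    (h : ∀ i, TwoScaleConverges N δ (fun n x => U n x i) (fun x y => f (x, y) i)) :
    ∀ᵐ x, ∀ᵐ y ∂(cellMeasure N), F x y = f (x, y) := by
  have hc : ∀ m, Continuous (expo N m) := fun m => (contDiff_expo m).continuous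
  have h1 : ∀ᵐ x, ∀ (m : Fin 2 → ℤ) (i : Fin 2), inner ℂ (testVec N i (hc m)) (F x) -
      ∫ y, f (x, y) i * expo N m y ∂(cellMeasure N) = 0 := by
    rw [ae_all_iff]
    intro m
    rw [ae_all_iff]
    intro i
    have l1 : LocallyIntegrable (fun x => inner ℂ (testVec N i (hc m)) (F x)) volume :=
      (memLp_inner_const _ F).locallyIntegrable (by simp)
    have l2 := locallyIntegrable_integral_mul (memLp_two_apply (Lp.memLp f) i) (hc m)
    refine ae_eq_zero_of_integral_contDiff_smul_eq_zero (l1.sub l2) fun φ hφ hφc => ?_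
    have hη : ContDiff ℝ ∞ fun x => (φ x : ℂ) := Complex.ofRealCLM.contDiff.comp hφ
    have hηc : HasCompactSupport fun x => (φ x : ℂ) :=
      hφc.comp_left (g := fun t : ℝ => (t : ℂ)) (by simp)
    have t1 := hF _ hη.continuous hηc (testVec N i (hc m))
    have t2 := (h i).2 _ hη hηc _ (contDiff_expo m) (isCellPeriodic_expo hN m)
    have t3 := tendsto_nhds_unique (t1.congr fun n =>
      osc_testVec hN (hδ n) _ i (hc m) (isCellPeriodic_expo hN m) (U n)) t2
    rw [← coe_area] at t3
    have ha : (area N : ℂ)⁻¹ ≠ 0 := inv_ne_zero (by exact_mod_cast (area_pos hN).ne')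
    have t4 := mul_left_cancel₀ ha t3
    have h2 : ∀ x, ∫ y, f (x, y) i * (φ x : ℂ) * expo N m y ∂(cellMeasure N) =
        φ x • ∫ y, f (x, y) i * expo N m y ∂(cellMeasure N) := fun x => by
      rw [Complex.real_smul, ← integral_const_mul]
      refine integral_congr_ae (Eventually.of_forall fun y => ?_)
      ring
    simp only [h2, ← Complex.real_smul] at t4
    simp only [smul_sub]
    rw [integral_sub, t4, sub_self]
    · exact l1.integrable_smul_left_of_hasCompactSupport hφ.continuous hφc
    · exact l2.integrable_smul_left_of_hasCompactSupport hφ.continuous hφc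
  filter_upwards [h1, ae_memLp_prod_right (Lp.memLp f)] with x hx hm
  have h3 : ∀ i, ∀ᵐ y ∂(cellMeasure N), F x y i - f (x, y) i = 0 := by
    intro i
    have i1 : Integrable (fun y => F x y i) (cellMeasure N) :=
      (memLp_two_apply (Lp.memLp (F x)) i).integrable (by simp)
    have i2 : Integrable (fun y => f (x, y) i) (cellMeasure N) :=
      (memLp_two_apply hm i).integrable (by simp)
    refine ae_eq_zero_of_expo hN (i1.sub i2) fun m => ?_
    have hb := (memLp_cell_of_continuous (N := N) (hc m))
    have j1 : Integrable (fun y => expo N m y * F x y i) (cellMeasure N) :=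
      hb.integrable_mul (memLp_two_apply (Lp.memLp (F x)) i)
    have j2 : Integrable (fun y => expo N m y * f (x, y) i) (cellMeasure N) :=
      hb.integrable_mul (memLp_two_apply hm i)
    have := hx m i
    rw [inner_testVec] at this
    simp only [mul_sub]
    rw [integral_sub j1 j2, ← this]
    simp only [mul_comm]
  filter_upwards [h3 0, h3 1] with y h4 h5
  ext i
  fin_cases i
  · exact sub_eq_zero.1 h4
  · exact sub_eq_zero.1 h5

end Identification

/-! ### Existence and uniqueness for the limit problem -/

section LimitSolutions

variable {N : Fin 2 → ℕ} {Q₀ : Set Plane} {ε₀ ε₁ : ℝ}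

theorem mem_V_iff {v : Lp Jet 2 (cellMeasure N)} : v ∈ V N Q₀ ↔
    v ∈ H1Per N ∧ mulOp _ (isBddFamily_chi1 Q₀ divOp) v = 0 := by
  refine ⟨fun h => ⟨h.1, Lp.ext ?_⟩, fun h => mem_V_of_div h.1 h.2⟩
  filter_upwards [coeFn_mulOp (isBddFamily_chi1 (N := N) Q₀ divOp) v, ae_divOp_eq_zero h,
    Lp.coeFn_zero C2 2 (cellMeasure N)] with y h1 h2 h3
  rw [h1, h3, smul_apply]
  by_cases hy : y ∈ F1 Q₀
  · rw [h2 hy, smul_zero]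
    rfl
  · simp [chi1, hy]

theorem isClosed_V : IsClosed (V N Q₀ : Set (Lp Jet 2 (cellMeasure N))) := by
  have h : (V N Q₀ : Set (Lp Jet 2 (cellMeasure N))) =
      (H1Per N : Set (Lp Jet 2 (cellMeasure N))) ∩
        {v | mulOp _ (isBddFamily_chi1 Q₀ divOp) v = 0} := by
    ext v
    exact mem_V_iff
  rw [h]
  exact (Submodule.isClosed_topologicalClosure _).inter
    (isClosed_eq (ContinuousLinearMap.continuous _) continuous_const)

/-- Composition with the orthogonal projection onto the closed space `V N Q₀` yields a measurable
lift, and it fixes the values already in that space. -/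
theorem exists_Lp_V {W : Lp (Lp Jet 2 (cellMeasure N)) 2 (volume : Measure Plane)}
    (hW : ∀ᵐ x, W x ∈ V N Q₀) :
    ∃ u₀ : Lp (V N Q₀) 2 (volume : Measure Plane), ∀ᵐ x, (u₀ x).1 = W x := by
  have : CompleteSpace (V N Q₀) := isClosed_V.completeSpace_coe
  refine ⟨(V N Q₀).orthogonalProjectionOnto.compLp W, ?_⟩
  filter_upwards [(V N Q₀).orthogonalProjectionOnto.coeFn_compLp W, hW] with x h1 h2
  rw [h1]
  exact congrArg Subtype.val
    (Submodule.orthogonalProjectionOnto_mem_subspace_eq_self (⟨W x, h2⟩ : V N Q₀))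

theorem memLp_coe_V (w : Lp (V N Q₀) 2 (volume : Measure Plane)) :
    MemLp (fun x => (w x).1) 2 volume :=
  (V N Q₀).subtypeL.comp_memLp' (Lp.memLp w)

theorem integrable_inner_of_memLp {X H : Type*} [MeasurableSpace X] {μ : Measure X}
    [NormedAddCommGroup H] [InnerProductSpace ℂ H] {g h : X → H} (hg : MemLp g 2 μ)
    (hh : MemLp h 2 μ) : Integrable (fun x => inner ℂ (g x) (h x)) μ := by
  refine (L2.integrable_inner (𝕜 := ℂ) (hg.toLp g) (hh.toLp h)).congr ?_
  filter_upwards [hg.coeFn_toLp, hh.coeFn_toLp] with x h1 h2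
  rw [h1, h2]

/-- The operator of the limit problem. -/
def limitOp (N : Fin 2 → ℕ) (hopen : IsOpen Q₀) (ε₀ ε₁ : ℝ) :
    Lp Jet 2 (cellMeasure N) →L[ℂ] Lp Jet 2 (cellMeasure N) :=
  fluxCell N hopen ε₀ ε₁ (ε₁ * (1 + 1))⁻¹ (ε₀ - ε₁)⁻¹ 1 +
    mulOp _ (isBddFamily_weight_cell (ε₀ := ε₀) (ε₁ := ε₁) hopen)

theorem memLp_comp_test {F : Type*} [NormedAddCommGroup F] [NormedSpace ℂ F]
    (T : Lp Jet 2 (cellMeasure N) →L[ℂ] F) {φ : Plane → V N Q₀} (hφ : Continuous φ)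
    (hc : HasCompactSupport φ) : MemLp (fun x => T (φ x).1) 2 (volume : Measure Plane) :=
  (T.continuous.comp (continuous_subtype_val.comp hφ)).memLp_of_hasCompactSupport
    (hc.comp_left (g := fun v : V N Q₀ => T v.1) (by simp))

theorem integral_limit_eq (hopen : IsOpen Q₀) (hbdry : volume (frontier Q₀) = 0)
    (hε₁ : 0 < ε₁) (hε₀ : ε₁ < ε₀) (w : Lp (V N Q₀) 2 (volume : Measure Plane))
    {φ : Plane → V N Q₀} (hφ : Continuous φ) (hc : HasCompactSupport φ) :
    (∫ x, ∫ y, limitForm ε₀ ε₁ ((w x).1 y) ((φ x).1 y) ∂(cellMeasure N)) +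
      (∫ x, ∫ y, limitWeight Q₀ ε₀ ε₁ y ((w x).1 y).val ((φ x).1 y).val ∂(cellMeasure N)) =
    ε₁ * ∫ x, inner ℂ (limitOp N hopen ε₀ ε₁ (φ x).1) (w x).1 := by
  have i1 := integrable_inner_of_memLp (memLp_comp_test (fluxCell N hopen ε₀ ε₁
    (ε₁ * (1 + 1))⁻¹ (ε₀ - ε₁)⁻¹ 1) hφ hc) (memLp_coe_V w)
  have i2 := integrable_inner_of_memLp (memLp_comp_test
    (mulOp _ (isBddFamily_weight_cell (ε₀ := ε₀) (ε₁ := ε₁) hopen)) hφ hc) (memLp_coe_V w)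
  simp only [integral_limitForm hopen hbdry hε₁ hε₀ (w _).2 (φ _).2,
    integral_limitWeight hopen hbdry]
  rw [integral_const_mul, integral_const_mul, ← mul_add, ← integral_add i1 i2]
  simp only [limitOp, add_apply, inner_add_left]

theorem integral_data_eq (hopen : IsOpen Q₀) (hbdry : volume (frontier Q₀) = 0)
    {f : Lp C2 2 ((volume : Measure Plane).prod (cellMeasure N))}
    {F : Lp (Lp C2 2 (cellMeasure N)) 2 (volume : Measure Plane)}
    (hF : ∀ᵐ x, ∀ᵐ y ∂(cellMeasure N), F x y = f (x, y)) (φ : Plane → V N Q₀) :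
    ∫ x, ∫ y, limitWeight Q₀ ε₀ ε₁ y (f (x, y)) ((φ x).1 y).val ∂(cellMeasure N) =
      ε₁ * ∫ x, inner ℂ (mulOp _ (isBddFamily_dataAdj (ε₀ := ε₀) (ε₁ := ε₁) hopen) (φ x).1)
        (F x) := by
  rw [← integral_const_mul]
  refine integral_congr_ae ?_
  filter_upwards [hF] with x hx
  rw [← integral_limitWeight_data hopen hbdry]
  refine integral_congr_ae ?_
  filter_upwards [hx] with y hy
  rw [hy]

theorem isLimitSolution_of_ae (hopen : IsOpen Q₀) (hbdry : volume (frontier Q₀) = 0)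
    (hε₁ : 0 < ε₁) (hε₀ : ε₁ < ε₀)
    {f : Lp C2 2 ((volume : Measure Plane).prod (cellMeasure N))}
    {F : Lp (Lp C2 2 (cellMeasure N)) 2 (volume : Measure Plane)}
    (hF : ∀ᵐ x, ∀ᵐ y ∂(cellMeasure N), F x y = f (x, y))
    {w : Lp (V N Q₀) 2 (volume : Measure Plane)}
    (h : ∀ᵐ x, ∀ b : V N Q₀, inner ℂ (limitOp N hopen ε₀ ε₁ b.1) (w x).1 =
      inner ℂ (mulOp _ (isBddFamily_dataAdj (ε₀ := ε₀) (ε₁ := ε₁) hopen) b.1) (F x)) :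
    IsLimitSolution N Q₀ ε₀ ε₁ f w := by
  intro φ hφ hc
  rw [integral_limit_eq hopen hbdry hε₁ hε₀ w hφ.continuous hc,
    integral_data_eq hopen hbdry hF φ]
  congr 1
  refine integral_congr_ae ?_
  filter_upwards [h] with x hx
  exact hx (φ x)

/-- Test functions `conj η · b` localize the difference of the two equations to almost every `x`.
There the difference of the solutions is itself an admissible `b`, and definiteness applies. -/
theorem IsLimitSolution.unique (hopen : IsOpen Q₀) (hbdry : volume (frontier Q₀) = 0)
    (hε₁ : 0 < ε₁) (hε₀ : ε₁ < ε₀)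
    {f : Lp C2 2 ((volume : Measure Plane).prod (cellMeasure N))}
    {w u : Lp (V N Q₀) 2 (volume : Measure Plane)}
    (hw : IsLimitSolution N Q₀ ε₀ ε₁ f w) (hu : IsLimitSolution N Q₀ ε₀ ε₁ f u) : w = u := by
  have hc : (ε₁ : ℂ) ≠ 0 := by exact_mod_cast hε₁.ne'
  have h1 : ∀ᵐ x, ∀ b : V N Q₀,
      inner ℂ (limitOp N hopen ε₀ ε₁ b.1) ((w x).1 - (u x).1) = 0 := by
    refine ae_forall_eq_zero (fun x => (((ContinuousLinearMap.continuous _).comp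
      continuous_subtype_val).inner continuous_const)) fun b => ?_
    refine ae_eq_zero_of_integral_smooth_mul
      (((memLp_coe_V w).sub (memLp_coe_V u)).const_inner _) fun η hη hηc => ?_
    have hφ : ContDiff ℝ ∞ fun x => conj (η x) • b :=
      ((Complex.conjCLE : ℂ →L[ℝ] ℂ).contDiff.comp hη).smul contDiff_const
    have hφc : HasCompactSupport fun x => conj (η x) • b :=
      hηc.comp_left (g := fun a : ℂ => conj a • b) (by simp)
    have h2 := (hw _ hφ hφc).trans (hu _ hφ hφc).symm
    rw [integral_limit_eq hopen hbdry hε₁ hε₀ w hφ.continuous hφc,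
      integral_limit_eq hopen hbdry hε₁ hε₀ u hφ.continuous hφc] at h2
    have h3 := mul_left_cancel₀ hc h2
    have i1 := integrable_inner_of_memLp (memLp_comp_test (limitOp N hopen ε₀ ε₁)
      hφ.continuous hφc) (memLp_coe_V w)
    have i2 := integrable_inner_of_memLp (memLp_comp_test (limitOp N hopen ε₀ ε₁)
      hφ.continuous hφc) (memLp_coe_V u)
    rw [← sub_eq_zero, ← integral_sub i1 i2] at h3
    rw [← h3]
    refine integral_congr_ae (Eventually.of_forall fun x => ?_)
    simp only [Submodule.coe_smul, map_smul, inner_smul_left, Complex.conj_conj, inner_sub_right,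
      mul_sub]
  refine Lp.ext ?_
  filter_upwards [h1] with x hx
  have h2 := hx (w x - u x)
  have h3 : (w x - u x : V N Q₀).1 = 0 := by
    refine eq_zero_of_forall_inner hopen hbdry hε₁ hε₀ (w x - u x).2 ?_
    rw [← inner_add_left]
    exact h2
  exact sub_eq_zero.1 (Subtype.ext h3)

end LimitSolutions

/-! ### Subsequences and almost everywhere modifications -/

section Sequences

variable {N : Fin 2 → ℕ}

theorem TwoScaleConverges.comp {δ : ℕ → ℝ} {w : ℕ → Plane → ℂ} {g : Plane → Plane → ℂ}
    (h : TwoScaleConverges N δ w g) {k : ℕ → ℕ} (hk : StrictMono k) :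
    TwoScaleConverges N (δ ∘ k) (w ∘ k) g :=
  ⟨h.1.imp fun _ hC n => hC (k n),
    fun φ hφ hc ψ hψ hp => (h.2 φ hφ hc ψ hψ hp).comp hk.tendsto_atTop⟩

theorem TwoScaleConverges.congr {δ : ℕ → ℝ} {w w' : ℕ → Plane → ℂ} {g g' : Plane → Plane → ℂ}
    (h : TwoScaleConverges N δ w g) (hw : ∀ n, w n =ᵐ[volume] w' n) (hg : ∀ᵐ x, g x = g' x) :
    TwoScaleConverges N δ w' g' := by
  refine ⟨h.1.imp fun C hC n => ⟨(hC n).1.ae_eq (hw n), ?_⟩, fun φ hφ hc ψ hψ hp => ?_⟩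
  · rw [← eLpNorm_congr_ae (hw n)]
    exact (hC n).2
  · have h1 : ∫ x, ∫ y, g x y * φ x * ψ y ∂(cellMeasure N) =
        ∫ x, ∫ y, g' x y * φ x * ψ y ∂(cellMeasure N) := by
      refine integral_congr_ae ?_
      filter_upwards [hg] with x hx
      rw [hx]
    rw [← h1]
    refine (h.2 φ hφ hc ψ hψ hp).congr fun n => integral_congr_ae ?_
    filter_upwards [hw n] with x hx
    rw [hx]

end Sequences

/-! ### Extraction of the limit from bounded sequences -/

section Compactness

variable {N : Fin 2 → ℕ} {Q₀ : Set Plane} {ε₀ ε₁ : ℝ}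

theorem exists_common_subseq_TS {E E' E'' : Type*} [NormedAddCommGroup E]
    [InnerProductSpace ℂ E] [CompleteSpace E] [TopologicalSpace.SeparableSpace E]
    [NormedAddCommGroup E'] [InnerProductSpace ℂ E'] [CompleteSpace E']
    [TopologicalSpace.SeparableSpace E'] [NormedAddCommGroup E''] [InnerProductSpace ℂ E'']
    [CompleteSpace E''] [TopologicalSpace.SeparableSpace E'']
    (hN : ∀ i, 0 < N i) {δ : ℕ → ℝ} (hδ : ∀ n, 0 < δ n)
    (hδ0 : Tendsto δ atTop (𝓝 0)) {U : ℕ → Lp E 2 (volume : Measure Plane)}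
    {P : ℕ → Lp E' 2 (volume : Measure Plane)} {f : ℕ → Lp E'' 2 (volume : Measure Plane)}
    {C B : ℝ} (hU : ∀ n, ‖U n‖ ≤ C) (hP : ∀ n, ‖P n‖ ≤ C) (hf : ∀ n, ‖f n‖ ≤ B) :
    ∃ k : ℕ → ℕ, StrictMono k ∧
      (∃ W : Lp (Lp E 2 (cellMeasure N)) 2 (volume : Measure Plane), TS N (δ ∘ k) (U ∘ k) W) ∧
      (∃ Y : Lp (Lp E' 2 (cellMeasure N)) 2 (volume : Measure Plane), TS N (δ ∘ k) (P ∘ k) Y) ∧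
      ∃ F : Lp (Lp E'' 2 (cellMeasure N)) 2 (volume : Measure Plane),
        TS N (δ ∘ k) (f ∘ k) F := by
  obtain ⟨W, k₁, hk₁, hW⟩ := exists_subseq_TS hN hδ hδ0 U C hU
  obtain ⟨Y, k₂, hk₂, hY⟩ := exists_subseq_TS hN (fun n => hδ (k₁ n))
    (hδ0.comp hk₁.tendsto_atTop) (P ∘ k₁) C fun n => hP _
  obtain ⟨F, k₃, hk₃, hF⟩ := exists_subseq_TS hN (fun n => hδ (k₁ (k₂ n)))
    (hδ0.comp (hk₁.comp hk₂).tendsto_atTop) (f ∘ k₁ ∘ k₂) B fun n => hf _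
  exact ⟨k₁ ∘ k₂ ∘ k₃, hk₁.comp (hk₂.comp hk₃), ⟨W, hW.comp (hk₂.comp hk₃)⟩,
    ⟨Y, hY.comp hk₃⟩, F, hF⟩

theorem exists_limit_of_bounded (hN : ∀ i, 0 < N i) (hopen : IsOpen Q₀) (hne : Q₀.Nonempty)
    (hsub : closure Q₀ ⊆ cell 1) (hbdry : volume (frontier Q₀) = 0) (hε₁ : 0 < ε₁)
    (hε₀ : ε₁ < ε₀) {δ : ℕ → ℝ} (hδ : ∀ n, 0 < δ n) (hδ0 : Tendsto δ atTop (𝓝 0))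
    (hδ1 : ∀ n, δ n ^ 2 ≤ ε₁) {fδ : ℕ → Lp C2 2 (volume : Measure Plane)} {B C : ℝ}
    (hB : ∀ n, ‖fδ n‖ ≤ B) {f : Lp C2 2 ((volume : Measure Plane).prod (cellMeasure N))}
    (hf : ∀ i, TwoScaleConverges N δ (fun n x => fδ n x i) (fun x y => f (x, y) i))
    {u : ℕ → H1Plane} (hu : ∀ n, IsResolventSolution Q₀ ε₀ ε₁ (δ n) (fδ n) (u n))
    (hU : ∀ n, ‖scaleJet (δ n) (u n).1‖ ≤ C) (hP : ∀ n, ‖divPhase Q₀ (δ n) (u n).1‖ ≤ C) :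
    ∃ u₀ : Lp (V N Q₀) 2 (volume : Measure Plane),
      (∃ k : ℕ → ℕ, StrictMono k ∧
        ∀ i, TwoScaleConverges N (δ ∘ k) (fun n x => ((u (k n)).1 x).val i)
          (fun x y => ((u₀ x).1 y).val i)) ∧
      IsLimitSolution N Q₀ ε₀ ε₁ f u₀ := by
  obtain ⟨k, hk, ⟨W, hW⟩, ⟨Y, hY⟩, F, hF⟩ := exists_common_subseq_TS hN hδ hδ0 hU hP hB
  have hδk : ∀ n, 0 < (δ ∘ k) n := fun n => hδ _
  have hδk0 : Tendsto (δ ∘ k) atTop (𝓝 0) := hδ0.comp hk.tendsto_atTop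
  have hW' : TS N (δ ∘ k) (fun n => scaleJet ((δ ∘ k) n) ((u ∘ k) n).1) W := hW
  have hY' : TS N (δ ∘ k) (fun n => divPhase Q₀ ((δ ∘ k) n) ((u ∘ k) n).1) Y := hY
  have hFf := hF.ae_eq hN hδk f fun i => (hf i).comp hk
  have hWV : ∀ᵐ x, W x ∈ V N Q₀ := by
    filter_upwards [ae_mem_H1Per hN hδk hδk0 hW', ae_chi1_div_eq_zero hN hδk hδk0 hW' hY']
      with x h1 h2
    exact mem_V_of_div h1 h2
  obtain ⟨u₀, hu₀⟩ := exists_Lp_V hWV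
  refine ⟨u₀, ⟨k, hk, fun i => ?_⟩, isLimitSolution_of_ae hopen hbdry hε₁ hε₀ hFf ?_⟩
  -- Scaling by `ε` changes only the derivative coordinates, so the coordinate `(i, none)` of the
  -- limit is the limit of `u` itself.
  · refine (hW'.twoScaleConverges hN hδk (fun n => hU (k n)) (i, none)).congr (fun n => ?_) ?_
    · filter_upwards [coeFn_scaleJet (δ (k n)) (u (k n)).1] with x hx
      rw [hx]
      simp [Jet.val]
    · filter_upwards [hu₀] with x hx
      rw [hx]
      rfl
  · filter_upwards [ae_limit_eq hN hopen hne hsub hbdry hε₁ hε₀ hδk hδk0 (fun n => hδ1 _)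
      (fun n => hu (k n)) (fun n => hU (k n)) hW' hY' hF, hu₀] with x h1 h2 b
    rw [h2, ← sub_eq_zero, ← h1 b, limitOp, add_apply, inner_add_left]

end Compactness

end PhotonicFibre
end

/-! ### The homogenization theorem -/

theorem mainTheorem5 (N : Fin 2 → ℕ) (hN : ∀ i, 0 < N i)
    (Q₀ : Set Plane) (hopen : IsOpen Q₀) (hne : Q₀.Nonempty) (hsub : closure Q₀ ⊆ cell 1)
    (hbdry : volume (frontier Q₀) = 0)
    (ε₀ ε₁ : ℝ) (hε₁ : 0 < ε₁) (hε₀ : ε₁ < ε₀)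
    (δ : ℕ → ℝ) (hδ : ∀ n, 0 < δ n) (hδ0 : Tendsto δ atTop (𝓝 0))
    (fδ : ℕ → Lp C2 2 (volume : Measure Plane))
    (f : Lp C2 2 ((volume : Measure Plane).prod (cellMeasure N)))
    (hf : ∀ i, TwoScaleConverges N δ (fun n x => fδ n x i) (fun x y => f (x, y) i))
    (u : ℕ → H1Plane)
    (hu : ∀ᶠ n in atTop, IsResolventSolution Q₀ ε₀ ε₁ (δ n) (fδ n) (u n)) :
    ∃ u₀ : Lp (V N Q₀) 2 (volume : Measure Plane),
      (∃ k : ℕ → ℕ, StrictMono k ∧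
        ∀ i, TwoScaleConverges N (δ ∘ k) (fun n x => ((u (k n)).1 x).val i)
          (fun x y => ((u₀ x).1 y).val i)) ∧
      IsLimitSolution N Q₀ ε₀ ε₁ f u₀ ∧
      ∀ w : Lp (V N Q₀) 2 (volume : Measure Plane),
        IsLimitSolution N Q₀ ε₀ ε₁ f w → w = u₀ := by
  obtain ⟨C, hC0, hC⟩ := exists_energy_bound (Q₀ := Q₀) hopen hbdry hε₁ hε₀
  obtain ⟨B, hB⟩ := exists_norm_le_of_twoScaleConverges hf
  have hB0 : 0 ≤ B := (norm_nonneg _).trans (hB 0)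
  have hsmall : Tendsto (fun n => δ n ^ 2) atTop (𝓝 0) := by simpa using hδ0.pow 2
  -- Beyond `n₀` the problem is solved, `δ n ≤ 1` and `δ n ^ 2 ≤ ε₁ / 2`, as the energy bound
  -- requires; the earlier terms are dropped by shifting the index.
  obtain ⟨n₀, hn₀⟩ := eventually_atTop.1 ((hu.and (hδ0.eventually (ge_mem_nhds one_pos))).and
    (hsmall.eventually (ge_mem_nhds (half_pos hε₁))))
  have hbound : ∀ n, n₀ ≤ n → ‖scaleJet (δ n) (u n).1‖ ≤ Real.sqrt (C * B ^ 2) ∧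
      ‖divPhase Q₀ (δ n) (u n).1‖ ≤ Real.sqrt (C * B ^ 2) := by
    intro n hn
    have h1 := hC (δ n) (hδ n) (hn₀ n hn).1.2 (hn₀ n hn).2 _ _ (hn₀ n hn).1.1
    have h2 : C * ‖fδ n‖ ^ 2 ≤ C * B ^ 2 :=
      mul_le_mul_of_nonneg_left (pow_le_pow_left₀ (norm_nonneg _) (hB n) 2) hC0
    exact ⟨Real.le_sqrt_of_sq_le (h1.1.trans h2), Real.le_sqrt_of_sq_le (h1.2.trans h2)⟩
  have hm₀ : StrictMono fun n : ℕ => n + n₀ := fun a b h => Nat.add_lt_add_right h n₀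
  obtain ⟨u₀, ⟨k, hk, hconv⟩, hsol⟩ := exists_limit_of_bounded hN hopen hne hsub hbdry hε₁ hε₀
    (δ := fun n => δ (n + n₀)) (fun n => hδ _) (hδ0.comp hm₀.tendsto_atTop)
    (fun n => (hn₀ _ (Nat.le_add_left _ _)).2.trans (half_le_self hε₁.le))
    (fδ := fun n => fδ (n + n₀)) (fun n => hB _) (fun i => (hf i).comp hm₀)
    (u := fun n => u (n + n₀)) (fun n => (hn₀ _ (Nat.le_add_left _ _)).1.1)
    (fun n => (hbound _ (Nat.le_add_left _ _)).1) (fun n => (hbound _ (Nat.le_add_left _ _)).2)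
  exact ⟨u₀, ⟨fun n => k n + n₀, hm₀.comp hk, hconv⟩, hsol,
    fun w hw => hw.unique hopen hbdry hε₁ hε₀ hsol⟩
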